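/- Let $G$ be a finite loopless undirected graph, possibly with parallel edges, with $n$ vertices, $m$ edges, nonnegative real edge weights and an arbitrary assignment of colors from a finite palette $\mathcal C$ to its edges and vertices. A color $c$ *damages* an edge $e=\{u,v\}$ if $e$ has color $c$ (ECFT setting, edge color faults), if $u$ or $v$ has color $c$ (VCFT setting, vertex color faults), or if at least one of $e,u,v$ has color $c$ (MCFT setting, mixed color faults). For $F\subseteq\mathcal C$ and a subgraph $H$ of $G$ on all vertices of $G$, let $H-F$ be the subgraph obtained from $H$ by deleting all edges damaged by some color of $F$. The subgraph $H$ is an *$f$-CFT $(2k-1)$-spanner* of $G$ (with respect to the chosen setting) if for every $F\subseteq \mathcal C$ with $|F|\le f$ and all vertices $u,v$, $$\operatorname{dist}_{H-F}(u,v)\le (2k-1)\cdot \operatorname{dist}_{G-F}(u,v).$$ A *$2k$-blocking set* of $H$ is a set $B$ of pairs $(e,c)$, with $e\in E(H)$ and $c$ a color that does not damage $e$, such that every cycle of $H$ with at most $2k$ edges contains, for some $(e,c)\in B$, the edge $e$ and an edge damaged by $c$. There is a single deterministic polynomial-time algorithm which, given the setting, integers $k,f\ge 1$ and a graph $G$ as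 above, outputs an $f$-CFT $(2k-1)$-spanner $H$ of $G$ whose number of edges $s$ satisfies 1. $s=O\big(k f\, n^{1+1/k}\big)$ in the ECFT setting, 2. $s=O\big(k f^{1-1/k} n^{1+1/k}\big)$ in the VCFT setting, and 3. $s=O\big(k^2 f^{2-1/k} n^{1+1/k}\big)$ in the MCFT setting. The running time is $O(m f s)$ (and $O(1)$ if $m=0$), and it is also bounded by a polynomial in $n+m$ that does not depend on $k$, $f$ or the weights. Moreover, $H$ has a $2k$-blocking set in which every edge of $H$ occurs in at most $4kf$ pairs. All implied constants are absolute. Running time is the number of steps of a unit-cost random access machine with registers and arrays, initially zero outside the input, whose arithmetic consists of adding or subtracting $1$ (so that stored numbers exceed those of the input and the program by at most the number of steps) and which accesses the edge weights only by comparing the weights of two edges. -/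

import Mathlib

open scoped NNReal ENNReal

namespace CFT

/-! ### Colored weighted multigraphs -/

/-- A loopless undirected multigraph with vertex set `Fin n` and edge set `Fin m`, nonnegative real
edge weights, and arbitrary edge and vertex colors from the palette `Fin q`.
The edge `e` joins `src e` and `dst e`; the orientation is only the order in which the two ends are
listed and plays no role. Parallel edges are allowed. -/
structure ColoredGraph (n m q : ℕ) where
  src : Fin m → Fin n
  dst : Fin m → Fin n
  loopless : ∀ e, src e ≠ dst e
  weight : Fin m → ℝ≥0
  edgeColor : Fin m → Fin q
  vertexColor : Fin n → Fin q

/-- Edge color faults, vertex color faults, and mixed color faults. -/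
inductive Setting where
  | ECFT
  | VCFT
  | MCFT

variable {n m q : ℕ}

namespace ColoredGraph

/-- The edge `e` has the ends `u` and `v`. -/
def Joins (G : ColoredGraph n m q) (e : Fin m) (u v : Fin n) : Prop :=
  (G.src e = u ∧ G.dst e = v) ∨ (G.src e = v ∧ G.dst e = u)

/-- The failure of the color `c` damages the edge `e`. -/
def Damages (G : ColoredGraph n m q) (σ : Setting) (c : Fin q) (e : Fin m) : Prop :=
  match σ with
  | .ECFT => G.edgeColor e = c
  | .VCFT => G.vertexColor (G.src e) = c ∨ G.vertexColor (G.dst e) = c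
  | .MCFT => G.edgeColor e = c ∨ G.vertexColor (G.src e) = c ∨ G.vertexColor (G.dst e) = c

/-- `G.IsWalk A u p v`: the list `p` of pairs (edge, vertex reached by it) is a walk from `u` to `v`
that uses edges of `A` only. -/
inductive IsWalk (G : ColoredGraph n m q) (A : Set (Fin m)) :
    Fin n → List (Fin m × Fin n) → Fin n → Prop where
  | nil (u : Fin n) : IsWalk G A u [] u
  | cons {u v w : Fin n} {e : Fin m} {p : List (Fin m × Fin n)} :
      e ∈ A → G.Joins e u v → IsWalk G A v p w → IsWalk G A u ((e, v) :: p) w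

/-- The total weight of a walk. -/
noncomputable def walkWeight (G : ColoredGraph n m q) (p : List (Fin m × Fin n)) : ℝ≥0∞ :=
  (p.map fun s => (G.weight s.1 : ℝ≥0∞)).sum

/-- The weighted distance from `u` to `v` in the subgraph with all vertices and the edge set `A`
(`∞` if `u` and `v` are not connected in it). -/
noncomputable def dist (G : ColoredGraph n m q) (A : Set (Fin m)) (u v : Fin n) : ℝ≥0∞ :=
  ⨅ (p : List (Fin m × Fin n)) (_ : G.IsWalk A u p v), G.walkWeight p

/-- The edges of `A` that survive the failure of the colors in `F`. -/
def surviving (G : ColoredGraph n m q) (σ : Setting) (A : Set (Fin m)) (F : Finset (Fin q)) :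
    Set (Fin m) :=
  {e | e ∈ A ∧ ∀ c ∈ F, ¬ G.Damages σ c e}

/-- The subgraph with edge set `H` is an `f`-color fault tolerant `t`-spanner of `G`. -/
def IsFTSpanner (G : ColoredGraph n m q) (σ : Setting) (f : ℕ) (t : ℝ≥0∞) (H : Finset (Fin m)) :
    Prop :=
  ∀ F : Finset (Fin q), F.card ≤ f → ∀ u v : Fin n,
    G.dist (G.surviving σ H F) u v ≤ t * G.dist (G.surviving σ Set.univ F) u v

/-- `p`, started at `u`, is a cycle with edges in `A` (two parallel edges form a cycle). -/
def IsCycle (G : ColoredGraph n m q) (A : Set (Fin m)) (u : Fin n) (p : List (Fin m × Fin n)) :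
    Prop :=
  G.IsWalk A u p u ∧ p ≠ [] ∧ (p.map Prod.fst).Nodup ∧ (p.map Prod.snd).Nodup

/-- `B` is an `L`-blocking set of the subgraph with edge set `H`: it consists of pairs (edge of `H`,
color not damaging that edge), and every cycle of `H` with at most `L` edges contains the edge of
some pair in `B` together with an edge that is damaged by the color of that pair. -/
def IsBlockingSet (G : ColoredGraph n m q) (σ : Setting) (L : ℕ) (H : Finset (Fin m))
    (B : Finset (Fin m × Fin q)) : Prop :=
  (∀ b ∈ B, b.1 ∈ H ∧ ¬ G.Damages σ b.2 b.1) ∧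
  ∀ (u : Fin n) (p : List (Fin m × Fin n)), G.IsCycle H u p → p.length ≤ L →
    ∃ b ∈ B, b.1 ∈ p.map Prod.fst ∧ ∃ e ∈ p.map Prod.fst, G.Damages σ b.2 e

end ColoredGraph

/-! ### A random access machine with a step count

Structured programs over finitely many registers and finitely many arrays of natural numbers (a
program mentions only finitely many names). The only arithmetic is `± 1`, so in `T` steps no stored
number exceeds the largest number in the input or in the program by more than `T`, and unit cost is
the same as unit cost per operation on words of logarithmic length. Edge weights are real numbers
that a program can only compare with each other. -/

/-- The memory: registers and arrays, addressed by their names. -/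
@[ext] structure State where
  reg : ℕ → ℕ
  arr : ℕ → ℕ → ℕ

/-- The value of a register is replaced. -/
def State.setReg (s : State) (x v : ℕ) : State :=
  { s with reg := Function.update s.reg x v }

/-- The value of one array cell is replaced. -/
def State.setArr (s : State) (a i v : ℕ) : State :=
  { s with arr := Function.update s.arr a (Function.update (s.arr a) i v) }

/-- Tests: comparison of two registers, and comparison of the weights of the two edges whose numbers
are in two registers. -/
inductive Test where
  | eq (x y : ℕ)
  | lt (x y : ℕ)
  | weightLE (x y : ℕ)

/-- The truth value of a test, where `W i` is the weight of the edge number `i`. -/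
def Test.Holds (W : ℕ → ℝ≥0) (s : State) : Test → Prop
  | .eq x y => s.reg x = s.reg y
  | .lt x y => s.reg x < s.reg y
  | .weightLE x y => W (s.reg x) ≤ W (s.reg y)

/-- Programs. -/
inductive Program where
  /-- no operation -/
  | skip
  /-- `x := c` for a constant `c` of the program -/
  | const (x c : ℕ)
  /-- `x := y` -/
  | copy (x y : ℕ)
  /-- `x := x + 1` -/
  | inc (x : ℕ)
  /-- `x := x - 1`, where `0 - 1 = 0` -/
  | dec (x : ℕ)
  /-- `x := a[y]` -/
  | load (x a y : ℕ)
  /-- `a[x] := y` -/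
  | store (a x y : ℕ)
  | seq (P Q : Program)
  | ite (b : Test) (P Q : Program)
  | while (b : Test) (P : Program)

/-- `Exec W P s T s'`: the program `P`, started in `s`, halts in `s'` after exactly `T` steps. Each
elementary operation and each evaluation of a test is one step. -/
inductive Exec (W : ℕ → ℝ≥0) : Program → State → ℕ → State → Prop where
  | skip (s) : Exec W .skip s 1 s
  | const (x c s) : Exec W (.const x c) s 1 (s.setReg x c)
  | copy (x y s) : Exec W (.copy x y) s 1 (s.setReg x (s.reg y))
  | inc (x s) : Exec W (.inc x) s 1 (s.setReg x (s.reg x + 1))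
  | dec (x s) : Exec W (.dec x) s 1 (s.setReg x (s.reg x - 1))
  | load (x a y s) : Exec W (.load x a y) s 1 (s.setReg x (s.arr a (s.reg y)))
  | store (a x y s) : Exec W (.store a x y) s 1 (s.setArr a (s.reg x) (s.reg y))
  | seq {P Q s s' s'' T T'} :
      Exec W P s T s' → Exec W Q s' T' s'' → Exec W (.seq P Q) s (T + T') s''
  | ite_true {b P Q s s' T} :
      b.Holds W s → Exec W P s T s' → Exec W (.ite b P Q) s (1 + T) s'
  | ite_false {b P Q s s' T} :
      ¬ b.Holds W s → Exec W Q s T s' → Exec W (.ite b P Q) s (1 + T) s'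
  | while_true {b P s s' s'' T T'} :
      b.Holds W s → Exec W P s T s' → Exec W (.while b P) s' T' s'' →
        Exec W (.while b P) s (1 + T + T') s''
  | while_false {b P s} :
      ¬ b.Holds W s → Exec W (.while b P) s 1 s

/-! ### Input and output -/

/-- The number by which the input names the setting. -/
def Setting.code : Setting → ℕ
  | .ECFT => 0
  | .VCFT => 1
  | .MCFT => 2

/-- A finite sequence of numbers below `b`, as an array padded with zeros. -/
def toArr {a b : ℕ} (g : Fin a → Fin b) (i : ℕ) : ℕ :=
  if h : i < a then (g ⟨i, h⟩ : ℕ) else 0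

/-- The weights, indexed by edge numbers. -/
noncomputable def ColoredGraph.weightArr (G : ColoredGraph n m q) (i : ℕ) : ℝ≥0 :=
  if h : i < m then G.weight ⟨i, h⟩ else 0

/-- The initial memory. Registers 0 to 5 hold `n`, `m`, `q`, `k`, `f` and the setting; arrays 0 to 3
hold the first ends, the second ends and the colors of the edges, and the colors of the vertices;
everything else is `0`. -/
def ColoredGraph.input (G : ColoredGraph n m q) (σ : Setting) (k f : ℕ) : State where
  reg := fun x =>
    match x with
    | 0 => n
    | 1 => m
    | 2 => q
    | 3 => k
    | 4 => f
    | 5 => σ.code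
    | _ => 0
  arr := fun a =>
    match a with
    | 0 => toArr G.src
    | 1 => toArr G.dst
    | 2 => toArr G.edgeColor
    | 3 => toArr G.vertexColor
    | _ => fun _ => 0

/-- The output: the set of the edges `e` with a nonzero entry in array 4. -/
def output (m : ℕ) (s : State) : Finset (Fin m) :=
  Finset.univ.filter fun e => s.arr 4 e ≠ 0

end CFT

/-! The spanner `H` is built greedily. The edges are considered in the order of their weights, and
an edge `e` is rejected if `H` already contains, under all `f` faults that do not damage `e`, a walk
with at most `2 * k - 1` edges between the ends of `e`. To decide this exactly would take too long,
and the program approximates it (`testEdge`): it searches for such a walk, marks all colors that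
damage an edge of the walk but not `e`, deletes the edges damaged by marked colors, and repeats. If
no walk is left, then `e` is accepted; if `min f m + 1` walks have been found, then `e` is rejected.

**Stretch.** The walks found for a rejected edge have no damaging colors in common, other than those
that damage `e`. Hence `f` faults do not hit all of them (`rejects_of_walks`), and a walk that is
not hit has at most `2 * k - 1` edges, none of which is heavier than `e` (`Rejects.covered`). To
bound the stretch of single edges is enough (`isFTSpanner_of_covered`).

**Blocking set.** An edge `e` is accepted after at most `f` walks, each with at most
`2 * (2 * k - 1)` new colors (`card_newColors_le`). The pairs of `e` with the marked colors form a
`2 * k`-blocking set (`GreedyList.exists_blockingSet`): of a cycle with at most `2 * k` edges,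
consider the edge accepted last; the rest of the cycle is a walk between its ends, and was hit by a
marked color.

**Size.** Put the colors into `24 * k * f` groups at random. A pair `(e, c)` of the blocking set is
harmful if the group of `c` contains one of the at most three colors that damage `e`; on average, at
most half of the edges are in harmful pairs (`exists_grouping`). Remove these. Among the edges that
are left, those whose damaging colors are in prescribed groups have no cycle with at most `2 * k`
edges (`noShortCycle_of_not_isBad`), and the Moore bound (`card_le_of_noShortCycle`) applies. For
edge colors it is multiplied by the number of groups. For vertex colors it is used in an asymmetric
form and summed over all pairs of groups (`card_le_of_classes`), and for both kinds of colors these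
two steps are combined.

**Running time.** Sorting the edges would be too slow if `H` is small. Instead, every vertex keeps
the lightest edge that is left among the edges listed with it as the first end, and the lightest of
these is processed next (`findBest`); then the edges with the same first end are scanned to update
the candidate (`rescan`). To limit the number of scans, an edge is discarded without a test once a
parallel edge of the same color or `f + 1` parallel edges have been tested (`Selection`). So each
edge is scanned at most `f + 1` times for every possible second end (`sum_sourceDegree_le`). Every
vertex with an edge of `G` has an edge of `H` (`IsFTSpanner.exists_joins`), so there are at most
`2 * s` vertices to be considered if `H` has `s` edges. A search takes time `O(s)`, and a test takes
at most `min f m + 1` searches, which gives `O(m * f * s)` steps in total (`time_le_size`);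
replacing `f` by `min f m` makes the polynomial bound independent of `f` (`time_le_poly`).

The programs are verified with weakest preconditions (`wp`) that keep track of the number of steps.
-/

namespace CFT

variable {n m q : ℕ}

namespace ColoredGraph

variable {G : ColoredGraph n m q} {A A' : Set (Fin m)} {u v w x y : Fin n}
  {p p' : List (Fin m × Fin n)} {e : Fin m}

/-! ### Walks -/

theorem Joins.symm (h : G.Joins e u v) : G.Joins e v u := Or.symm h

theorem Joins.ne (h : G.Joins e u v) : u ≠ v := by
  rcases h with ⟨rfl, rfl⟩ | ⟨rfl, rfl⟩
  · exact G.loopless e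
  · exact (G.loopless e).symm

theorem Joins.right_unique (h : G.Joins e u v) (h' : G.Joins e u w) : v = w := by
  have := G.loopless e
  unfold Joins at h h'
  grind

theorem IsWalk.mono (hA : A ⊆ A') (h : G.IsWalk A u p v) : G.IsWalk A' u p v := by
  induction h with
  | nil u => exact .nil u
  | cons he hj _ ih => exact .cons (hA he) hj ih

theorem IsWalk.append (h : G.IsWalk A u p v) (h' : G.IsWalk A v p' w) :
    G.IsWalk A u (p ++ p') w := by
  induction h with
  | nil u => exact h'
  | cons he hj _ ih => exact .cons he hj (ih h')

theorem IsWalk.single (he : e ∈ A) (hj : G.Joins e u v) : G.IsWalk A u [(e, v)] v :=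
  .cons he hj (.nil v)

theorem IsWalk.of_append (h : G.IsWalk A u (p ++ p') w) :
    ∃ v, G.IsWalk A u p v ∧ G.IsWalk A v p' w := by
  induction p generalizing u with
  | nil => exact ⟨u, .nil u, h⟩
  | cons s p ih =>
    cases h with
    | cons he hj h =>
      obtain ⟨v, h1, h2⟩ := ih h
      exact ⟨v, .cons he hj h1, h2⟩

theorem IsWalk.end_eq (h : G.IsWalk A u (p ++ [(e, x)]) w) : x = w := by
  obtain ⟨v, -, h⟩ := h.of_append
  cases h with
  | cons _ _ h => cases h; rfl

theorem IsWalk.mem_edgeSet (h : G.IsWalk A u p w) (he : e ∈ p.map Prod.fst) : e ∈ A := by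
  induction h with
  | nil u => simp at he
  | cons he' hj _ ih =>
    rw [List.map_cons, List.mem_cons] at he
    rcases he with rfl | he
    · exact he'
    · exact ih he

/-- A walk using only edges of `A'` among those of `A` is a walk in `A'`. -/
theorem IsWalk.restrict (h : G.IsWalk A u p w) (hA : ∀ e ∈ p.map Prod.fst, e ∈ A') :
    G.IsWalk A' u p w := by
  induction h with
  | nil u => exact .nil u
  | cons _ hj _ ih =>
    rw [List.map_cons, List.forall_mem_cons] at hA
    exact .cons hA.1 hj (ih hA.2)

theorem IsWalk.ends_mem (h : G.IsWalk A u p w) (he : e ∈ p.map Prod.fst) :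
    G.src e ∈ u :: p.map Prod.snd ∧ G.dst e ∈ u :: p.map Prod.snd := by
  induction h with
  | nil u => simp at he
  | cons he' hj _ ih =>
    rw [List.map_cons, List.mem_cons] at he
    rcases he with rfl | he
    · rcases hj with ⟨rfl, rfl⟩ | ⟨rfl, rfl⟩ <;> simp
    · have := ih he
      exact ⟨List.mem_cons_of_mem _ this.1, List.mem_cons_of_mem _ this.2⟩

theorem IsWalk.joins_mem (h : G.IsWalk A u p w) (he : e ∈ p.map Prod.fst) (hj : G.Joins e x y) :
    x ∈ u :: p.map Prod.snd := by
  rcases hj with ⟨rfl, rfl⟩ | ⟨rfl, rfl⟩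
  exacts [(h.ends_mem he).1, (h.ends_mem he).2]

/-- Traverse `p` backwards and go on along `p'`. -/
theorem IsWalk.exists_reverse_append (h : G.IsWalk A y p x) (h' : G.IsWalk A y p' w) :
    ∃ r, G.IsWalk A x r w ∧ r.map Prod.fst = (p.map Prod.fst).reverse ++ p'.map Prod.fst := by
  induction h generalizing p' with
  | nil u => exact ⟨p', h', by simp⟩
  | cons he hj _ ih =>
    obtain ⟨r, h1, h2⟩ := ih (.cons he hj.symm h')
    exact ⟨r, h1, by simp [h2]⟩

theorem IsWalk.exists_reverse (h : G.IsWalk A y p x) :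
    ∃ r, G.IsWalk A x r y ∧ r.map Prod.fst = (p.map Prod.fst).reverse := by
  simpa using h.exists_reverse_append (.nil y)

theorem IsWalk.nodup_edges (h : G.IsWalk A u p w) (hn : (u :: p.map Prod.snd).Nodup) :
    (p.map Prod.fst).Nodup := by
  induction h with
  | nil u => simp
  | cons he hj h ih =>
    rw [List.map_cons, List.nodup_cons] at hn ⊢
    refine ⟨fun hmem => hn.1 ?_, ih hn.2⟩
    exact h.joins_mem hmem hj

/-! ### The Moore bound -/

/-- No cycle with edges in `A` has at most `L` edges. -/
def NoShortCycle (G : ColoredGraph n m q) (A : Set (Fin m)) (L : ℕ) : Prop :=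
  ∀ u p, G.IsCycle A u p → L < p.length

/-- No edge of the walk is immediately followed by itself. -/
def Reduced (p : List (Fin m × Fin n)) : Prop := (p.map Prod.fst).IsChain (· ≠ ·)

/-- A short walk that never turns back visits no vertex twice: otherwise its part between two visits
would contain a cycle. -/
theorem NoShortCycle.nodup {L : ℕ} (hA : G.NoShortCycle A L) (h : G.IsWalk A u p w)
    (hr : Reduced p) (hL : p.length ≤ L) : (u :: p.map Prod.snd).Nodup := by
  induction h with
  | nil u => simp
  | @cons u v w e p he hj h ih =>
    have hrp : Reduced p := by
      unfold Reduced at hr ⊢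
      rw [List.map_cons] at hr
      exact hr.tail
    have hn := ih hrp (by simp at hL; omega)
    rw [List.map_cons, List.nodup_cons]
    refine ⟨fun hu => ?_, hn⟩
    rw [List.mem_cons] at hu
    rcases hu with rfl | hu
    · exact hj.ne rfl
    -- the walk closes up: its part up to the first return is a cycle
    obtain ⟨⟨e', u'⟩, hmem, rfl⟩ := List.mem_map.1 hu
    obtain ⟨p1, p2, rfl⟩ := List.append_of_mem hmem
    dsimp only at hj hu
    rw [show p1 ++ (e', u') :: p2 = (p1 ++ [(e', u')]) ++ p2 by simp] at h hn hr hL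
    obtain ⟨x, h1, -⟩ := h.of_append
    obtain rfl := h1.end_eq
    have hn1 : (v :: (p1 ++ [(e', u')]).map Prod.snd).Nodup := by
      refine List.Nodup.sublist ?_ hn
      simp
    refine absurd (hA u' ((e, v) :: (p1 ++ [(e', u')])) ⟨.cons he hj h1, by simp, ?_, ?_⟩) ?_
    · rw [List.map_cons, List.nodup_cons]
      refine ⟨fun hmem => ?_, h1.nodup_edges hn1⟩
      generalize hp0 : p1 ++ [(e', u')] = p0 at *
      cases h1 with
      | nil => simp at hp0
      | @cons _ v1 _ e1 p0 he1 hj1 h1 =>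
        rw [List.map_cons, List.mem_cons] at hmem
        rcases hmem with rfl | hmem
        · simp [Reduced] at hr
        · have := h1.joins_mem hmem hj.symm
          rw [List.map_cons, List.nodup_cons] at hn1
          exact hn1.1 this
    · simpa using hn1
    · simp at hL ⊢
      omega

/-- Two short walks of the same length between the same vertices that never turn back are equal:
otherwise, after their common initial part is removed, one of them traversed backwards followed by
the other is a closed walk that never turns back. -/
theorem NoShortCycle.eq_of_reduced {L : ℕ} (hA : G.NoShortCycle A L) (h : G.IsWalk A y p x)
    (h' : G.IsWalk A y p' x) (hr : Reduced p) (hr' : Reduced p') (hl : p.length = p'.length)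
    (hL : 2 * p.length ≤ L) : p = p' := by
  induction h generalizing p' with
  | nil u => simpa [eq_comm] using hl
  | @cons u v w e p he hj h ih =>
    cases h' with
    | nil => simp at hl
    | @cons _ v' _ e' p' he' hj' h' =>
      by_cases hee : e = e'
      · subst hee
        obtain rfl := hj.right_unique hj'
        rw [ih h' hr.tail hr'.tail (by simpa using hl) (by simp at hL ⊢; omega)]
      · exfalso
        obtain ⟨r, h1, h2⟩ :=
          (IsWalk.cons he hj h).exists_reverse_append (IsWalk.cons he' hj' h')
        have hrr : Reduced r := by
          unfold Reduced at *
          rw [h2, List.isChain_append, List.isChain_reverse]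
          refine ⟨?_, hr', ?_⟩
          · simpa only [ne_comm] using hr
          · simpa using hee
        have hlr : r.length = 2 * ((e, v) :: p).length := by
          have := congrArg List.length h2
          simp only [List.length_map, List.length_append, List.length_reverse] at this
          omega
        have hn := hA.nodup h1 hrr (by omega)
        have hne : r ≠ [] := by
          rintro rfl
          simp at hlr
        obtain ⟨r', ⟨e'', x'⟩, rfl⟩ := List.eq_nil_or_concat r |>.resolve_left hne
        rw [List.concat_eq_append] at h1 hn
        obtain rfl := h1.end_eq
        simp at hn

open Classical in
/-- A graph with more than `d` edges per vertex has a subgraph with all degrees greater than `d`. -/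
theorem exists_dense_core (G : ColoredGraph n m q) (S : Finset (Fin m)) (V : Finset (Fin n)) (d : ℕ)
    (hV : ∀ e ∈ S, G.src e ∈ V ∧ G.dst e ∈ V) (hd : d * V.card < S.card) :
    ∃ (S' : Finset (Fin m)) (V' : Finset (Fin n)), S' ⊆ S ∧ V'.Nonempty ∧
      (∀ e ∈ S', G.src e ∈ V' ∧ G.dst e ∈ V') ∧
      ∀ x ∈ V', d < (S'.filter fun e => ∃ y, G.Joins e x y).card := by
  classical
  -- the smallest vertex set that induces more than `d` edges per vertex will do
  let I : Finset (Fin n) → Finset (Fin m) := fun V' => S.filter fun e => G.src e ∈ V' ∧ G.dst e ∈ V'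
  have hne : (Finset.univ.filter fun V' : Finset (Fin n) =>
      d * V'.card < (I V').card).Nonempty := by
    refine ⟨V, ?_⟩
    have : I V = S := Finset.filter_true_of_mem hV
    simpa [this] using hd
  obtain ⟨V', hV', hmin⟩ := Finset.exists_min_image _ Finset.card hne
  simp only [Finset.mem_filter, Finset.mem_univ, true_and] at hV' hmin
  refine ⟨I V', V', Finset.filter_subset _ _, ?_, fun e he => (Finset.mem_filter.1 he).2, ?_⟩
  · rw [Finset.nonempty_iff_ne_empty]
    rintro rfl
    simp [I] at hV'
  · intro x hx
    by_contra! hle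
    have h1 : I V' ⊆ (I V').filter (fun e => ∃ y, G.Joins e x y) ∪ I (V'.erase x) := by
      intro e he
      by_cases hj : ∃ y, G.Joins e x y
      · exact Finset.mem_union_left _ (Finset.mem_filter.2 ⟨he, hj⟩)
      · refine Finset.mem_union_right _ (Finset.mem_filter.2 ⟨(Finset.mem_filter.1 he).1, ?_⟩)
        have := (Finset.mem_filter.1 he).2
        simp only [Finset.mem_erase]
        refine ⟨⟨?_, this.1⟩, ?_, this.2⟩
        · rintro rfl
          exact hj ⟨_, Or.inl ⟨rfl, rfl⟩⟩
        · rintro rfl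
          exact hj ⟨_, Or.inr ⟨rfl, rfl⟩⟩
    have h2 := (Finset.card_le_card h1).trans (Finset.card_union_le _ _)
    have h3 := Finset.card_erase_of_mem hx
    have h4 : 0 < V'.card := Finset.card_pos.2 ⟨x, hx⟩
    have h5 := hmin (V'.erase x)
    obtain ⟨c, hc⟩ : ∃ c, V'.card = c + 1 := ⟨V'.card - 1, by omega⟩
    rw [hc] at h3 hV' h5
    simp only [Nat.add_sub_cancel] at h3
    rw [h3] at h5
    have h6 : d * (c + 1) = d * c + d := by ring
    have : c + 1 ≤ c := h5 (by omega)
    omega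

open Classical in
/-- If all degrees are greater than `d`, then at least `d ^ j` walks of length `j` that never turn
back end in `x`, because there are `d` ways to prolong such a walk at its start. -/
theorem exists_many_reduced_walks (S : Finset (Fin m)) (V : Finset (Fin n)) (d : ℕ)
    (hV : ∀ e ∈ S, G.src e ∈ V ∧ G.dst e ∈ V)
    (hd : ∀ x ∈ V, d < (S.filter fun e => ∃ y, G.Joins e x y).card) (hx : x ∈ V) (j : ℕ) :
    ∃ P : Finset (Fin n × List (Fin m × Fin n)), d ^ j ≤ P.card ∧
      ∀ z ∈ P, G.IsWalk S z.1 z.2 x ∧ Reduced z.2 ∧ z.2.length = j ∧ z.1 ∈ V := by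
  classical
  induction j with
  | zero => exact ⟨{(x, [])}, by simp, by simp [Reduced, IsWalk.nil, hx]⟩
  | succ j ih =>
    obtain ⟨P, hP, hP'⟩ := ih
    -- all ways to put an edge, different from the present first edge, in front of the walk
    let N : Fin n × List (Fin m × Fin n) → Finset (Fin m × Fin n) := fun z =>
      Finset.univ.filter fun b => b.1 ∈ S ∧ G.Joins b.1 z.1 b.2 ∧
        ∀ f ∈ (z.2.map Prod.fst).head?, b.1 ≠ f
    have hN : ∀ z ∈ P, d ≤ (N z).card := by
      intro z hz
      have h1 := hd z.1 (hP' z hz).2.2.2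
      have h2 : (S.filter fun e => ∃ y, G.Joins e z.1 y) ⊆
          (N z).image Prod.fst ∪ (z.2.map Prod.fst).head?.toFinset := by
        intro e he
        obtain ⟨he, y, hj⟩ := Finset.mem_filter.1 he
        by_cases hh : e ∈ (z.2.map Prod.fst).head?
        · exact Finset.mem_union_right _ (by simpa using hh)
        · refine Finset.mem_union_left _ (Finset.mem_image.2 ⟨(e, y), ?_, rfl⟩)
          simp only [N, Finset.mem_filter, Finset.mem_univ, true_and]
          refine ⟨he, hj, ?_⟩
          rintro f hf rfl
          exact hh hf
      have h3 := (Finset.card_le_card h2).trans (Finset.card_union_le _ _)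
      have h4 : ((z.2.map Prod.fst).head?.toFinset).card ≤ 1 := by
        cases (z.2.map Prod.fst).head? <;> simp
      have h5 : ((N z).image Prod.fst).card ≤ (N z).card := Finset.card_image_le
      omega
    refine ⟨(P.sigma N).image fun a => (a.2.2, (a.2.1, a.1.1) :: a.1.2), ?_, ?_⟩
    · rw [Finset.card_image_of_injective]
      · rw [Finset.card_sigma, pow_succ]
        calc d ^ j * d ≤ P.card * d := Nat.mul_le_mul_right _ hP
          _ = ∑ _z ∈ P, d := by simp
          _ ≤ _ := Finset.sum_le_sum hN
      · rintro ⟨⟨y, p⟩, e, z⟩ ⟨⟨y', p'⟩, e', z'⟩ h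
        simp only [Prod.mk.injEq, List.cons.injEq] at h
        obtain ⟨rfl, ⟨rfl, rfl⟩, rfl⟩ := h
        rfl
    · intro z hz
      obtain ⟨⟨⟨y, p⟩, e, z⟩, ha, rfl⟩ := Finset.mem_image.1 hz
      obtain ⟨hp, hN⟩ := Finset.mem_sigma.1 ha
      obtain ⟨h1, h2, h3, h4⟩ := hP' _ hp
      simp only [N, Finset.mem_filter, Finset.mem_univ, true_and] at hN
      dsimp only at *
      refine ⟨.cons hN.1 hN.2.1.symm h1, ?_, by simp [h3], ?_⟩
      · unfold Reduced at *
        rw [List.map_cons, List.isChain_cons]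
        exact ⟨hN.2.2, h2⟩
      · rcases hN.2.1 with ⟨-, h⟩ | ⟨h, -⟩
        · exact h ▸ (hV e hN.1).2
        · exact h ▸ (hV e hN.1).1

/-- If every edge goes from class `a` to class `b`, then the class of the start of a walk is
determined by the class of its end and the parity of its length. -/
theorem IsWalk.class_eq {ι : Type*} {κ : Fin n → ι} {a b : ι}
    (hA : ∀ e ∈ A, κ (G.src e) = a ∧ κ (G.dst e) = b) (h : G.IsWalk A y p x) :
    (κ x = a → κ y = if Even p.length then a else b) ∧
      (κ x = b → κ y = if Even p.length then b else a) := by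
  induction h with
  | nil u => simp
  | cons he hj h ih =>
    have := hA _ he
    simp only [List.length_cons, Nat.even_add_one]
    rcases hj with ⟨rfl, rfl⟩ | ⟨rfl, rfl⟩
    all_goals
      constructor
      all_goals
        intro hx
        have h1 := ih.1
        have h2 := ih.2
        split_ifs at * <;> simp_all

/-- In a dense subgraph, `d ^ k` walks of length `k` that never turn back end in a given root. They
have different starts, which are all in the same class. -/
theorem pow_le_card_class {ι : Type*} [DecidableEq ι] {k d : ℕ} (κ : Fin n → ι) (a b : ι)
    (S : Finset (Fin m)) (hS : ∀ e ∈ S, κ (G.src e) = a ∧ κ (G.dst e) = b)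
    (hc : G.NoShortCycle S (2 * k))
    (hd : d * ((Finset.univ.filter fun x => κ x = a).card +
      (Finset.univ.filter fun x => κ x = b).card) < S.card) :
    d ^ k ≤ (Finset.univ.filter fun x => κ x = a).card ∧
      d ^ k ≤ (Finset.univ.filter fun x => κ x = b).card := by
  classical
  obtain ⟨S', V, hSS, ⟨x0, hx0⟩, hV, hdeg⟩ := G.exists_dense_core S
    ((Finset.univ.filter fun x => κ x = a) ∪ (Finset.univ.filter fun x => κ x = b)) d
    (by simp +contextual [hS])
    (lt_of_le_of_lt (Nat.mul_le_mul_left _ (Finset.card_union_le _ _)) hd)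
  have hS' : ∀ e ∈ (S' : Set (Fin m)), κ (G.src e) = a ∧ κ (G.dst e) = b :=
    fun e he => hS e (hSS he)
  have hc' : G.NoShortCycle S' (2 * k) := fun u p hp =>
    hc u p ⟨hp.1.mono (by exact_mod_cast hSS), hp.2⟩
  obtain ⟨e0, he0⟩ := Finset.card_pos.1 (Nat.zero_lt_of_lt (hdeg x0 hx0))
  have he0 := (Finset.mem_filter.1 he0).1
  have key : ∀ x ∈ V, ∀ c, (∀ y p, G.IsWalk S' y p x → p.length = k → κ y = c) →
      d ^ k ≤ (Finset.univ.filter fun x => κ x = c).card := by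
    intro x hx c hxc
    obtain ⟨P, hP, hP'⟩ := exists_many_reduced_walks S' V d hV hdeg hx k
    refine hP.trans (Finset.card_le_card_of_injOn Prod.fst ?_ ?_)
    · intro z hz
      have := hP' z hz
      simpa using hxc _ _ this.1 this.2.2.1
    · rintro ⟨y, p⟩ hz ⟨y', p'⟩ hz' h
      obtain ⟨h1, h2, h3, -⟩ := hP' _ hz
      obtain ⟨h1', h2', h3', -⟩ := hP' _ hz'
      dsimp only at *
      subst h
      rw [hc'.eq_of_reduced h1 h1' h2 h2' (by omega) (by omega)]
  -- the root is chosen such that after `k` steps the walk is in the wanted class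
  have hs := (hS' e0 he0).1
  have ht := (hS' e0 he0).2
  by_cases hk : Even k
  · exact ⟨key _ (hV e0 he0).1 a fun y p hp hl => by simpa [hl, hk] using (hp.class_eq hS').1 hs,
      key _ (hV e0 he0).2 b fun y p hp hl => by simpa [hl, hk] using (hp.class_eq hS').2 ht⟩
  · exact ⟨key _ (hV e0 he0).2 a fun y p hp hl => by simpa [hl, hk] using (hp.class_eq hS').2 ht,
      key _ (hV e0 he0).1 b fun y p hp hl => by simpa [hl, hk] using (hp.class_eq hS').1 hs⟩

/-- The Moore bound for graphs whose edges all go from class `a` to class `b`. It is asymmetric: the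
root may be taken such that the leaves of the tree lie in the smaller class. -/
theorem card_le_of_noShortCycle {ι : Type*} [DecidableEq ι] {k : ℕ} (hk : 1 ≤ k) (κ : Fin n → ι)
    (a b : ι) (S : Finset (Fin m)) (hS : ∀ e ∈ S, κ (G.src e) = a ∧ κ (G.dst e) = b)
    (hc : G.NoShortCycle S (2 * k)) :
    (S.card : ℝ) ≤ ((Finset.univ.filter fun x => κ x = a).card : ℝ) *
        (((Finset.univ.filter fun x => κ x = b).card : ℝ) ^ (1 / (k : ℝ)) + 1) +
      ((Finset.univ.filter fun x => κ x = b).card : ℝ) *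
        (((Finset.univ.filter fun x => κ x = a).card : ℝ) ^ (1 / (k : ℝ)) + 1) := by
  set na := (Finset.univ.filter fun x => κ x = a).card with hna
  set nb := (Finset.univ.filter fun x => κ x = b).card with hnb
  have hk0 : (k : ℝ) ≠ 0 := by positivity
  set r : ℝ := ((min na nb : ℕ) : ℝ) ^ (1 / (k : ℝ)) with hr
  have hr0 : 0 ≤ r := by positivity
  -- `⌊r⌋₊ + 1` is the least degree `d` with `min na nb < d ^ k`
  have hle : S.card ≤ (⌊r⌋₊ + 1) * (na + nb) := by
    by_contra! hlt
    have h1 := pow_le_card_class κ a b S hS hc hlt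
    have h2 : (⌊r⌋₊ + 1) ^ k ≤ min na nb := le_min h1.1 h1.2
    have h3 : r ^ k < ((⌊r⌋₊ + 1 : ℕ) : ℝ) ^ k := by
      refine pow_lt_pow_left₀ ?_ hr0 (by omega)
      exact_mod_cast Nat.lt_floor_add_one r
    have h4 : r ^ k = ((min na nb : ℕ) : ℝ) := by
      rw [hr, ← Real.rpow_natCast, ← Real.rpow_mul (by positivity), one_div_mul_cancel hk0,
        Real.rpow_one]
    rw [h4] at h3
    exact absurd h2 (not_le.2 (by exact_mod_cast h3))
  have hra : r ≤ (na : ℝ) ^ (1 / (k : ℝ)) :=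
    Real.rpow_le_rpow (by positivity) (by exact_mod_cast min_le_left _ _) (by positivity)
  have hrb : r ≤ (nb : ℝ) ^ (1 / (k : ℝ)) :=
    Real.rpow_le_rpow (by positivity) (by exact_mod_cast min_le_right _ _) (by positivity)
  calc (S.card : ℝ) ≤ (⌊r⌋₊ + 1) * (na + nb) := by exact_mod_cast hle
    _ ≤ (r + 1) * (na + nb) := by
      gcongr
      exact Nat.floor_le hr0
    _ = na * (r + 1) + nb * (r + 1) := by ring
    _ ≤ _ := by gcongr

end ColoredGraph

end CFT

namespace CFT

variable {n m q : ℕ}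

namespace ColoredGraph

variable {G : ColoredGraph n m q} {σ : Setting} {k f t D : ℕ}

/-! ### The size of a subgraph with a blocking set -/

/-- Among the functions to `Fin t`, at most one in `t` agrees at two given places. -/
theorem card_functions_agreeing_le {c c' : Fin q} (h : c ≠ c') :
    t * (Finset.univ.filter fun g : Fin q → Fin t => g c = g c').card ≤ t ^ q := by
  classical
  have h1 : ((Finset.univ.filter fun g : Fin q → Fin t => g c = g c') ×ˢ
      (Finset.univ : Finset (Fin t))).card ≤ (Finset.univ : Finset (Fin q → Fin t)).card := by
    refine Finset.card_le_card_of_injOn (fun z => Function.update z.1 c z.2) (by simp) ?_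
    rintro ⟨g, j⟩ hg ⟨g', j'⟩ hg' heq
    simp only [Finset.coe_product, Finset.coe_filter, Finset.mem_univ, true_and, Set.mem_prod,
      Set.mem_ofPred_eq] at hg hg'
    dsimp only at heq
    have hj : j = j' := by simpa using congrFun heq c
    have hne : ∀ x, x ≠ c → g x = g' x := fun x hx => by
      simpa [Function.update_of_ne hx] using congrFun heq x
    have : g = g' := by
      funext x
      by_cases hx : x = c
      · rw [hx, hg.1, hg'.1, hne c' h.symm]
      · exact hne x hx
    rw [this, hj]
  simpa [mul_comm] using h1

open Classical in
theorem card_damaging_le (G : ColoredGraph n m q) (σ : Setting) (e : Fin m) :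
    (Finset.univ.filter fun c => G.Damages σ c e).card ≤ 3 := by
  have : (Finset.univ.filter fun c => G.Damages σ c e) ⊆
      {G.edgeColor e, G.vertexColor (G.src e), G.vertexColor (G.dst e)} := by
    intro c hc
    simp only [Finset.mem_filter, Finset.mem_univ, true_and] at hc
    cases σ <;> simp only [Damages] at hc <;>
      simp only [Finset.mem_insert, Finset.mem_singleton] <;> tauto
  exact (Finset.card_le_card this).trans Finset.card_le_three

/-- If the colors are put into `t` groups by `g`, then the edge `e` is bad if for some pair `(e, c)`
of the blocking set the color `c` is in the group of a color that damages `e`. -/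
def IsBad (G : ColoredGraph n m q) (σ : Setting) (B : Finset (Fin m × Fin q)) (g : Fin q → Fin t)
    (e : Fin m) : Prop :=
  ∃ c, (e, c) ∈ B ∧ ∃ c', G.Damages σ c' e ∧ g c = g c'

open Classical in
/-- Averaging over all ways to put the colors into `t` groups: a color of a blocking pair is in the
group of a given other color with probability `1 / t`. -/
theorem exists_grouping {H : Finset (Fin m)} {B : Finset (Fin m × Fin q)}
    (hB : ∀ b ∈ B, b.1 ∈ H ∧ ¬ G.Damages σ b.2 b.1)
    (hD : ∀ e ∈ H, (B.filter fun b => b.1 = e).card ≤ D) (ht : 0 < t) (htD : 6 * D ≤ t) :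
    ∃ g : Fin q → Fin t, H.card ≤ 2 * (H.filter fun e => ¬ G.IsBad σ B g e).card := by
  by_contra! hlt
  have hbad : ∀ g : Fin q → Fin t, H.card + 1 ≤ 2 * (H.filter fun e => G.IsBad σ B g e).card := by
    intro g
    have h1 := hlt g
    have h2 := Finset.card_filter_add_card_filter_not (s := H) (fun e => G.IsBad σ B g e)
    omega
  have hBc : B.card ≤ H.card * D := by
    rw [Finset.card_eq_sum_card_fiberwise (f := Prod.fst) (t := H) fun b hb => (hB b hb).1]
    exact (Finset.sum_le_sum hD).trans (by simp)
  have hcount : ∀ g : Fin q → Fin t, (H.filter fun e => G.IsBad σ B g e).card ≤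
      ∑ b ∈ B, ∑ c' ∈ Finset.univ.filter (fun c => G.Damages σ c b.1),
        if g b.2 = g c' then 1 else 0 := by
    intro g
    have h1 : (H.filter fun e => G.IsBad σ B g e) ⊆ (B.filter fun b =>
        ∃ c', G.Damages σ c' b.1 ∧ g b.2 = g c').image Prod.fst := by
      intro e he
      obtain ⟨-, c, hc, c', hc'⟩ := Finset.mem_filter.1 he
      exact Finset.mem_image.2 ⟨(e, c), Finset.mem_filter.2 ⟨hc, c', hc'⟩, rfl⟩
    refine (Finset.card_le_card h1).trans (Finset.card_image_le.trans ?_)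
    rw [Finset.card_filter]
    refine Finset.sum_le_sum fun b _ => ?_
    split_ifs with h
    · obtain ⟨c', h1, h2⟩ := h
      rw [← Finset.sum_filter, ← Finset.card_eq_sum_ones, Nat.one_le_iff_ne_zero,
        ← Nat.pos_iff_ne_zero, Finset.card_pos]
      exact ⟨c', by simp [h1, h2]⟩
    · exact Nat.zero_le _
  have hsum : t * ∑ g : Fin q → Fin t, (H.filter fun e => G.IsBad σ B g e).card ≤
      3 * (H.card * D) * t ^ q := by
    calc t * ∑ g : Fin q → Fin t, (H.filter fun e => G.IsBad σ B g e).card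
        ≤ t * ∑ g : Fin q → Fin t, ∑ b ∈ B,
            ∑ c' ∈ Finset.univ.filter (fun c => G.Damages σ c b.1),
              if g b.2 = g c' then 1 else 0 := by
          gcongr with g
          exact hcount g
      _ = ∑ b ∈ B, ∑ c' ∈ Finset.univ.filter (fun c => G.Damages σ c b.1),
            t * (Finset.univ.filter fun g : Fin q → Fin t => g b.2 = g c').card := by
          rw [Finset.sum_comm, Finset.mul_sum]
          refine Finset.sum_congr rfl fun b _ => ?_
          rw [Finset.sum_comm, Finset.mul_sum]
          refine Finset.sum_congr rfl fun c' _ => ?_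
          rw [Finset.card_filter]
      _ ≤ ∑ b ∈ B, 3 * t ^ q := by
          refine Finset.sum_le_sum fun b hb => ?_
          calc _ ≤ ∑ c' ∈ Finset.univ.filter (fun c => G.Damages σ c b.1), t ^ q := by
                refine Finset.sum_le_sum fun c' hc' => card_functions_agreeing_le ?_
                rintro rfl
                exact (hB b hb).2 (Finset.mem_filter.1 hc').2
            _ = (Finset.univ.filter (fun c => G.Damages σ c b.1)).card * t ^ q := by simp
            _ ≤ _ := Nat.mul_le_mul_right _ (G.card_damaging_le σ b.1)
      _ = B.card * (3 * t ^ q) := by simp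
      _ ≤ (H.card * D) * (3 * t ^ q) := by gcongr
      _ = _ := by ring
  -- if every grouping made more than half of `H` bad, the average would exceed `hsum`
  have hlow : t ^ q * (H.card + 1) ≤
      2 * ∑ g : Fin q → Fin t, (H.filter fun e => G.IsBad σ B g e).card := by
    rw [Finset.mul_sum]
    calc t ^ q * (H.card + 1) = ∑ _g : Fin q → Fin t, (H.card + 1) := by simp
      _ ≤ _ := Finset.sum_le_sum fun g _ => hbad g
  have h1 : t * (t ^ q * (H.card + 1)) ≤ t * (t ^ q * H.card) := by
    calc t * (t ^ q * (H.card + 1))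
        ≤ t * (2 * ∑ g : Fin q → Fin t, (H.filter fun e => G.IsBad σ B g e).card) := by gcongr
      _ = 2 * (t * ∑ g : Fin q → Fin t, (H.filter fun e => G.IsBad σ B g e).card) := by ring
      _ ≤ 2 * (3 * (H.card * D) * t ^ q) := by gcongr
      _ = (6 * D) * (t ^ q * H.card) := by ring
      _ ≤ t * (t ^ q * H.card) := by gcongr
  have h2 : 0 < t * t ^ q := by positivity
  nlinarith

/-- Among edges that are not bad, those whose damaging colors are in the same groups contain no
short cycle: a blocking pair of the cycle would make its edge bad. -/
theorem noShortCycle_of_not_isBad {H : Finset (Fin m)} {B : Finset (Fin m × Fin q)} {L : ℕ}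
    (hB : G.IsBlockingSet σ L H B) {g : Fin q → Fin t} {S : Set (Fin m)}
    (hS : ∀ e ∈ S, e ∈ H ∧ ¬ G.IsBad σ B g e)
    (hg : ∀ e ∈ S, ∀ e' ∈ S, ∀ c', G.Damages σ c' e' → ∃ c, G.Damages σ c e ∧ g c' = g c) :
    G.NoShortCycle S L := by
  intro u p hp
  by_contra! hL
  obtain ⟨⟨e, c⟩, hb, he, e', he', hc⟩ :=
    hB.2 u p ⟨hp.1.mono fun e he => (hS e he).1, hp.2⟩ hL
  have heS := hp.1.mem_edgeSet he
  obtain ⟨c', h1, h2⟩ := hg e heS e' (hp.1.mem_edgeSet he') c hc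
  exact (hS e heS).2 ⟨c, hb, c', h1, h2⟩

/-- A graph without short cycles has no parallel edges, hence at most one edge for every pair of
vertices. -/
theorem NoShortCycle.card_le_mul {ι : Type*} [DecidableEq ι] (hk : 1 ≤ k) (κ : Fin n → ι)
    (a b : ι) (S : Finset (Fin m)) (hS : ∀ e ∈ S, κ (G.src e) = a ∧ κ (G.dst e) = b)
    (hc : G.NoShortCycle S (2 * k)) :
    S.card ≤ (Finset.univ.filter fun x => κ x = a).card *
      (Finset.univ.filter fun x => κ x = b).card := by
  rw [← Finset.card_product]
  refine Finset.card_le_card_of_injOn (fun e => (G.src e, G.dst e)) ?_ ?_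
  · intro e he
    simpa using hS e he
  · intro e he e' he' h
    by_contra hne
    simp only [Prod.mk.injEq] at h
    -- two parallel edges form a cycle
    have := hc (G.src e) [(e, G.dst e), (e', G.src e)]
      ⟨.cons he (Or.inl ⟨rfl, rfl⟩) (.single he' (Or.inr ⟨h.1.symm, h.2.symm⟩)), by simp,
        by simpa using hne, by simpa using (G.loopless e).symm⟩
    simp at this
    omega

/-- The sum of `k`-th roots is largest if all terms are equal. -/
theorem sum_rpow_inv_le {ι : Type*} (s : Finset ι) (hk : 1 ≤ k) (x : ι → ℕ) :
    ∑ i ∈ s, (x i : ℝ) ^ (1 / (k : ℝ)) ≤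
      (s.card : ℝ) ^ (1 - 1 / (k : ℝ)) * ((∑ i ∈ s, x i : ℕ) : ℝ) ^ (1 / (k : ℝ)) := by
  have hk0 : (0 : ℝ) < k := by exact_mod_cast hk
  have h := Real.rpow_sum_le_const_mul_sum_rpow s (fun i => (x i : ℝ) ^ (1 / (k : ℝ)))
    (p := k) (by exact_mod_cast hk)
  have h1 : ∀ i, |(x i : ℝ) ^ (1 / (k : ℝ))| = (x i : ℝ) ^ (1 / (k : ℝ)) := fun i =>
    abs_of_nonneg (by positivity)
  have h2 : ∀ i, ((x i : ℝ) ^ (1 / (k : ℝ))) ^ (k : ℝ) = x i := fun i => by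
    rw [← Real.rpow_mul (by positivity), one_div_mul_cancel hk0.ne', Real.rpow_one]
  simp only [h1, h2] at h
  have h3 : 0 ≤ ∑ i ∈ s, (x i : ℝ) ^ (1 / (k : ℝ)) := Finset.sum_nonneg fun i _ => by positivity
  have h4 := Real.rpow_le_rpow (by positivity) h (z := 1 / (k : ℝ)) (by positivity)
  rw [← Real.rpow_mul h3, mul_one_div_cancel hk0.ne', Real.rpow_one,
    Real.mul_rpow (by positivity) (Finset.sum_nonneg fun i _ => by positivity),
    ← Real.rpow_mul (by positivity)] at h4
  have h5 : ((k : ℝ) - 1) * (1 / k) = 1 - 1 / k := by field_simp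
  rw [h5] at h4
  push_cast
  exact h4

theorem natCast_sq_le_rpow_mul_rpow (hf : n ≤ f) :
    (n : ℝ) * n ≤ (f : ℝ) ^ (1 - 1 / (k : ℝ)) * (n : ℝ) ^ (1 + 1 / (k : ℝ)) := by
  rcases Nat.eq_zero_or_pos n with rfl | hn
  · simpa using by positivity
  have hn : (0 : ℝ) < n := by exact_mod_cast hn
  have hk1 : (0 : ℝ) ≤ 1 - 1 / (k : ℝ) := by
    rcases Nat.eq_zero_or_pos k with rfl | hk
    · simp
    · rw [sub_nonneg, div_le_one (by exact_mod_cast hk)]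
      exact_mod_cast hk
  calc (n : ℝ) * n = (n : ℝ) ^ (1 - 1 / (k : ℝ)) * (n : ℝ) ^ (1 + 1 / (k : ℝ)) := by
        rw [← Real.rpow_add hn]
        ring_nf
        norm_num
    _ ≤ _ := by gcongr

/-- The vertices are in `24 * k * f` classes, and the edges from any class to any class have no
short cycle. The asymmetric Moore bound is summed over all pairs of classes; the sum of the `k`-th
roots of the sizes of the classes is bounded by concavity. If `n ≤ f`, then it suffices that there
are no parallel edges. -/
theorem card_le_of_classes (hk : 1 ≤ k) (hf : 1 ≤ f) (κ : Fin n → Fin (24 * k * f))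
    (S : Finset (Fin m))
    (hc : ∀ a b, G.NoShortCycle {e | e ∈ S ∧ κ (G.src e) = a ∧ κ (G.dst e) = b} (2 * k)) :
    (S.card : ℝ) ≤
      96 * (k * (f : ℝ) ^ (1 - 1 / (k : ℝ)) * (n : ℝ) ^ (1 + 1 / (k : ℝ))) := by
  have hk0 : (1 : ℝ) ≤ k := by exact_mod_cast hk
  have hf0 : (1 : ℝ) ≤ f := by exact_mod_cast hf
  set c : Fin (24 * k * f) → ℕ := fun a => (Finset.univ.filter fun x => κ x = a).card with hcdef
  have hcsum : ∑ a, c a = n := by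
    rw [hcdef, ← Finset.card_eq_sum_card_fiberwise
      (fun x _ => Finset.mem_coe.2 (Finset.mem_univ _))]
    simp
  let P : Fin (24 * k * f) → Fin (24 * k * f) → Finset (Fin m) := fun a b =>
    S.filter fun e => κ (G.src e) = a ∧ κ (G.dst e) = b
  have hP : ∀ a b, G.NoShortCycle (P a b : Set (Fin m)) (2 * k) := fun a b => by
    simpa [P] using hc a b
  have hPm : ∀ a b, ∀ e ∈ P a b, κ (G.src e) = a ∧ κ (G.dst e) = b := fun a b e he =>
    (Finset.mem_filter.1 he).2
  have hS : S.card = ∑ a, ∑ b, (P a b).card := by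
    rw [← Finset.sum_product', Finset.card_eq_sum_card_fiberwise
      (f := fun e => (κ (G.src e), κ (G.dst e))) (t := Finset.univ ×ˢ Finset.univ) (by simp)]
    simp [P, Prod.ext_iff]
  rcases le_total n f with hnf | hnf
  · have h1 : S.card ≤ n * n := by
      calc S.card = ∑ a, ∑ b, (P a b).card := hS
        _ ≤ ∑ a, ∑ b, c a * c b :=
          Finset.sum_le_sum fun a _ => Finset.sum_le_sum fun b _ =>
            NoShortCycle.card_le_mul hk κ a b _ (hPm a b) (hP a b)
        _ = n * n := by rw [← Finset.sum_mul_sum, hcsum]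
    have h2 : (S.card : ℝ) ≤ n * n := by exact_mod_cast h1
    refine h2.trans ((natCast_sq_le_rpow_mul_rpow (k := k) hnf).trans ?_)
    have h3 : 0 ≤ (f : ℝ) ^ (1 - 1 / (k : ℝ)) * (n : ℝ) ^ (1 + 1 / (k : ℝ)) := by positivity
    nlinarith
  · have hn0 : (0 : ℝ) < n := by
      have : (f : ℝ) ≤ n := by exact_mod_cast hnf
      linarith
    set α : ℝ := 1 / (k : ℝ) with hα
    have hα0 : 0 ≤ α := by positivity
    have hα1 : 0 ≤ 1 - α := by
      rw [hα, sub_nonneg, div_le_one (by linarith)]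
      exact hk0
    have h1 : (S.card : ℝ) ≤ ∑ a, ∑ b, ((c a : ℝ) * ((c b : ℝ) ^ α + 1) +
        (c b : ℝ) * ((c a : ℝ) ^ α + 1)) := by
      rw [hS]
      push_cast
      exact Finset.sum_le_sum fun a _ => Finset.sum_le_sum fun b _ =>
        card_le_of_noShortCycle hk κ a b _ (hPm a b) (hP a b)
    have h2 : ∑ a, ∑ b, ((c a : ℝ) * ((c b : ℝ) ^ α + 1) + (c b : ℝ) * ((c a : ℝ) ^ α + 1)) =
        2 * ((∑ a, (c a : ℝ)) * ∑ b, ((c b : ℝ) ^ α + 1)) := by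
      rw [two_mul]
      simp only [Finset.sum_add_distrib (f := fun b => _ * ((c b : ℝ) ^ α + 1)),
        Finset.sum_add_distrib (f := fun a => ∑ b, (c a : ℝ) * ((c b : ℝ) ^ α + 1))]
      congr 1
      · rw [← Finset.sum_mul_sum]
      · rw [Finset.sum_comm, ← Finset.sum_mul_sum]
    have h3 : ∑ a, (c a : ℝ) = n := by exact_mod_cast hcsum
    have h4 := sum_rpow_inv_le Finset.univ hk c
    rw [hcsum, ← hα] at h4
    have h5 : ∑ b, ((c b : ℝ) ^ α + 1) ≤ 48 * k * (f : ℝ) ^ (1 - α) * (n : ℝ) ^ α := by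
      rw [Finset.sum_add_distrib]
      simp only [Finset.card_univ, Fintype.card_fin, Finset.sum_const, nsmul_eq_mul,
        mul_one] at h4 ⊢
      push_cast at h4 ⊢
      have h6 : (24 * (k : ℝ) * f) ^ (1 - α) ≤ 24 * k * (f : ℝ) ^ (1 - α) := by
        rw [Real.mul_rpow (by positivity) (by positivity)]
        gcongr
        calc (24 * (k : ℝ)) ^ (1 - α) ≤ (24 * (k : ℝ)) ^ (1 : ℝ) :=
              Real.rpow_le_rpow_of_exponent_le (by linarith) (by linarith)
          _ = 24 * k := Real.rpow_one _
      have h7 : (f : ℝ) ≤ (f : ℝ) ^ (1 - α) * (n : ℝ) ^ α := by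
        calc (f : ℝ) = (f : ℝ) ^ (1 - α) * (f : ℝ) ^ α := by
              rw [← Real.rpow_add (by linarith)]
              simp
          _ ≤ _ := by gcongr
      have h8 : (0 : ℝ) ≤ (n : ℝ) ^ α := by positivity
      have h9 : (24 * (k : ℝ) * f) ≤ 24 * k * ((f : ℝ) ^ (1 - α) * (n : ℝ) ^ α) := by gcongr
      nlinarith
    calc (S.card : ℝ) ≤ 2 * (n * ∑ b, ((c b : ℝ) ^ α + 1)) := by rw [← h3, ← h2]; exact h1
      _ ≤ 2 * (n * (48 * k * (f : ℝ) ^ (1 - α) * (n : ℝ) ^ α)) := by gcongr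
      _ = 96 * (k * (f : ℝ) ^ (1 - α) * ((n : ℝ) * (n : ℝ) ^ α)) := by ring
      _ = _ := by rw [Real.rpow_add hn0, Real.rpow_one]

section Size

variable {H : Finset (Fin m)} {B : Finset (Fin m × Fin q)}

open Classical in
/-- The edges whose colors are in the same group have no short cycle, after the bad edges have been
removed; the Moore bound is applied to each of the `24 * k * f` groups. -/
theorem card_le_of_blocking_ECFT (hk : 1 ≤ k) (hf : 1 ≤ f) (hB : G.IsBlockingSet .ECFT (2 * k) H B)
    (hD : ∀ e ∈ H, (B.filter fun b => b.1 = e).card ≤ 4 * k * f) :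
    (H.card : ℝ) ≤ 5000 * (k * f * (n : ℝ) ^ (1 + 1 / (k : ℝ))) := by
  obtain ⟨g, hg⟩ := exists_grouping hB.1 (by convert hD) (t := 24 * k * f) (by positivity)
    (by linarith)
  set S := H.filter fun e => ¬ G.IsBad .ECFT B g e with hS
  have hpiece : ∀ i, ((S.filter fun e => g (G.edgeColor e) = i).card : ℝ) ≤
      4 * (n : ℝ) ^ (1 + 1 / (k : ℝ)) := by
    intro i
    have h1 : G.NoShortCycle ((S.filter fun e => g (G.edgeColor e) = i : Finset (Fin m)) :
        Set (Fin m)) (2 * k) := by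
      refine noShortCycle_of_not_isBad hB (g := g) ?_ ?_
      · intro e he
        simp only [Finset.coe_filter, Set.mem_ofPred_eq, hS, Finset.mem_filter] at he
        exact he.1
      · intro e he e' he' c' hc'
        simp only [Finset.coe_filter, Set.mem_ofPred_eq] at he he'
        refine ⟨G.edgeColor e, rfl, ?_⟩
        rw [← (show G.edgeColor e' = c' from hc'), he'.2, he.2]
    have h2 := card_le_of_noShortCycle hk (fun _ : Fin n => ()) () () _ (by simp) h1
    simp only [Finset.filter_true, Finset.card_univ, Fintype.card_fin] at h2
    refine h2.trans ?_
    rcases Nat.eq_zero_or_pos n with rfl | hn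
    · simpa using by positivity
    have hn0 : (0 : ℝ) < n := by exact_mod_cast hn
    have hn1 : (1 : ℝ) ≤ (n : ℝ) ^ (1 / (k : ℝ)) :=
      Real.one_le_rpow (by exact_mod_cast hn) (by positivity)
    rw [Real.rpow_add hn0, Real.rpow_one]
    nlinarith
  have hsum : S.card = ∑ i, (S.filter fun e => g (G.edgeColor e) = i).card :=
    Finset.card_eq_sum_card_fiberwise (by simp)
  have h3 : (S.card : ℝ) ≤ (24 * k * f) * (4 * (n : ℝ) ^ (1 + 1 / (k : ℝ))) := by
    rw [hsum]
    push_cast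
    exact (Finset.sum_le_sum fun i _ => hpiece i).trans (by simp)
  have h4 : (H.card : ℝ) ≤ 2 * S.card := by exact_mod_cast hg
  have h5 : 0 ≤ k * f * (n : ℝ) ^ (1 + 1 / (k : ℝ)) := by positivity
  linarith

open Classical in
/-- The groups of the vertex colors divide the vertices into classes, and the edges between two
classes have no short cycle, after the bad edges have been removed. -/
theorem card_le_of_blocking_VCFT (hk : 1 ≤ k) (hf : 1 ≤ f) (hB : G.IsBlockingSet .VCFT (2 * k) H B)
    (hD : ∀ e ∈ H, (B.filter fun b => b.1 = e).card ≤ 4 * k * f) :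
    (H.card : ℝ) ≤
      5000 * (k * (f : ℝ) ^ (1 - 1 / (k : ℝ)) * (n : ℝ) ^ (1 + 1 / (k : ℝ))) := by
  obtain ⟨g, hg⟩ := exists_grouping hB.1 (by convert hD) (t := 24 * k * f) (by positivity)
    (by linarith)
  set S := H.filter fun e => ¬ G.IsBad .VCFT B g e with hS
  have h3 := card_le_of_classes (G := G) hk hf (fun x => g (G.vertexColor x)) S (by
    intro a b
    refine noShortCycle_of_not_isBad hB (g := g) ?_ ?_
    · intro e he
      simpa [hS] using he.1
    · rintro e ⟨-, he⟩ e' ⟨-, he'⟩ c' (hc' | hc')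
      · exact ⟨_, Or.inl rfl, by rw [← hc', he'.1, he.1]⟩
      · exact ⟨_, Or.inr rfl, by rw [← hc', he'.2, he.2]⟩)
  have h4 : (H.card : ℝ) ≤ 2 * S.card := by exact_mod_cast hg
  have h5 : 0 ≤ k * (f : ℝ) ^ (1 - 1 / (k : ℝ)) * (n : ℝ) ^ (1 + 1 / (k : ℝ)) := by positivity
  linarith

open Classical in
/-- The bound for vertex color faults is applied to the edges of each of the `24 * k * f` groups of
edge colors. -/
theorem card_le_of_blocking_MCFT (hk : 1 ≤ k) (hf : 1 ≤ f) (hB : G.IsBlockingSet .MCFT (2 * k) H B)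
    (hD : ∀ e ∈ H, (B.filter fun b => b.1 = e).card ≤ 4 * k * f) :
    (H.card : ℝ) ≤
      5000 * ((k : ℝ) ^ 2 * (f : ℝ) ^ (2 - 1 / (k : ℝ)) * (n : ℝ) ^ (1 + 1 / (k : ℝ))) := by
  obtain ⟨g, hg⟩ := exists_grouping hB.1 (by convert hD) (t := 24 * k * f) (by positivity)
    (by linarith)
  set S := H.filter fun e => ¬ G.IsBad .MCFT B g e with hS
  have hpiece := fun i => card_le_of_classes (G := G) hk hf (fun x => g (G.vertexColor x))
    (S.filter fun e => g (G.edgeColor e) = i) (by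
      intro a b
      refine noShortCycle_of_not_isBad hB (g := g) ?_ ?_
      · rintro e ⟨he, -⟩
        simp only [hS, Finset.mem_filter] at he
        exact he.1
      · rintro e ⟨hi, he⟩ e' ⟨hi', he'⟩ c' (hc' | hc' | hc')
        · exact ⟨_, Or.inl rfl, by
            rw [← hc', (Finset.mem_filter.1 hi').2, (Finset.mem_filter.1 hi).2]⟩
        · exact ⟨_, Or.inr (Or.inl rfl), by rw [← hc', he'.1, he.1]⟩
        · exact ⟨_, Or.inr (Or.inr rfl), by rw [← hc', he'.2, he.2]⟩)
  have hsum : S.card = ∑ i, (S.filter fun e => g (G.edgeColor e) = i).card :=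
    Finset.card_eq_sum_card_fiberwise (by simp)
  have h3 : (S.card : ℝ) ≤ (24 * k * f) *
      (96 * (k * (f : ℝ) ^ (1 - 1 / (k : ℝ)) * (n : ℝ) ^ (1 + 1 / (k : ℝ)))) := by
    rw [hsum]
    push_cast
    exact (Finset.sum_le_sum fun i _ => hpiece i).trans (by simp)
  have h4 : (H.card : ℝ) ≤ 2 * S.card := by exact_mod_cast hg
  have hf0 : (0 : ℝ) < f := by exact_mod_cast hf
  have h6 : (f : ℝ) ^ (2 - 1 / (k : ℝ)) = f * (f : ℝ) ^ (1 - 1 / (k : ℝ)) := by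
    rw [show (2 : ℝ) - 1 / (k : ℝ) = 1 + (1 - 1 / (k : ℝ)) by ring, Real.rpow_add hf0,
      Real.rpow_one]
  rw [h6]
  have h5 : 0 ≤ (k : ℝ) ^ 2 * (f * (f : ℝ) ^ (1 - 1 / (k : ℝ))) * (n : ℝ) ^ (1 + 1 / (k : ℝ)) := by
    positivity
  calc (H.card : ℝ) ≤ 2 * S.card := h4
    _ ≤ 2 * ((24 * k * f) *
      (96 * (k * (f : ℝ) ^ (1 - 1 / (k : ℝ)) * (n : ℝ) ^ (1 + 1 / (k : ℝ))))) := by gcongr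
    _ = 4608 * ((k : ℝ) ^ 2 * (f * (f : ℝ) ^ (1 - 1 / (k : ℝ))) * (n : ℝ) ^ (1 + 1 / (k : ℝ))) := by
      ring
    _ ≤ _ := by linarith

end Size

end ColoredGraph

end CFT

namespace CFT

variable {n m q : ℕ}

namespace ColoredGraph

variable {G : ColoredGraph n m q} {σ : Setting} {k f : ℕ} {t : ℝ≥0∞} {A A' : Set (Fin m)}
  {H H' : Finset (Fin m)} {e e' : Fin m} {u v w : Fin n} {p : List (Fin m × Fin n)}

/-! ### Distances and spanners -/

theorem walkWeight_cons (s : Fin m × Fin n) (p : List (Fin m × Fin n)) :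
    G.walkWeight (s :: p) = G.weight s.1 + G.walkWeight p := by
  simp [walkWeight]

theorem walkWeight_append (p p' : List (Fin m × Fin n)) :
    G.walkWeight (p ++ p') = G.walkWeight p + G.walkWeight p' := by
  simp [walkWeight]

theorem dist_le (h : G.IsWalk A u p v) : G.dist A u v ≤ G.walkWeight p := iInf₂_le p h

theorem dist_self (G : ColoredGraph n m q) (A : Set (Fin m)) (u : Fin n) : G.dist A u u = 0 := by
  simpa [walkWeight] using G.dist_le (.nil (A := A) u)

theorem dist_anti (hA : A ⊆ A') : G.dist A' u v ≤ G.dist A u v :=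
  le_iInf₂ fun _ hp => dist_le (hp.mono hA)

theorem dist_comm_le (G : ColoredGraph n m q) (A : Set (Fin m)) (u v : Fin n) :
    G.dist A u v ≤ G.dist A v u := by
  refine le_iInf₂ fun p hp => ?_
  obtain ⟨r, hr, hrp⟩ := hp.exists_reverse
  refine (dist_le hr).trans (le_of_eq ?_)
  have h : ∀ p : List (Fin m × Fin n),
      G.walkWeight p = ((p.map Prod.fst).map fun e => (G.weight e : ℝ≥0∞)).sum := by
    simp [walkWeight, Function.comp_def]
  rw [h, h, hrp, List.map_reverse, List.sum_reverse]

theorem dist_triangle (G : ColoredGraph n m q) (A : Set (Fin m)) (u v w : Fin n) :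
    G.dist A u w ≤ G.dist A u v + G.dist A v w := by
  unfold dist
  simp only [ENNReal.iInf_add, ENNReal.add_iInf]
  refine le_iInf₂ fun p' hp' => le_iInf₂ fun p hp => ?_
  rw [← walkWeight_append]
  exact dist_le (hp.append hp')

theorem surviving_mono {F : Finset (Fin q)} (hA : A ⊆ A') :
    G.surviving σ A F ⊆ G.surviving σ A' F := fun _ h => ⟨hA h.1, h.2⟩

/-- In `H`, the edge `e` is stretched by at most `t` under all faults that do not damage it. -/
def Covered (G : ColoredGraph n m q) (σ : Setting) (f : ℕ) (t : ℝ≥0∞) (H : Finset (Fin m))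
    (e : Fin m) : Prop :=
  ∀ F : Finset (Fin q), F.card ≤ f → (∀ c ∈ F, ¬ G.Damages σ c e) →
    G.dist (G.surviving σ H F) (G.src e) (G.dst e) ≤ t * G.weight e

theorem Covered.mono (h : G.Covered σ f t H e) (hH : H ⊆ H') : G.Covered σ f t H' e :=
  fun F hF hd => (dist_anti (surviving_mono (by exact_mod_cast hH))).trans (h F hF hd)

theorem covered_of_mem (he : e ∈ H) (ht : 1 ≤ t) : G.Covered σ f t H e := by
  intro F _ hd
  refine (dist_le (IsWalk.single (A := G.surviving σ H F) ⟨he, hd⟩ (Or.inl ⟨rfl, rfl⟩))).trans ?_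
  simpa [walkWeight] using le_mul_of_one_le_left' ht

/-- It suffices to bound the stretch of single edges, since walks are concatenations of edges. -/
theorem isFTSpanner_of_covered (ht : 1 ≤ t) (ht' : t ≠ ⊤) (h : ∀ e, G.Covered σ f t H e) :
    G.IsFTSpanner σ f t H := by
  intro F hF u v
  conv_rhs => unfold dist
  simp only [ENNReal.mul_iInf_of_ne (one_pos.trans_le ht).ne' ht']
  refine le_iInf₂ fun p hp => ?_
  induction hp with
  | nil u => simp [dist_self]
  | @cons u v w e p he hj _ ih =>
    rw [walkWeight_cons, mul_add]
    refine (G.dist_triangle _ u v w).trans (add_le_add ?_ ih)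
    have := h e F hF he.2
    rcases hj with ⟨rfl, rfl⟩ | ⟨rfl, rfl⟩
    · exact this
    · exact (G.dist_comm_le _ _ _).trans this

theorem Covered.congr (h : G.Covered σ f t H e') (hs : G.src e' = G.src e) (hd : G.dst e' = G.dst e)
    (hc : G.edgeColor e' = G.edgeColor e) (hw : G.weight e' ≤ G.weight e) :
    G.Covered σ f t H e := by
  intro F hF hF'
  have := h F hF (fun c hc' => by
    have := hF' c hc'
    cases σ <;> simp only [Damages, hs, hd, hc] at this ⊢ <;> exact this)
  rw [hs, hd] at this
  exact this.trans (by gcongr)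

/-- `f` faults that do not damage `e` leave one of `f + 1` edges parallel to `e` that have different
colors. -/
theorem covered_of_parallel {X : Finset (Fin m)} (hX : f < X.card)
    (hinj : ∀ e₁ ∈ X, ∀ e₂ ∈ X, G.edgeColor e₁ = G.edgeColor e₂ → e₁ = e₂)
    (h : ∀ e' ∈ X, G.Covered σ f t H e' ∧ G.src e' = G.src e ∧ G.dst e' = G.dst e ∧
      G.weight e' ≤ G.weight e) : G.Covered σ f t H e := by
  classical
  intro F hF hF'
  obtain ⟨e', he', hc⟩ : ∃ e' ∈ X, G.edgeColor e' ∉ F := by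
    by_contra! hall
    have := Finset.card_le_card_of_injOn G.edgeColor hall (fun e₁ h1 e₂ h2 => hinj e₁ h1 e₂ h2)
    omega
  obtain ⟨hcov, hs, hd, hw⟩ := h e' he'
  have := hcov F hF (fun c hc' => by
    have := hF' c hc'
    have : G.edgeColor e' ≠ c := by
      rintro rfl
      exact hc hc'
    cases σ <;> simp_all [Damages])
  rw [hs, hd] at this
  exact this.trans (by gcongr)

/-- Under any `f` faults that do not damage `e`, the subgraph `H` contains a walk with at most
`2 * k - 1` edges between the ends of `e`. -/
def Rejects (G : ColoredGraph n m q) (σ : Setting) (k f : ℕ) (H : Finset (Fin m)) (e : Fin m) :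
    Prop :=
  ∀ F : Finset (Fin q), F.card ≤ f → (∀ c ∈ F, ¬ G.Damages σ c e) →
    ∃ p, G.IsWalk (G.surviving σ H F) (G.dst e) p (G.src e) ∧ p.length ≤ 2 * k - 1

theorem Rejects.covered (h : G.Rejects σ k f H e) (hw : ∀ e' ∈ H, G.weight e' ≤ G.weight e) :
    G.Covered σ f ((2 * k - 1 : ℕ) : ℝ≥0∞) H e := by
  intro F hF hd
  obtain ⟨p, hp, hl⟩ := h F hF hd
  refine (G.dist_comm_le _ _ _).trans ((dist_le hp).trans ?_)
  have h1 : ∀ u v, G.IsWalk (G.surviving σ H F) u p v →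
      G.walkWeight p ≤ p.length * (G.weight e : ℝ≥0∞) := by
    clear hp hl
    induction p with
    | nil => simp [walkWeight]
    | cons s p ih =>
      intro u v hp
      cases hp with
      | cons he hj hp =>
        rw [walkWeight_cons, List.length_cons, Nat.cast_add, Nat.cast_one, add_mul, one_mul,
          add_comm]
        refine add_le_add (ih _ _ hp) ?_
        exact_mod_cast hw _ he.1
  exact (h1 _ _ hp).trans (by gcongr)

/-- The lists `p` and `p'` have no damaging color in common that does not damage `e`. -/
def ColorDisjoint (G : ColoredGraph n m q) (σ : Setting) (e : Fin m) (p p' : List (Fin m × Fin n)) :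
    Prop :=
  ∀ c, ¬ G.Damages σ c e → ∀ h ∈ p.map Prod.fst, ∀ h' ∈ p'.map Prod.fst,
    ¬ (G.Damages σ c h ∧ G.Damages σ c h')

/-- More than `min f m` pairwise color disjoint walks show that `e` may be rejected: if each of them
is hit by a fault, then different walks are hit by different colors at different edges. -/
theorem rejects_of_walks {ps : List (List (Fin m × Fin n))} (hps : min f m < ps.length)
    (hw : ∀ p ∈ ps, G.IsWalk H (G.dst e) p (G.src e) ∧ p.length ≤ 2 * k - 1)
    (hd : ps.Pairwise (G.ColorDisjoint σ e)) : G.Rejects σ k f H e := by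
  intro F hF hF'
  by_contra! hno
  have hhit : ∀ i : Fin ps.length, ∃ a : Fin m × Fin q, a.1 ∈ (ps[i]).map Prod.fst ∧ a.2 ∈ F ∧
      G.Damages σ a.2 a.1 := by
    intro i
    by_contra! hi
    have h1 := hw ps[i] (List.getElem_mem _)
    refine absurd h1.2 (not_le.2 (hno ps[i] (h1.1.restrict fun h hh => ?_)))
    exact ⟨h1.1.mem_edgeSet hh, fun c hc => hi (h, c) hh hc⟩
  choose a ha using hhit
  rw [List.pairwise_iff_getElem] at hd
  have hdis : ∀ i j : Fin ps.length, i ≠ j → (a i).1 ≠ (a j).1 ∧ (a i).2 ≠ (a j).2 := by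
    have hlt : ∀ i j : Fin ps.length, i < j → (a i).1 ≠ (a j).1 ∧ (a i).2 ≠ (a j).2 := by
      intro i j hij
      have h1 := hd i j i.2 j.2 hij
      refine ⟨fun heq => ?_, fun heq => ?_⟩
      · exact h1 (a i).2 (hF' _ (ha i).2.1) _ (ha i).1 _ (heq ▸ (ha j).1)
          ⟨(ha i).2.2, (ha i).2.2⟩
      · exact h1 (a i).2 (hF' _ (ha i).2.1) _ (ha i).1 _ (ha j).1
          ⟨(ha i).2.2, heq ▸ (ha j).2.2⟩
    intro i j hij
    rcases lt_or_gt_of_ne hij with h | h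
    · exact hlt i j h
    · exact ⟨(hlt j i h).1.symm, (hlt j i h).2.symm⟩
  have h1 : ps.length ≤ m := by
    have := Fintype.card_le_of_injective (fun i => (a i).1)
      fun i j hij => by_contra fun hne => (hdis i j hne).1 hij
    simpa using this
  have h2 : ps.length ≤ F.card := by
    have := Finset.card_le_card_of_injOn (s := Finset.univ) (fun i => (a i).2)
      (fun i _ => (ha i).2.1) fun i _ j _ hij => by_contra fun hne => (hdis i j hne).2 hij
    simpa using this
  omega

/-- Every vertex with an edge of `G` has an edge of the spanner. -/
theorem IsFTSpanner.exists_joins (hH : G.IsFTSpanner σ f t H) (ht' : t ≠ ⊤) (hj : G.Joins e u v) :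
    ∃ e' ∈ H, ∃ w, G.Joins e' u w := by
  have h2 : G.dist (G.surviving σ H ∅) u v < ⊤ := by
    refine (hH ∅ (by simp) u v).trans_lt (ENNReal.mul_lt_top ht'.lt_top ?_)
    refine (dist_le (IsWalk.single (by simp [surviving]) hj)).trans_lt ?_
    simp [walkWeight]
  unfold dist at h2
  simp only [iInf_lt_iff] at h2
  obtain ⟨p, hp, -⟩ := h2
  cases hp with
  | nil => exact absurd rfl hj.ne
  | cons he hj _ => exact ⟨_, he.1, _, hj⟩

/-! ### The blocking set of the greedy spanner -/

/-- The edge `e` may be added to `H` because of the colors in `F`: these are at most `4 * k * f`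
colors that do not damage `e`, and they hit all walks with at most `2 * k - 1` edges of `H` between
the ends of `e`. -/
structure Accepts (G : ColoredGraph n m q) (σ : Setting) (k f : ℕ) (H : Set (Fin m)) (e : Fin m)
    (F : Finset (Fin q)) : Prop where
  card_le : F.card ≤ 4 * k * f
  not_damages : ∀ c ∈ F, ¬ G.Damages σ c e
  hits : ∀ p, G.IsWalk H (G.dst e) p (G.src e) → p.length ≤ 2 * k - 1 →
    ∃ h ∈ p.map Prod.fst, ∃ c ∈ F, G.Damages σ c h

/-- The edges of the list, from the last to the first, were each accepted with respect to the
previous ones. -/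
def GreedyList (G : ColoredGraph n m q) (σ : Setting) (k f : ℕ) :
    List (Fin m × Finset (Fin q)) → Prop
  | [] => True
  | (e, F) :: L => GreedyList G σ k f L ∧ e ∉ L.map Prod.fst ∧
      G.Accepts σ k f {e | e ∈ L.map Prod.fst} e F

theorem GreedyList.nodup {L : List (Fin m × Finset (Fin q))} (h : G.GreedyList σ k f L) :
    (L.map Prod.fst).Nodup := by
  induction L with
  | nil => simp
  | cons a L ih =>
    rw [List.map_cons, List.nodup_cons]
    exact ⟨h.2.1, ih h.1⟩

theorem GreedyList.accepts {L : List (Fin m × Finset (Fin q))} (h : G.GreedyList σ k f L)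
    {a : Fin m × Finset (Fin q)} (ha : a ∈ L) : ∃ H, G.Accepts σ k f H a.1 a.2 := by
  induction L with
  | nil => simp at ha
  | cons b L ih =>
    rcases List.mem_cons.1 ha with rfl | ha
    · exact ⟨_, h.2.2⟩
    · exact ih h.1 ha

/-- The rest of a cycle is a walk between the ends of any of its edges. -/
theorem IsCycle.exists_walk (hp : G.IsCycle A u p) (he : e ∈ p.map Prod.fst) :
    ∃ r, G.IsWalk A (G.dst e) r (G.src e) ∧ r.length + 1 = p.length ∧
      ∀ h ∈ r.map Prod.fst, h ∈ p.map Prod.fst ∧ h ≠ e := by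
  obtain ⟨hp, -, hn, -⟩ := hp
  obtain ⟨⟨e', y⟩, hmem, rfl⟩ := List.mem_map.1 he
  obtain ⟨p1, p2, rfl⟩ := List.append_of_mem hmem
  obtain ⟨x, h1, h2⟩ := hp.of_append
  cases h2 with
  | cons he' hj h2 =>
    have h3 := h2.append h1
    have hne : ∀ h ∈ (p2 ++ p1).map Prod.fst,
        h ∈ (p1 ++ (e', y) :: p2).map Prod.fst ∧ h ≠ e' := by
      intro h hh
      simp only [List.map_append, List.map_cons] at hn hh ⊢
      rw [List.nodup_middle, List.nodup_cons] at hn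
      simp only [List.mem_append, List.mem_cons] at hh hn ⊢
      refine ⟨by tauto, ?_⟩
      rintro rfl
      tauto
    rcases hj with ⟨rfl, rfl⟩ | ⟨rfl, rfl⟩
    · exact ⟨p2 ++ p1, h3, by simp; omega, hne⟩
    · obtain ⟨r, hr, hrp⟩ := h3.exists_reverse
      refine ⟨r, hr, ?_, fun h hh => hne h ?_⟩
      · have := congrArg List.length hrp
        simp only [List.length_map, List.length_reverse, List.length_append] at this
        simp
        omega
      · simpa only [hrp, List.mem_reverse] using hh

/-- A short cycle is blocked at the edge of the cycle that was accepted last, since the rest of the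
cycle is a walk between its ends. -/
theorem GreedyList.exists_hit {L : List (Fin m × Finset (Fin q))} (h : G.GreedyList σ k f L)
    (hp : G.IsCycle {e | e ∈ L.map Prod.fst} u p) (hl : p.length ≤ 2 * k) :
    ∃ a ∈ L, a.1 ∈ p.map Prod.fst ∧ ∃ c ∈ a.2, ∃ e' ∈ p.map Prod.fst, G.Damages σ c e' := by
  induction L with
  | nil =>
    obtain ⟨h1, h2, -⟩ := hp
    cases h1 with
    | nil => exact absurd rfl h2
    | cons he _ _ => simp at he
  | cons a L ih =>
    by_cases hmem : a.1 ∈ p.map Prod.fst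
    · obtain ⟨r, hr, hrl, hrp⟩ := hp.exists_walk hmem
      obtain ⟨e', he', c, hc, hd⟩ := h.2.2.hits r (hr.restrict fun h hh => by
        have h1 := hr.mem_edgeSet hh
        have h2 := (hrp h hh).2
        simpa [h2] using h1) (by omega)
      exact ⟨a, by simp, hmem, c, hc, e', (hrp e' he').1, hd⟩
    · obtain ⟨b, hb, h1⟩ := ih h.1 ⟨hp.1.restrict fun h hh => by
        have h1 := hp.1.mem_edgeSet hh
        have h2 : h ≠ a.1 := by
          rintro rfl
          exact hmem hh
        simpa [h2] using h1, hp.2⟩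
      exact ⟨b, List.mem_cons_of_mem _ hb, h1⟩

theorem GreedyList.exists_blockingSet {L : List (Fin m × Finset (Fin q))}
    (h : G.GreedyList σ k f L) (hH : ∀ e, e ∈ H ↔ e ∈ L.map Prod.fst) :
    ∃ B : Finset (Fin m × Fin q), G.IsBlockingSet σ (2 * k) H B ∧
      ∀ e ∈ H, (B.filter fun b => b.1 = e).card ≤ 4 * k * f := by
  classical
  have hHs : (H : Set (Fin m)) = {e | e ∈ L.map Prod.fst} := by
    ext e
    exact hH e
  refine ⟨Finset.univ.filter fun b => ∃ F, (b.1, F) ∈ L ∧ b.2 ∈ F, ⟨?_, ?_⟩, ?_⟩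
  · rintro ⟨e, c⟩ hb
    simp only [Finset.mem_filter, Finset.mem_univ, true_and] at hb
    obtain ⟨F, hF, hc⟩ := hb
    obtain ⟨_, ha⟩ := h.accepts hF
    exact ⟨(hH e).2 (List.mem_map.2 ⟨_, hF, rfl⟩), ha.not_damages c hc⟩
  · intro u p hp hl
    rw [hHs] at hp
    obtain ⟨⟨e, F⟩, ha, he, c, hc, e', he', hd⟩ := h.exists_hit hp hl
    exact ⟨(e, c), by simpa using ⟨F, ha, hc⟩, he, e', he', hd⟩
  · intro e he
    obtain ⟨⟨e, F⟩, ha, rfl⟩ := List.mem_map.1 ((hH e).1 he)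
    obtain ⟨_, hacc⟩ := h.accepts ha
    refine le_trans (le_trans (Finset.card_le_card (t := F.image fun c => (e, c)) ?_)
      Finset.card_image_le) hacc.card_le
    rintro ⟨e', c⟩ hb
    simp only [Finset.mem_filter, Finset.mem_univ, true_and] at hb
    obtain ⟨⟨F', hF', hc⟩, rfl⟩ := hb
    have := List.inj_on_of_nodup_map h.nodup hF' ha rfl
    simp only [Prod.mk.injEq, true_and] at this
    exact Finset.mem_image.2 ⟨c, this ▸ hc, rfl⟩

end ColoredGraph

end CFT

namespace CFT

/-! ### Reasoning about programs -/

/-- `wp W P s Q`: the program `P`, started in `s`, halts, and `Q` holds for the number of steps and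
the final memory. -/
def wp (W : ℕ → ℝ≥0) (P : Program) (s : State) (Q : ℕ → State → Prop) : Prop :=
  ∃ T s', Exec W P s T s' ∧ Q T s'

variable {W : ℕ → ℝ≥0} {s s' s'' : State} {Q : ℕ → State → Prop} {P P' : Program} {b : Test}

theorem wp_skip : wp W .skip s Q ↔ Q 1 s :=
  ⟨fun ⟨_, _, h, hq⟩ => by cases h; exact hq, fun h => ⟨_, _, .skip _, h⟩⟩

theorem wp_const {x c : ℕ} : wp W (.const x c) s Q ↔ Q 1 (s.setReg x c) :=
  ⟨fun ⟨_, _, h, hq⟩ => by cases h; exact hq, fun h => ⟨_, _, .const _ _ _, h⟩⟩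

theorem wp_copy {x y : ℕ} : wp W (.copy x y) s Q ↔ Q 1 (s.setReg x (s.reg y)) :=
  ⟨fun ⟨_, _, h, hq⟩ => by cases h; exact hq, fun h => ⟨_, _, .copy _ _ _, h⟩⟩

theorem wp_inc {x : ℕ} : wp W (.inc x) s Q ↔ Q 1 (s.setReg x (s.reg x + 1)) :=
  ⟨fun ⟨_, _, h, hq⟩ => by cases h; exact hq, fun h => ⟨_, _, .inc _ _, h⟩⟩

theorem wp_dec {x : ℕ} : wp W (.dec x) s Q ↔ Q 1 (s.setReg x (s.reg x - 1)) :=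
  ⟨fun ⟨_, _, h, hq⟩ => by cases h; exact hq, fun h => ⟨_, _, .dec _ _, h⟩⟩

theorem wp_load {x a y : ℕ} : wp W (.load x a y) s Q ↔ Q 1 (s.setReg x (s.arr a (s.reg y))) :=
  ⟨fun ⟨_, _, h, hq⟩ => by cases h; exact hq, fun h => ⟨_, _, .load _ _ _ _, h⟩⟩

theorem wp_store {a x y : ℕ} :
    wp W (.store a x y) s Q ↔ Q 1 (s.setArr a (s.reg x) (s.reg y)) :=
  ⟨fun ⟨_, _, h, hq⟩ => by cases h; exact hq, fun h => ⟨_, _, .store _ _ _ _, h⟩⟩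

theorem wp_seq : wp W (.seq P P') s Q ↔ wp W P s fun T s' => wp W P' s' fun T' => Q (T + T') :=
  ⟨fun ⟨_, _, h, hq⟩ => by
    cases h with
    | seq h h' => exact ⟨_, _, h, _, _, h', hq⟩,
  fun ⟨_, _, h, _, _, h', hq⟩ => ⟨_, _, .seq h h', hq⟩⟩

theorem wp_ite : wp W (.ite b P P') s Q ↔
    (b.Holds W s → wp W P s fun T => Q (1 + T)) ∧
      (¬ b.Holds W s → wp W P' s fun T => Q (1 + T)) := by
  by_cases hb : b.Holds W s
  · simp only [hb, true_implies, not_true_eq_false, false_implies, and_true]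
    constructor
    · rintro ⟨_, _, h, hq⟩
      cases h with
      | ite_true _ h => exact ⟨_, _, h, hq⟩
      | ite_false h' _ => exact absurd hb h'
    · rintro ⟨_, _, h, hq⟩
      exact ⟨_, _, .ite_true hb h, hq⟩
  · simp only [hb, true_implies, not_false_eq_true, false_implies, true_and]
    constructor
    · rintro ⟨_, _, h, hq⟩
      cases h with
      | ite_true h' _ => exact absurd h' hb
      | ite_false _ h => exact ⟨_, _, h, hq⟩
    · rintro ⟨_, _, h, hq⟩
      exact ⟨_, _, .ite_false hb h, hq⟩

/-- The registers that a program can change. -/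
def Program.regWrites : Program → List ℕ
  | .skip => []
  | .const x _ => [x]
  | .copy x _ => [x]
  | .inc x => [x]
  | .dec x => [x]
  | .load x _ _ => [x]
  | .store _ _ _ => []
  | .seq P Q => P.regWrites ++ Q.regWrites
  | .ite _ P Q => P.regWrites ++ Q.regWrites
  | .while _ P => P.regWrites

/-- The arrays that a program can change. -/
def Program.arrWrites : Program → List ℕ
  | .store a _ _ => [a]
  | .seq P Q => P.arrWrites ++ Q.arrWrites
  | .ite _ P Q => P.arrWrites ++ Q.arrWrites
  | .while _ P => P.arrWrites
  | _ => []

/-- `s'` differs from `s` only in registers and arrays that `P` can change. -/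
structure Frame (P : Program) (s s' : State) : Prop where
  reg : ∀ x ∉ P.regWrites, s'.reg x = s.reg x
  arr : ∀ a ∉ P.arrWrites, s'.arr a = s.arr a

theorem Frame.refl (P : Program) (s : State) : Frame P s s := ⟨fun _ _ => rfl, fun _ _ => rfl⟩

theorem Frame.trans (h : Frame P s s') (h' : Frame P s' s'') : Frame P s s'' :=
  ⟨fun x hx => (h'.reg x hx).trans (h.reg x hx), fun a ha => (h'.arr a ha).trans (h.arr a ha)⟩

theorem Exec.frame {T : ℕ} (h : Exec W P s T s') : Frame P s s' := by
  induction h with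
  | skip | const | copy | inc | dec | load | store =>
    constructor <;> intro x hx <;> simp_all [Program.regWrites, Program.arrWrites, State.setReg,
      State.setArr, Function.update_of_ne]
  | seq _ _ ih ih' =>
    constructor <;> intro x hx <;> simp only [Program.regWrites, Program.arrWrites,
      List.mem_append, not_or] at hx
    · rw [ih'.reg x hx.2, ih.reg x hx.1]
    · rw [ih'.arr x hx.2, ih.arr x hx.1]
  | ite_true _ _ ih =>
    constructor <;> intro x hx <;> simp only [Program.regWrites, Program.arrWrites,
      List.mem_append, not_or] at hx
    · exact ih.reg x hx.1
    · exact ih.arr x hx.1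
  | ite_false _ _ ih =>
    constructor <;> intro x hx <;> simp only [Program.regWrites, Program.arrWrites,
      List.mem_append, not_or] at hx
    · exact ih.reg x hx.2
    · exact ih.arr x hx.2
  | while_true _ _ _ ih ih' =>
    constructor <;> intro x hx
    · rw [ih'.reg x hx, ih.reg x hx]
    · rw [ih'.arr x hx, ih.arr x hx]
  | while_false => exact Frame.refl _ _

/-- The rule of consequence, which also tells what the program leaves unchanged. -/
theorem wp.mono {R : ℕ → State → Prop} (h : wp W P s Q)
    (hQ : ∀ T s', Q T s' → Frame P s s' → R T s') : wp W P s R := by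
  obtain ⟨T, s', h, hq⟩ := h
  exact ⟨T, s', h, hQ T s' hq h.frame⟩

/-- The rule for loops. In the invariant `I j T s`, the number `j` decreases in every round, and `T`
is the number of steps so far. What the loop does not write to is known from the frame. -/
theorem wp_while (I : ℕ → ℕ → State → Prop) {j : ℕ} (h0 : I j 0 s)
    (hstep : ∀ j T s', I j T s' → Frame P s s' → b.Holds W s' →
      wp W P s' fun T' s'' => ∃ j' < j, I j' (T + 1 + T') s'') :
    wp W (.while b P) s fun T s' =>
      ∃ j T', T = T' + 1 ∧ I j T' s' ∧ Frame P s s' ∧ ¬ b.Holds W s' := by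
  suffices h : ∀ j T s', I j T s' → Frame P s s' → wp W (.while b P) s' fun T' s'' =>
      ∃ j T₀, T + T' = T₀ + 1 ∧ I j T₀ s'' ∧ Frame P s s'' ∧ ¬ b.Holds W s'' by
    simpa using h j 0 s h0 (Frame.refl P s)
  intro j
  induction j using Nat.strong_induction_on with
  | _ j ih =>
    intro T s' hI hf
    by_cases hb : b.Holds W s'
    · obtain ⟨T', s'', he, j', hj', hI'⟩ := hstep j T s' hI hf hb
      obtain ⟨T₂, s₂, he₂, j₂, T₀, h1, h2⟩ := ih j' hj' _ _ hI' (hf.trans he.frame)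
      exact ⟨_, _, .while_true hb he he₂, j₂, T₀, by omega, h2⟩
    · exact ⟨_, _, .while_false hb, j, T, rfl, hI, hf, hb⟩

theorem State.reg_setReg (s : State) (x v y : ℕ) :
    (s.setReg x v).reg y = if y = x then v else s.reg y := by
  simp [State.setReg, Function.update_apply]

theorem State.arr_setReg (s : State) (x v a : ℕ) : (s.setReg x v).arr a = s.arr a := rfl

theorem State.reg_setArr (s : State) (a i v x : ℕ) : (s.setArr a i v).reg x = s.reg x := rfl

theorem State.arr_setArr (s : State) (a i v b : ℕ) :
    (s.setArr a i v).arr b = if b = a then Function.update (s.arr a) i v else s.arr b := by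
  by_cases h : b = a
  · subst h
    simp [State.setArr]
  · simp [State.setArr, h]

theorem Test.holds_eq {x y : ℕ} : (Test.eq x y).Holds W s ↔ s.reg x = s.reg y := Iff.rfl
theorem Test.holds_lt {x y : ℕ} : (Test.lt x y).Holds W s ↔ s.reg x < s.reg y := Iff.rfl
theorem Test.holds_weightLE {x y : ℕ} :
    (Test.weightLE x y).Holds W s ↔ W (s.reg x) ≤ W (s.reg y) := Iff.rfl

/-! ### Linked lists -/

/-- The list with the first entry `h` and the successor function `nx` is `l`; entries are positive
and `0` marks the end. -/
def IsLinked (nx : ℕ → ℕ) : ℕ → List ℕ → Prop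
  | h, [] => h = 0
  | h, a :: l => h = a ∧ 0 < a ∧ IsLinked nx (nx a) l

theorem IsLinked.congr {nx nx' : ℕ → ℕ} {h : ℕ} {l : List ℕ} (hl : IsLinked nx h l)
    (hnx : ∀ a ∈ l, nx' a = nx a) : IsLinked nx' h l := by
  induction l generalizing h with
  | nil => exact hl
  | cons a l ih =>
    refine ⟨hl.1, hl.2.1, ?_⟩
    rw [hnx a (by simp)]
    exact ih hl.2.2 fun b hb => hnx b (List.mem_cons_of_mem _ hb)

end CFT

namespace CFT

variable {n m q : ℕ} {G : ColoredGraph n m q} {σ : Setting} {k f : ℕ} {W : ℕ → ℝ≥0}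

/-- The programs of a list, one after the other. -/
def Program.block : List Program → Program
  | [] => .skip
  | P :: l => .seq P (block l)

theorem wp_block_nil {s : State} {Q : ℕ → State → Prop} :
    wp W (Program.block []) s Q ↔ Q 1 s := wp_skip

theorem wp_block_cons {s : State} {Q : ℕ → State → Prop} {P : Program} {l : List Program} :
    wp W (Program.block (P :: l)) s Q ↔
      wp W P s fun T s' => wp W (Program.block l) s' fun T' => Q (T + T') := wp_seq

/-! ### Representation of the data -/

/-! The program uses the memory as follows, besides the input and some registers for intermediate
results.

* Constants: registers 6 (zero), 7 (one) and 8 (`min f m`); arrays 5 to 7 (codes of the colors of an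
  edge and its ends).
* Order of the edges: registers 9 (number of active vertices), 10 (number of edges read) and 14
  (handle of the lightest edge left); arrays 8 and 9 (lists of the edges from each vertex), 10
  (active vertices) and 11 (handle of the lightest edge left from each vertex).
* The edge considered: registers 17 (number), 11 and 18 (ends), 19 to 21 (codes of the colors) and
  42 (edge color).
* Test: registers 22 (stamp of the marks), 23 (number of walks found) and 24 (result); array 12
  (marks of the colors).
* Search: registers 25 (stamp of the visits), 26 and 27 (queue head and tail); arrays 13 (visits),
  14 and 15 (depths), 16 (queue), 17 and 18 (parent edges and vertices).
* Spanner: register 36 (number of incidences); arrays 19 to 22 (incidence lists).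
* Selection: arrays 23 (edges done) and 24 (numbers of parallel edges selected). -/

/-- The code of the color of an edge: `0` if edge colors do not fail, and the number of the color
plus one otherwise. With these codes the three settings need not be distinguished. -/
def codeE (G : ColoredGraph n m q) (σ : Setting) (e : Fin m) : ℕ :=
  match σ with
  | .VCFT => 0
  | _ => G.edgeColor e + 1

/-- The code of the color of a vertex: `0` if vertex colors do not fail. -/
def codeV (G : ColoredGraph n m q) (σ : Setting) (v : Fin n) : ℕ :=
  match σ with
  | .ECFT => 0
  | _ => G.vertexColor v + 1

theorem damages_iff (c : Fin q) (e : Fin m) : G.Damages σ c e ↔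
    codeE G σ e = c + 1 ∨ codeV G σ (G.src e) = c + 1 ∨ codeV G σ (G.dst e) = c + 1 := by
  cases σ <;> simp [ColoredGraph.Damages, codeE, codeV, Fin.ext_iff]

/-- The color codes of the edges are in the arrays 5 to 7. -/
structure HasCodes (G : ColoredGraph n m q) (σ : Setting) (s : State) : Prop where
  edge : ∀ e : Fin m, s.arr 5 e = codeE G σ e
  src : ∀ e : Fin m, s.arr 6 e = codeV G σ (G.src e)
  dst : ∀ e : Fin m, s.arr 7 e = codeV G σ (G.dst e)

/-- `F` is the set of the marked colors: those whose codes have the current stamp in array 12. The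
code `0` is never marked. -/
structure HasMarks (F : Finset (Fin q)) (s : State) : Prop where
  mark : ∀ c : Fin q, s.arr 12 (c + 1) = s.reg 22 ↔ c ∈ F
  zero : s.arr 12 0 ≠ s.reg 22
  stamp : ∀ i, s.arr 12 i ≤ s.reg 22

theorem exists_color_codeE {e : Fin m} (h : codeE G σ e ≠ 0) :
    ∃ c : Fin q, codeE G σ e = c + 1 := by
  cases σ <;> simp_all [codeE]

theorem exists_color_codeV {v : Fin n} (h : codeV G σ v ≠ 0) :
    ∃ c : Fin q, codeV G σ v = c + 1 := by
  cases σ <;> simp_all [codeV]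

theorem HasMarks.survives_iff {F : Finset (Fin q)} {s : State} (h : HasMarks F s) (e : Fin m) :
    (∀ c ∈ F, ¬ G.Damages σ c e) ↔ s.arr 12 (codeE G σ e) ≠ s.reg 22 ∧
      s.arr 12 (codeV G σ (G.src e)) ≠ s.reg 22 ∧ s.arr 12 (codeV G σ (G.dst e)) ≠ s.reg 22 := by
  have key : ∀ a : ℕ, (a ≠ 0 → ∃ c : Fin q, a = c + 1) →
      ((∀ c ∈ F, a ≠ c + 1) ↔ s.arr 12 a ≠ s.reg 22) := by
    intro a ha
    by_cases h0 : a = 0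
    · subst h0
      simp [h.zero]
    · obtain ⟨c, rfl⟩ := ha h0
      rw [ne_eq, h.mark c]
      constructor
      · intro hall hc
        exact hall c hc rfl
      · intro hc c' hc' heq
        have : c = c' := Fin.ext (by omega)
        exact hc (this ▸ hc')
  rw [← key _ exists_color_codeE, ← key _ exists_color_codeV, ← key _ exists_color_codeV]
  simp only [damages_iff, not_or]
  exact ⟨fun h => ⟨fun c hc => (h c hc).1, fun c hc => (h c hc).2.1, fun c hc => (h c hc).2.2⟩,
    fun h c hc => ⟨h.1 c hc, h.2.1 c hc, h.2.2 c hc⟩⟩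

/-- The incidences of the vertex `x` with the edges in `L`, as pairs (edge, other end). -/
def incidences (G : ColoredGraph n m q) (L : List (Fin m)) (x : Fin n) : List (Fin m × Fin n) :=
  L.flatMap fun e =>
    if G.src e = x then [(e, G.dst e)] else if G.dst e = x then [(e, G.src e)] else []

theorem mem_incidences {L : List (Fin m)} {x y : Fin n} {e : Fin m} :
    (e, y) ∈ incidences G L x ↔ e ∈ L ∧ G.Joins e x y := by
  simp only [incidences, List.mem_flatMap]
  constructor
  · rintro ⟨e', he', h⟩
    split_ifs at h with h1 h2
    · simp only [List.mem_singleton, Prod.mk.injEq] at h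
      obtain ⟨rfl, rfl⟩ := h
      exact ⟨he', Or.inl ⟨h1, rfl⟩⟩
    · simp only [List.mem_singleton, Prod.mk.injEq] at h
      obtain ⟨rfl, rfl⟩ := h
      exact ⟨he', Or.inr ⟨rfl, h2⟩⟩
    · simp at h
  · rintro ⟨he, hj⟩
    refine ⟨e, he, ?_⟩
    have := G.loopless e
    rcases hj with ⟨rfl, rfl⟩ | ⟨rfl, rfl⟩
    · simp
    · simp [this]

theorem sum_length_incidences (G : ColoredGraph n m q) (L : List (Fin m)) :
    ∑ x, (incidences G L x).length = 2 * L.length := by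
  induction L with
  | nil => simp [incidences]
  | cons e L ih =>
    have h1 : ∀ x, (incidences G (e :: L) x).length = (if G.src e = x then 1 else 0) +
        (if G.dst e = x then 1 else 0) + (incidences G L x).length := by
      intro x
      have := G.loopless e
      simp only [incidences, List.flatMap_cons, List.length_append]
      split_ifs with h1 h2 <;> simp_all
    simp only [h1, Finset.sum_add_distrib, ih]
    simp
    omega

/-- The subgraph with the edges `L` is stored as incidence lists: array 19 holds the first entries,
array 22 the successors, and arrays 20 and 21 the edge and the other end of an entry. Register 36 is
the number of entries in use. -/
def HasSubgraph (G : ColoredGraph n m q) (L : List (Fin m)) (s : State) : Prop :=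
  ∀ x : Fin n, ∃ l, IsLinked (s.arr 22) (s.arr 19 x) l ∧
    List.Forall₂ (fun a b => s.arr 20 a = (b.1 : Fin m) ∧ s.arr 21 a = (b.2 : Fin n) ∧ a ≤ s.reg 36)
      l (incidences G L x)

/-! ### Breadth-first search -/

/-- Scan the incidence list of the vertex in register 28. -/
def bfsScan : Program :=
  .while (.lt 6 31) (.block [
    .load 32 21 31, .load 35 13 32,
    .ite (.eq 35 25) .skip (.block [
      .load 33 20 31, .load 34 5 33, .load 35 12 34,
      .ite (.eq 35 22) .skip (.block [
        .load 34 6 33, .load 35 12 34,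
        .ite (.eq 35 22) .skip (.block [
          .load 34 7 33, .load 35 12 34,
          .ite (.eq 35 22) .skip (.block [
            .store 13 32 25, .store 14 32 29, .store 15 32 30, .store 17 32 33, .store 18 32 28,
            .store 16 27 32, .inc 27])])])]),
    .load 31 22 31])

/-- Search from the vertex in register 11 for walks with at most `2 * k - 1` edges that survive the
failure of the marked colors. The distance `d` of a visited vertex is stored as `d / 2` and
`(d + 1) / 2` in the arrays 14 and 15, and its parent edge and vertex in the arrays 17 and 18.
With these halves `d < 2 * k - 1` means `(d + 1) / 2 < k`; the number `2 * k - 1` itself cannot be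
computed in time independent of `k`. -/
def bfs : Program :=
  .block [
    .inc 25, .store 13 11 25, .store 14 11 6, .store 15 11 6, .store 16 6 11,
    .const 26 0, .const 27 1,
    .while (.lt 26 27) (.block [
      .load 28 16 26, .inc 26, .load 29 15 28,
      .ite (.lt 29 3) (.block [.load 30 14 28, .inc 30, .load 31 19 28, bfsScan]) .skip])]

/-- The depth of a visited vertex. -/
def depth (s : State) (x : ℕ) : ℕ := s.arr 14 x + s.arr 15 x

/-- The invariant of the search from `u` along the edges in `A`; the list `Q` is the queue,
including the vertices already removed from it. A vertex is visited if its entry in array 13 is the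
stamp of the search, in register 25; so nothing has to be erased before the next search. -/
structure BfsInv (G : ColoredGraph n m q) (A : Set (Fin m)) (k : ℕ) (u : Fin n) (Q : List (Fin n))
    (s : State) : Prop where
  len : s.reg 27 = Q.length
  queue : ∀ (i : ℕ) (x : Fin n), Q[i]? = some x → s.arr 16 i = x
  nodup : Q.Nodup
  vis : ∀ x : Fin n, s.arr 13 x = s.reg 25 ↔ x ∈ Q
  halves : ∀ x ∈ Q, s.arr 14 x ≤ s.arr 15 x ∧ s.arr 15 x ≤ s.arr 14 x + 1
  root : u ∈ Q
  zero : ∀ x ∈ Q, depth s x = 0 ↔ x = u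
  tree : ∀ x ∈ Q, x ≠ u → ∃ e ∈ A, ∃ y ∈ Q, G.Joins e x y ∧ s.arr 17 x = e ∧ s.arr 18 x = y ∧
    depth s x = depth s y + 1
  depth_le : ∀ x ∈ Q, depth s x ≤ 2 * k - 1 ∧ depth s x ≤ s.reg 26
  sorted : Q.Pairwise fun x y : Fin n => depth s x ≤ depth s y
  stamp : ∀ i, s.arr 13 i ≤ s.reg 25

/-- Visit the vertex `y` from the vertex `x`. The depth `d` becomes `d + 1`, and the pair
`(d / 2, (d + 1) / 2)` becomes `((d + 1) / 2, d / 2 + 1)`. -/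
theorem BfsInv.push {A : Set (Fin m)} {u x y : Fin n} {Q : List (Fin n)} {s s' : State}
    (h : BfsInv G A k u Q s) (hx : x ∈ Q) (hy : y ∉ Q) {e : Fin m} (he : e ∈ A)
    (hj : G.Joins e x y) (hd : depth s x < 2 * k - 1) (hd' : depth s x + 1 ≤ s.reg 26)
    (hle : ∀ z ∈ Q, depth s z ≤ depth s x + 1)
    (h27 : s'.reg 27 = s.reg 27 + 1) (h26 : s'.reg 26 = s.reg 26) (h25 : s'.reg 25 = s.reg 25)
    (a13 : s'.arr 13 = Function.update (s.arr 13) y (s.reg 25))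
    (a14 : s'.arr 14 = Function.update (s.arr 14) y (s.arr 15 x))
    (a15 : s'.arr 15 = Function.update (s.arr 15) y (s.arr 14 x + 1))
    (a16 : s'.arr 16 = Function.update (s.arr 16) (s.reg 27) y)
    (a17 : s'.arr 17 = Function.update (s.arr 17) y e)
    (a18 : s'.arr 18 = Function.update (s.arr 18) y x) :
    BfsInv G A k u (Q ++ [y]) s' ∧ (∀ z ∈ Q, depth s' z = depth s z) ∧
      depth s' y = depth s x + 1 := by
  have hne : ∀ z ∈ Q, (z : ℕ) ≠ y := fun z hz heq => hy (Fin.ext heq ▸ hz)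
  have hold : ∀ z ∈ Q, depth s' z = depth s z := fun z hz => by
    simp [depth, a14, a15, Function.update_of_ne (hne z hz)]
  have hnew : depth s' y = depth s x + 1 := by
    simp [depth, a14, a15]
    omega
  have hxu := h.halves x hx
  refine ⟨⟨?_, ?_, ?_, ?_, ?_, ?_, ?_, ?_, ?_, ?_, ?_⟩, hold, hnew⟩
  · simp [h27, h.len]
  · intro i z hz
    rw [a16, h.len]
    rcases lt_trichotomy i Q.length with hi | rfl | hi
    · rw [List.getElem?_append_left hi] at hz
      rw [Function.update_of_ne hi.ne]
      exact h.queue i z hz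
    · simp at hz
      simp [hz]
    · rw [List.getElem?_append_right hi.le, List.getElem?_eq_none (by simp; omega)] at hz
      simp at hz
  · rw [List.nodup_append]
    refine ⟨h.nodup, by simp, ?_⟩
    rintro z hz w hw rfl
    simp only [List.mem_singleton] at hw
    exact hy (hw ▸ hz)
  · intro z
    rw [a13, h25]
    by_cases hz : z = y
    · simp [hz]
    · rw [Function.update_of_ne (fun h => hz (Fin.ext h)), h.vis z]
      simp [hz]
  · intro z hz
    rw [List.mem_append, List.mem_singleton] at hz
    rcases hz with hz | rfl
    · rw [a14, a15, Function.update_of_ne (hne z hz), Function.update_of_ne (hne z hz)]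
      exact h.halves z hz
    · simp [a14, a15]
      omega
  · exact List.mem_append_left _ h.root
  · intro z hz
    rw [List.mem_append, List.mem_singleton] at hz
    rcases hz with hz | rfl
    · rw [hold z hz]
      exact h.zero z hz
    · rw [hnew]
      simp only [Nat.add_eq_zero_iff, one_ne_zero, and_false, false_iff]
      rintro rfl
      exact hy h.root
  · intro z hz hzu
    rw [List.mem_append, List.mem_singleton] at hz
    rcases hz with hz | rfl
    · obtain ⟨e', he', w, hw, hj', h1, h2, h3⟩ := h.tree z hz hzu
      refine ⟨e', he', w, List.mem_append_left _ hw, hj', ?_, ?_, ?_⟩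
      · rw [a17, Function.update_of_ne (hne z hz), h1]
      · rw [a18, Function.update_of_ne (hne z hz), h2]
      · rw [hold z hz, hold w hw, h3]
    · exact ⟨e, he, x, List.mem_append_left _ hx, hj.symm, by simp [a17], by simp [a18],
        by rw [hnew, hold x hx]⟩
  · intro z hz
    rw [List.mem_append, List.mem_singleton] at hz
    rw [h26]
    rcases hz with hz | rfl
    · rw [hold z hz]
      exact h.depth_le z hz
    · rw [hnew]
      omega
  · rw [List.pairwise_append]
    refine ⟨?_, by simp, ?_⟩
    · refine h.sorted.imp_of_mem fun {a b} ha hb hab => ?_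
      rwa [hold a ha, hold b hb]
    · intro z hz w hw
      rw [List.mem_singleton] at hw
      rw [hw, hnew, hold z hz]
      exact hle z hz
  · intro i
    rw [a13, h25]
    by_cases hi : i = y
    · simp [hi]
    · rw [Function.update_of_ne hi]
      exact h.stamp i

theorem BfsInv.congr {A : Set (Fin m)} {u : Fin n} {Q : List (Fin n)} {s s' : State}
    (h : BfsInv G A k u Q s) (h27 : s'.reg 27 = s.reg 27) (h26 : s.reg 26 ≤ s'.reg 26)
    (h25 : s'.reg 25 = s.reg 25) (ha : ∀ a ∈ [13, 14, 15, 16, 17, 18], s'.arr a = s.arr a) :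
    BfsInv G A k u Q s' := by
  have hd : ∀ x, depth s' x = depth s x := fun x => by simp [depth, ha]
  constructor
  · rw [h27, h.len]
  · simpa [ha] using h.queue
  · exact h.nodup
  · simpa [ha, h25] using h.vis
  · simpa [ha] using h.halves
  · exact h.root
  · simpa [hd] using h.zero
  · simpa [hd, ha] using h.tree
  · intro x hx
    have := h.depth_le x hx
    rw [hd]
    omega
  · simpa [hd] using h.sorted
  · simpa [h25, ha] using h.stamp

open ColoredGraph in
/-- The list `Q'` consists of the vertices visited from `x`. -/
theorem wp_bfsScan {L : List (Fin m)} {F : Finset (Fin q)} {u x : Fin n} {Q : List (Fin n)}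
    {s : State} (h : BfsInv G (G.surviving σ {e | e ∈ L} F) k u Q s) (hcode : HasCodes G σ s)
    (hmark : HasMarks F s) (hsub : HasSubgraph G L s) (h6 : s.reg 6 = 0) (hx : x ∈ Q)
    (h28 : s.reg 28 = x) (h29 : s.reg 29 = s.arr 15 x) (h30 : s.reg 30 = s.arr 14 x + 1)
    (h31 : s.reg 31 = s.arr 19 x)
    (hd : depth s x < 2 * k - 1) (hd' : depth s x + 1 ≤ s.reg 26)
    (hle : ∀ z ∈ Q, depth s z ≤ depth s x + 1) :
    wp W bfsScan s fun T s' => ∃ Q', T ≤ 40 * (incidences G L x).length + 1 ∧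
      BfsInv G (G.surviving σ {e | e ∈ L} F) k u (Q ++ Q') s' ∧
      (∀ z ∈ Q, depth s' z = depth s z) ∧ (∀ z ∈ Q', depth s' z = depth s x + 1) ∧
      ∀ e ∈ G.surviving σ {e | e ∈ L} F, ∀ y, G.Joins e x y → y ∈ Q ++ Q' := by
  obtain ⟨l, hl, hl2⟩ := hsub x
  -- the incidences `i1` have been scanned, and `l2` is left, stored as `l'`
  refine (wp_while (j := l.length) (fun j T s' => ∃ Q' l' l2 i1, l'.length = j ∧
    incidences G L x = i1 ++ l2 ∧ IsLinked (s.arr 22) (s'.reg 31) l' ∧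
    List.Forall₂ (fun a b => s.arr 20 a = (b.1 : Fin m) ∧ s.arr 21 a = (b.2 : Fin n) ∧ a ≤ s.reg 36)
      l' l2 ∧ T ≤ 40 * i1.length ∧
    BfsInv G (G.surviving σ {e | e ∈ L} F) k u (Q ++ Q') s' ∧ s'.reg 25 = s.reg 25 ∧
      (∀ z ∈ Q, s'.arr 14 z = s.arr 14 z ∧ s'.arr 15 z = s.arr 15 z) ∧
      (∀ z ∈ Q', depth s' z = depth s x + 1) ∧
      ∀ b ∈ i1, b.1 ∈ G.surviving σ {e | e ∈ L} F → b.2 ∈ Q ++ Q') ?_ ?_).mono ?_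
  · exact ⟨[], l, incidences G L x, [], rfl, rfl, h31 ▸ hl, hl2, by simp, by simpa using h, rfl,
      by simp, by simp, by simp⟩
  · rintro j T s1 ⟨Q', l', l2, i1, rfl, hi, hl', hl2', hT, hI, h25, hold, hnew, hcl⟩ hf hb
    rw [Test.holds_lt, hf.reg 6 (by decide), h6] at hb
    cases hl2' with
    | nil =>
      have : s1.reg 31 = 0 := hl'
      omega
    | @cons a b l' l2 hab hrest =>
      obtain ⟨e, y⟩ := b
      obtain ⟨h31', ha0, hl'⟩ := hl'
      obtain ⟨h20, h21, -⟩ := hab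
      have hmem : (e, y) ∈ incidences G L x := by rw [hi]; simp
      obtain ⟨heL, hj⟩ := mem_incidences.1 hmem
      have r22 := hf.reg 22 (by decide)
      have r28 := hf.reg 28 (by decide)
      have r29 := hf.reg 29 (by decide)
      have r30 := hf.reg 30 (by decide)
      have r6 := hf.reg 6 (by decide)
      have r26 := hf.reg 26 (by decide)
      have a5 := hf.arr 5 (by decide)
      have a6 := hf.arr 6 (by decide)
      have a7 := hf.arr 7 (by decide)
      have a12 := hf.arr 12 (by decide)
      have a20 := hf.arr 20 (by decide)
      have a21 := hf.arr 21 (by decide)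
      have a22 := hf.arr 22 (by decide)
      have hsurv := hmark.survives_iff (G := G) (σ := σ) e
      have hdx : depth s1 x = depth s x := by simp [depth, hold x hx]
      dsimp only at h20 h21
      have hyA : e ∈ G.surviving σ {e | e ∈ L} F ↔ _ := (and_iff_right heL).trans hsurv
      refine wp.mono (Q := fun T' s2 => T' ≤ 39 ∧ s2.reg 31 = s.arr 22 a ∧
        ((s2.reg 27 = s1.reg 27 ∧ (∀ a ∈ [13, 14, 15, 16, 17, 18], s2.arr a = s1.arr a) ∧
          (e ∈ G.surviving σ {e | e ∈ L} F → s1.arr 13 y = s1.reg 25)) ∨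
        (s2.reg 27 = s1.reg 27 + 1 ∧ s1.arr 13 y ≠ s1.reg 25 ∧ e ∈ G.surviving σ {e | e ∈ L} F ∧
          s2.arr 13 = Function.update (s1.arr 13) y (s1.reg 25) ∧
          s2.arr 14 = Function.update (s1.arr 14) y (s.arr 15 x) ∧
          s2.arr 15 = Function.update (s1.arr 15) y (s.arr 14 x + 1) ∧
          s2.arr 16 = Function.update (s1.arr 16) (s1.reg 27) y ∧
          s2.arr 17 = Function.update (s1.arr 17) y e ∧
          s2.arr 18 = Function.update (s1.arr 18) y x))) ?_ ?_
      · simp only [wp_block_cons, wp_block_nil, wp_load, wp_ite, wp_skip, wp_store, wp_inc,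
          State.reg_setReg, State.arr_setReg, State.reg_setArr, State.arr_setArr, Test.holds_eq,
          reduceIte, Nat.reduceEqDiff, h31', a20, a21, a22, a5, a6, a7, a12, h20, h21, r22, r28,
          r29, r30, hcode.edge, hcode.src, hcode.dst, h28, h29, h30, List.forall_mem_cons, hyA]
        simp +contextual
      · rintro T' s2 ⟨hT', h31'', hcase⟩ hf2
        have q25 : s2.reg 25 = s1.reg 25 := hf2.reg 25 (by decide)
        have q26 : s2.reg 26 = s1.reg 26 := hf2.reg 26 (by decide)
        have hTT : T + 1 + T' ≤ 40 * (i1 ++ [(e, y)]).length := by simp; omega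
        refine ⟨l'.length, by simp, ?_⟩
        rcases hcase with ⟨q27, ha, hs⟩ | ⟨q27, hnv, hs, b13, b14, b15, b16, b17, b18⟩
        · refine ⟨Q', l', l2, i1 ++ [(e, y)], rfl, by simp [hi], h31'' ▸ hl', hrest, hTT,
            hI.congr q27 q26.ge q25 ha, q25.trans h25, ?_, ?_, ?_⟩
          · simpa [ha] using hold
          · simpa [ha, depth] using hnew
          · intro b hb hbs
            rw [List.mem_append, List.mem_singleton] at hb
            rcases hb with hb | rfl
            · exact hcl b hb hbs
            · exact (hI.vis y).1 (hs hbs)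
        · have hy : y ∉ Q ++ Q' := fun hy => hnv ((hI.vis y).2 hy)
          obtain ⟨hI2, hold2, hnew2⟩ := hI.push (s' := s2) (List.mem_append_left _ hx) hy hs hj
            (by rw [hdx]; exact hd) (by rw [hdx, r26]; exact hd') (by
              intro z hz
              rw [hdx]
              rcases List.mem_append.1 hz with hz | hz
              · have := hold z hz
                have := hle z hz
                simp_all [depth]
              · exact (hnew z hz).le) q27 q26 q25 b13 (by rw [b14, (hold x hx).2])
            (by rw [b15, (hold x hx).1]) b16 b17 b18
          refine ⟨Q' ++ [y], l', l2, i1 ++ [(e, y)], rfl, by simp [hi], h31'' ▸ hl', hrest, hTT,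
            by simpa using hI2, q25.trans h25, ?_, ?_, ?_⟩
          · intro z hz
            have : (z : ℕ) ≠ y := fun heq => hy (List.mem_append_left _ (Fin.ext heq ▸ hz))
            rw [b14, b15, Function.update_of_ne this, Function.update_of_ne this]
            exact hold z hz
          · intro z hz
            rcases List.mem_append.1 hz with hz | hz
            · rw [hold2 z (List.mem_append_right _ hz), hnew z hz]
            · rw [List.mem_singleton.1 hz, hnew2, hdx]
          · intro b hb hbs
            rw [List.mem_append, List.mem_singleton] at hb
            rcases hb with hb | rfl
            · have := hcl b hb hbs
              simp only [List.mem_append] at this ⊢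
              tauto
            · simp
  · rintro T s' ⟨j, T', rfl, ⟨Q', l', l2, i1, rfl, hi, hl', hl2', hT, hI, h25, hold, hnew, hcl⟩, hf,
      hb⟩ -
    rw [Test.holds_lt, hf.reg 6 (by decide), h6] at hb
    have hnil : l2 = [] := by
      cases hl2' with
      | nil => rfl
      | cons =>
        have := hl'.1
        have := hl'.2.1
        omega
    subst hnil
    rw [List.append_nil] at hi
    subst hi
    refine ⟨Q', by omega, hI, ?_, hnew, ?_⟩
    · intro z hz
      simp [depth, hold z hz]
    · intro e he y hj
      exact hcl (e, y) (mem_incidences.2 ⟨he.1, hj⟩) he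

end CFT

namespace CFT

variable {n m q : ℕ} {G : ColoredGraph n m q} {σ : Setting} {k f : ℕ} {W : ℕ → ℝ≥0}

theorem HasCodes.congr {s s' : State} (h : HasCodes G σ s)
    (ha : ∀ a ∈ [5, 6, 7], s'.arr a = s.arr a) : HasCodes G σ s' := by
  constructor
  · simpa [ha] using h.edge
  · simpa [ha] using h.src
  · simpa [ha] using h.dst

theorem HasMarks.congr {F : Finset (Fin q)} {s s' : State} (h : HasMarks F s)
    (ha : s'.arr 12 = s.arr 12) (hr : s'.reg 22 = s.reg 22) : HasMarks F s' := by
  constructor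
  · simpa [ha, hr] using h.mark
  · simpa [ha, hr] using h.zero
  · simpa [ha, hr] using h.stamp

theorem HasSubgraph.congr {L : List (Fin m)} {s s' : State} (h : HasSubgraph G L s)
    (ha : ∀ a ∈ [19, 20, 21, 22], s'.arr a = s.arr a) (hr : s'.reg 36 = s.reg 36) :
    HasSubgraph G L s' := by
  unfold HasSubgraph at *
  simpa [ha, hr] using h

theorem HasCodes.frame {P : Program} {s s' : State} (h : HasCodes G σ s) (hf : Frame P s s')
    (hP : ∀ a ∈ [5, 6, 7], a ∉ P.arrWrites) : HasCodes G σ s' :=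
  h.congr fun a ha => hf.arr a (hP a ha)

theorem HasSubgraph.frame {P : Program} {L : List (Fin m)} {s s' : State} (h : HasSubgraph G L s)
    (hf : Frame P s s') (hP : ∀ a ∈ [19, 20, 21, 22], a ∉ P.arrWrites) (hP' : 36 ∉ P.regWrites) :
    HasSubgraph G L s' :=
  h.congr (fun a ha => hf.arr a (hP a ha)) (hf.reg 36 hP')

/-- Every visited vertex other than the root is incident with an edge of the subgraph, so that the
time of a search does not depend on the number of vertices. -/
theorem BfsInv.length_le {L : List (Fin m)} {F : Finset (Fin q)} {u : Fin n} {Q : List (Fin n)}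
    {s : State} (h : BfsInv G (G.surviving σ {e | e ∈ L} F) k u Q s) :
    Q.length ≤ 2 * L.length + 1 := by
  classical
  calc Q.length = ∑ _x ∈ Q.toFinset, 1 := by
        rw [← Finset.card_eq_sum_ones, List.toFinset_card_of_nodup h.nodup]
    _ ≤ ∑ x ∈ Q.toFinset, ((incidences G L x).length + if x = u then 1 else 0) := by
        refine Finset.sum_le_sum fun x hx => ?_
        by_cases hu : x = u
        · simp [hu]
        · obtain ⟨e, he, y, -, hj, -⟩ := h.tree x (List.mem_toFinset.1 hx) hu
          have : 0 < (incidences G L x).length :=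
            List.length_pos_of_mem (mem_incidences.2 ⟨he.1, hj⟩)
          omega
    _ ≤ ∑ x, ((incidences G L x).length + if x = u then 1 else 0) :=
        Finset.sum_le_sum_of_subset (Finset.subset_univ _)
    _ = 2 * L.length + 1 := by
        rw [Finset.sum_add_distrib, sum_length_incidences]
        simp

/-- The time needed to scan the incidences of all visited vertices. -/
theorem BfsInv.sum_le {L : List (Fin m)} {F : Finset (Fin q)} {u : Fin n} {Q : List (Fin n)}
    {s : State} (h : BfsInv G (G.surviving σ {e | e ∈ L} F) k u Q s) :
    (Q.map fun x => 40 * (incidences G L x).length + 20).sum ≤ 120 * L.length + 20 := by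
  classical
  have h1 : (Q.map fun x => (incidences G L x).length).sum ≤ 2 * L.length := by
    rw [← List.sum_toFinset _ h.nodup, ← sum_length_incidences G L]
    exact Finset.sum_le_sum_of_subset (Finset.subset_univ _)
  have h2 := h.length_le
  rw [List.sum_map_add, List.sum_map_mul_left]
  simp
  omega

open ColoredGraph in
/-- The vertices `Q` visited by the search form a tree, and every surviving edge at a visited vertex
of depth less than `2 * k - 1` leads to a visited vertex. -/
theorem wp_bfs {L : List (Fin m)} {F : Finset (Fin q)} {u : Fin n} {s : State} (hk : 1 ≤ k)
    (hcode : HasCodes G σ s) (hmark : HasMarks F s) (hsub : HasSubgraph G L s) (h6 : s.reg 6 = 0)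
    (h3 : s.reg 3 = k) (h11 : s.reg 11 = u) (hst : ∀ i, s.arr 13 i ≤ s.reg 25) :
    wp W bfs s fun T s' => ∃ Q, T ≤ 150 * (L.length + 1) ∧
      BfsInv G (G.surviving σ {e | e ∈ L} F) k u Q s' ∧
      (∀ x ∈ Q, depth s' x ≤ 2 * L.length + 1) ∧
      ∀ x ∈ Q, depth s' x < 2 * k - 1 → ∀ e ∈ G.surviving σ {e | e ∈ L} F, ∀ y, G.Joins e x y →
        y ∈ Q ∧ depth s' y ≤ depth s' x + 1 := by
  unfold bfs
  simp only [wp_block_cons, wp_block_nil, wp_const, wp_store, wp_inc,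
    State.reg_setReg, State.reg_setArr, reduceIte, Nat.reduceEqDiff, h6, h11]
  set s0 : State := (((((((s.setReg 25 (s.reg 25 + 1)).setArr 13 u (s.reg 25 + 1)).setArr 14 u
    0).setArr 15 u 0).setArr 16 0 u).setReg 26 0).setReg 27 1) with hs0
  have hne : ∀ i, s.arr 13 i ≠ s.reg 25 + 1 := fun i => by
    have := hst i
    omega
  have hI0 : BfsInv G (G.surviving σ {e | e ∈ L} F) k u [u] s0 := by
    constructor
    all_goals try simp [hs0, State.reg_setReg, State.arr_setReg, State.reg_setArr, State.arr_setArr,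
      depth]
    · intro i x hx
      have hi : i = 0 := by
        by_contra hi
        rw [List.getElem?_eq_none (by simp; omega)] at hx
        simp at hx
      subst hi
      simpa using congrArg (Option.map Fin.val) hx
    · intro x
      by_cases hx : x = u
      · simp [hx]
      · rw [Function.update_of_ne (fun h => hx (Fin.ext h))]
        simp [hx, hne]
    · intro i
      by_cases hi : i = u
      · simp [hi]
      · rw [Function.update_of_ne hi]
        have := hst i
        omega
  have h6' : s0.reg 6 = 0 := by simpa [hs0, State.reg_setReg, State.reg_setArr] using h6
  have h3' : s0.reg 3 = k := by simpa [hs0, State.reg_setReg, State.reg_setArr] using h3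
  have h26' : s0.reg 26 = 0 := by simp [hs0, State.reg_setReg]
  replace hcode : HasCodes G σ s0 := hcode.congr (by simp [hs0, State.arr_setReg, State.arr_setArr])
  replace hmark : HasMarks F s0 := hmark.congr (by simp [hs0, State.arr_setReg, State.arr_setArr])
    (by simp [hs0, State.reg_setReg, State.reg_setArr])
  replace hsub : HasSubgraph G L s0 := hsub.congr
    (by simp [hs0, State.arr_setReg, State.arr_setArr])
    (by simp [hs0, State.reg_setReg, State.reg_setArr])
  clear_value s0
  -- the vertices in `Q1` have been removed from the queue, and those in `Q2` are left
  refine (wp_while (j := n) (fun j T s' => ∃ Q1 Q2, j + Q1.length = n ∧ s'.reg 26 = Q1.length ∧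
    BfsInv G (G.surviving σ {e | e ∈ L} F) k u (Q1 ++ Q2) s' ∧
    T ≤ (Q1.map fun x => 40 * (incidences G L x).length + 20).sum ∧
    (∀ x ∈ Q2.head?, ∀ z ∈ Q1 ++ Q2, depth s' z ≤ depth s' x + 1) ∧
    ∀ x ∈ Q1, depth s' x < 2 * k - 1 → ∀ e ∈ G.surviving σ {e | e ∈ L} F, ∀ y, G.Joins e x y →
        y ∈ Q1 ++ Q2 ∧ depth s' y ≤ depth s' x + 1) ?_ ?_).mono ?_
  · exact ⟨[], [u], by simp, by simpa using h26', hI0, by simp, by simp, by simp⟩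
  · rintro j T s1 ⟨Q1, Q2, hj, h26, hI, hT, hhead, hcl⟩ hf hb
    rw [Test.holds_lt, h26, hI.len] at hb
    cases Q2 with
    | nil => simp at hb
    | cons x Q2 =>
      have hxQ : x ∈ Q1 ++ x :: Q2 := by simp
      have h16 : s1.arr 16 Q1.length = x := hI.queue _ _ (by simp)
      have r3 := (hf.reg 3 (by decide)).trans h3'
      have r6 := (hf.reg 6 (by decide)).trans h6'
      have hlen : Q1.length + 1 ≤ n := by
        have := hI.nodup.length_le_card
        simp at this
        omega
      have hle : ∀ z ∈ Q1 ++ x :: Q2, depth s1 z ≤ depth s1 x + 1 := hhead x (by simp)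
      have hdx : depth s1 x ≤ Q1.length := by
        have := (hI.depth_le x hxQ).2
        omega
      have hhalf := hI.halves x hxQ
      have hbk : s1.arr 15 x < k ↔ depth s1 x < 2 * k - 1 := by
        unfold depth
        omega
      simp only [wp_block_cons, wp_block_nil, wp_load, wp_ite, wp_skip, wp_inc,
        State.reg_setReg, State.arr_setReg, Test.holds_lt,
        reduceIte, Nat.reduceEqDiff, h26, h16, r3, hbk]
      constructor
      · intro hlt
        refine (wp_bfsScan (x := x) (Q := Q1 ++ x :: Q2) (L := L) (F := F) (k := k) (u := u)
          (hI.congr ?_ ?_ ?_ ?_) (hcode.congr ?_) (hmark.congr ?_ ?_) (hsub.congr ?_ ?_) ?_ hxQ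
          ?_ ?_ ?_ ?_ ?_ ?_ ?_).mono ?_
        · simp [State.reg_setReg]
        · simp [State.reg_setReg, h26]
        · simp [State.reg_setReg]
        · simp [State.arr_setReg]
        · simp [State.arr_setReg, hf.arr 5 (by decide), hf.arr 6 (by decide), hf.arr 7 (by decide)]
        · simp [State.arr_setReg, hf.arr 12 (by decide)]
        · simp [State.reg_setReg, hf.reg 22 (by decide)]
        · simp [State.arr_setReg, hf.arr 19 (by decide), hf.arr 20 (by decide),
            hf.arr 21 (by decide), hf.arr 22 (by decide)]
        · simp [State.reg_setReg, hf.reg 36 (by decide)]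
        · simpa [State.reg_setReg] using r6
        · simp [State.reg_setReg]
        · simp [State.reg_setReg, State.arr_setReg]
        · simp [State.reg_setReg, State.arr_setReg]
        · simp [State.reg_setReg, State.arr_setReg]
        · simpa [depth, State.arr_setReg] using hlt
        · simpa [depth, State.arr_setReg, State.reg_setReg] using hdx
        · simpa [depth, State.arr_setReg] using hle
        · rintro T' s2 ⟨Q', hT', hI2, hold, hnew, hcl2⟩ hf2
          have hold : ∀ z ∈ Q1 ++ x :: Q2, depth s2 z = depth s1 z := by
            simpa [depth, State.arr_setReg] using hold
          have hnew : ∀ z ∈ Q', depth s2 z = depth s1 x + 1 := by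
            simpa [depth, State.arr_setReg] using hnew
          have h26' : s2.reg 26 = Q1.length + 1 := by
            have := hf2.reg 26 (by decide)
            simpa [State.reg_setReg] using this
          have hQ : (Q1 ++ [x]) ++ (Q2 ++ Q') = (Q1 ++ x :: Q2) ++ Q' := by simp
          have hle2 : ∀ z ∈ (Q1 ++ x :: Q2) ++ Q', depth s2 z ≤ depth s2 x + 1 := by
            intro z hz
            rw [hold x hxQ]
            rcases List.mem_append.1 hz with hz | hz
            · rw [hold z hz]
              exact hle z hz
            · rw [hnew z hz]
          refine ⟨j - 1, by omega, Q1 ++ [x], Q2 ++ Q', by simp; omega, by simpa using h26',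
            hQ ▸ hI2, (by
              simp only [List.map_append, List.sum_append, List.map_cons, List.map_nil,
                List.sum_cons, List.sum_nil]
              omega), ?_, ?_⟩
          · intro y hy z hz
            rw [hQ] at hz
            have hy' : y ∈ Q2 ++ Q' := List.mem_of_mem_head? hy
            have h1 := hI2.sorted
            rw [← hQ, List.append_assoc, List.pairwise_append, List.singleton_append,
              List.pairwise_cons] at h1
            exact (hle2 z hz).trans (by have := h1.2.1.1 y hy'; omega)
          · rw [hQ]
            intro w hw hdw e he y hjw
            rcases List.mem_append.1 hw with hw | hw
            · have hwQ : w ∈ Q1 ++ x :: Q2 := List.mem_append_left _ hw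
              rw [hold w hwQ] at hdw ⊢
              obtain ⟨h1, h2⟩ := hcl w hw hdw e he y hjw
              rw [hold y h1]
              exact ⟨List.mem_append_left _ h1, h2⟩
            · rw [List.mem_singleton] at hw
              subst hw
              have := hcl2 e he y hjw
              exact ⟨this, hle2 y this⟩
      · intro hnlt
        have hQ : (Q1 ++ [x]) ++ Q2 = Q1 ++ x :: Q2 := by simp
        refine ⟨j - 1, by omega, Q1 ++ [x], Q2, by simp; omega, by simp, ?_, (by
              simp only [List.map_append, List.sum_append, List.map_cons, List.map_nil,
                List.sum_cons, List.sum_nil]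
              omega),
          ?_, ?_⟩
        · rw [hQ]
          exact hI.congr (by simp [State.reg_setReg]) (by simp [State.reg_setReg, h26])
            (by simp [State.reg_setReg]) (by simp [State.arr_setReg])
        · intro y hy z hz
          rw [hQ] at hz
          have hy' : y ∈ Q2 := List.mem_of_mem_head? hy
          have h1 := hI.sorted
          rw [List.pairwise_append, List.pairwise_cons] at h1
          refine (hle z hz).trans ?_
          have := h1.2.1.1 y hy'
          simp only [depth, State.arr_setReg] at this ⊢
          omega
        · rw [hQ]
          simp only [depth, State.arr_setReg] at hnlt ⊢
          intro w hw hdw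
          rcases List.mem_append.1 hw with hw | hw
          · exact hcl w hw hdw
          · rw [List.mem_singleton] at hw
            subst hw
            exact absurd hdw hnlt
  · rintro T s' ⟨j, T', rfl, ⟨Q1, Q2, hj, h26, hI, hT, hhead, hcl⟩, hf, hb⟩ -
    rw [Test.holds_lt, h26, hI.len] at hb
    have hnil : Q2 = [] := by
      cases Q2 with
      | nil => rfl
      | cons => simp at hb
    subst hnil
    rw [List.append_nil] at hI hcl
    have h1 := hI.sum_le
    have h2 := hI.length_le
    refine ⟨Q1, by omega, hI, fun x hx => ?_, hcl⟩
    have := (hI.depth_le x hx).2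
    omega

/-- If a set is closed under edges from vertices of depth less than `2 * k - 1`, then it contains
the ends of all walks with at most `2 * k - 1` edges from a vertex of depth zero. -/
theorem mem_of_isWalk {A : Set (Fin m)} {s : State} {Q : List (Fin n)} {x w : Fin n}
    {p : List (Fin m × Fin n)}
    (hcl : ∀ x ∈ Q, depth s x < 2 * k - 1 → ∀ e ∈ A, ∀ y, G.Joins e x y →
      y ∈ Q ∧ depth s y ≤ depth s x + 1)
    (hp : G.IsWalk A x p w) (hx : x ∈ Q) (hd : depth s x + p.length ≤ 2 * k - 1) : w ∈ Q := by
  induction hp with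
  | nil => exact hx
  | cons he hj _ ih =>
    rw [List.length_cons] at hd
    obtain ⟨h1, h2⟩ := hcl _ hx (by omega) _ he _ hj
    exact ih h1 (by omega)

end CFT

namespace CFT

variable {n m q : ℕ} {G : ColoredGraph n m q} {σ : Setting} {k f : ℕ} {W : ℕ → ℝ≥0}

/-! ### The test whether an edge is added to the spanner -/

open Classical in
/-- The colors that damage an edge of `p`, but not `e`. -/
noncomputable def newColors (G : ColoredGraph n m q) (σ : Setting) (e : Fin m)
    (p : List (Fin m × Fin n)) : Finset (Fin q) :=
  Finset.univ.filter fun c => ¬ G.Damages σ c e ∧ ∃ h ∈ p.map Prod.fst, G.Damages σ c h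

theorem mem_newColors {e : Fin m} {p : List (Fin m × Fin n)} {c : Fin q} :
    c ∈ newColors G σ e p ↔ ¬ G.Damages σ c e ∧ ∃ h ∈ p.map Prod.fst, G.Damages σ c h := by
  simp [newColors]

theorem mem_newColors_concat {e h : Fin m} {p : List (Fin m × Fin n)} {y : Fin n} {c : Fin q} :
    c ∈ newColors G σ e (p ++ [(h, y)]) ↔ c ∈ newColors G σ e p ∨
      codeE G σ h = c + 1 ∧ ¬ G.Damages σ c e ∨
      codeV G σ (G.src h) = c + 1 ∧ ¬ G.Damages σ c e ∨
      codeV G σ (G.dst h) = c + 1 ∧ ¬ G.Damages σ c e := by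
  rw [← or_and_right, ← or_and_right, ← damages_iff]
  simp only [mem_newColors, List.map_append, List.map_cons, List.map_nil, List.mem_append,
    List.mem_singleton, or_and_right, exists_or, exists_eq_left, and_or_left]
  rw [and_comm (a := G.Damages σ c h)]

/-- A walk with `l` edges has at most `l` edge colors and `l + 1` vertex colors; if vertex colors
fail, then that of the first vertex, an end of `e`, damages `e`. -/
theorem card_newColors_le {A : Set (Fin m)} {e : Fin m} {p : List (Fin m × Fin n)} {w : Fin n}
    (hp : G.IsWalk A (G.dst e) p w) : (newColors G σ e p).card ≤ 2 * p.length := by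
  classical
  have hsub : newColors G σ e p ⊆ (p.map fun s => G.edgeColor s.1).toFinset ∪
      (p.map fun s => G.vertexColor s.2).toFinset := by
    intro c hc
    obtain ⟨hce, h, hh, hd⟩ := mem_newColors.1 hc
    simp only [Finset.mem_union, List.mem_toFinset]
    have hE : G.edgeColor h = c → c ∈ p.map fun s => G.edgeColor s.1 := by
      rintro rfl
      obtain ⟨s, hs, rfl⟩ := List.mem_map.1 hh
      exact List.mem_map.2 ⟨s, hs, rfl⟩
    have hV : ∀ x ∈ G.dst e :: p.map Prod.snd, G.vertexColor x = c →
        G.vertexColor (G.dst e) ≠ c → c ∈ p.map fun s => G.vertexColor s.2 := by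
      rintro x hx rfl hne
      rcases List.mem_cons.1 hx with rfl | hx
      · exact absurd rfl hne
      · obtain ⟨s, hs, rfl⟩ := List.mem_map.1 hx
        exact List.mem_map.2 ⟨s, hs, rfl⟩
    obtain ⟨h1, h2⟩ := hp.ends_mem hh
    cases σ with
    | ECFT => exact Or.inl (hE hd)
    | VCFT =>
      right
      have hne : G.vertexColor (G.dst e) ≠ c := fun h => hce (Or.inr h)
      rcases hd with hd | hd
      exacts [hV _ h1 hd hne, hV _ h2 hd hne]
    | MCFT =>
      have hne : G.vertexColor (G.dst e) ≠ c := fun h => hce (Or.inr (Or.inr h))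
      rcases hd with hd | hd | hd
      exacts [Or.inl (hE hd), Or.inr (hV _ h1 hd hne), Or.inr (hV _ h2 hd hne)]
  refine (Finset.card_le_card hsub).trans ((Finset.card_union_le _ _).trans ?_)
  have h1 := (p.map fun s => G.edgeColor s.1).toFinset_card_le
  have h2 := (p.map fun s => G.vertexColor s.2).toFinset_card_le
  simp only [List.length_map] at h1 h2
  omega

/-- The registers 19 to 21 contain the color codes of the edge `e`. -/
structure HasEdgeCodes (G : ColoredGraph n m q) (σ : Setting) (e : Fin m) (s : State) : Prop where
  edge : s.reg 19 = codeE G σ e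
  src : s.reg 20 = codeV G σ (G.src e)
  dst : s.reg 21 = codeV G σ (G.dst e)

theorem HasEdgeCodes.congr {e : Fin m} {s s' : State} (h : HasEdgeCodes G σ e s)
    (hr : ∀ r ∈ [19, 20, 21], s'.reg r = s.reg r) : HasEdgeCodes G σ e s' := by
  constructor
  · simpa [hr] using h.edge
  · simpa [hr] using h.src
  · simpa [hr] using h.dst

theorem HasEdgeCodes.frame {P : Program} {e : Fin m} {s s' : State} (h : HasEdgeCodes G σ e s)
    (hf : Frame P s s') (hP : ∀ r ∈ [19, 20, 21], r ∉ P.regWrites) : HasEdgeCodes G σ e s' :=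
  h.congr fun r hr => hf.reg r (hP r hr)

/-- Mark the color with the code in array `a` at the position in register 33, unless it damages the
edge under consideration. -/
def markColor (a : ℕ) : Program :=
  .block [.load 34 a 33,
    .ite (.eq 34 6) .skip (.ite (.eq 34 19) .skip (.ite (.eq 34 20) .skip
      (.ite (.eq 34 21) .skip (.store 12 34 22))))]

theorem HasMarks.update {F F' : Finset (Fin q)} {s s' : State} {c : Fin q} (h : HasMarks F s)
    (hr : s'.reg 22 = s.reg 22) (ha : s'.arr 12 = Function.update (s.arr 12) (c + 1) (s.reg 22))
    (hF : ∀ c', c' ∈ F' ↔ c' ∈ F ∨ c' = c) : HasMarks F' s' := by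
  constructor
  · intro c'
    rw [ha, hr, hF]
    by_cases hc : c' = c
    · simp [hc]
    · rw [Function.update_of_ne (by simpa [Fin.ext_iff] using hc), h.mark]
      simp [hc]
  · rw [ha, hr, Function.update_of_ne (by simp)]
    exact h.zero
  · intro i
    rw [ha, hr]
    by_cases hi : i = c + 1
    · simp [hi]
    · rw [Function.update_of_ne hi]
      exact h.stamp i

theorem wp_markColor {F F' : Finset (Fin q)} {e : Fin m} {a γ : ℕ} {s : State} (h6 : s.reg 6 = 0)
    (hmark : HasMarks F s) (he : HasEdgeCodes G σ e s) (hγ : s.arr a (s.reg 33) = γ)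
    (hcol : γ ≠ 0 → ∃ c : Fin q, γ = c + 1)
    (hF : ∀ c : Fin q, c ∈ F' ↔ c ∈ F ∨ γ = c + 1 ∧ ¬ G.Damages σ c e) :
    wp W (markColor a) s fun T s' => T ≤ 8 ∧ HasMarks F' s' := by
  unfold markColor
  simp only [wp_block_cons, wp_block_nil, wp_load, wp_ite, wp_skip, wp_store, State.reg_setReg,
    reduceIte, Nat.reduceEqDiff, Test.holds_eq, hγ, h6, he.edge, he.src, he.dst]
  have hsame : ∀ s' : State, s'.arr 12 = s.arr 12 → s'.reg 22 = s.reg 22 →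
      (γ = 0 ∨ γ = codeE G σ e ∨ γ = codeV G σ (G.src e) ∨ γ = codeV G σ (G.dst e)) →
      HasMarks F' s' := by
    intro s' h1 h2 h3
    have : F' = F := by
      ext c
      rw [hF, damages_iff]
      constructor
      · rintro (h | ⟨h, h'⟩)
        · exact h
        · omega
      · exact Or.inl
    exact this ▸ hmark.congr h1 h2
  refine ⟨fun h => ⟨by omega, hsame _ rfl rfl (by tauto)⟩,
    fun h1 => ⟨fun h => ⟨by omega, hsame _ rfl rfl (by tauto)⟩,
      fun h2 => ⟨fun h => ⟨by omega, hsame _ rfl rfl (by tauto)⟩,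
        fun h3 => ⟨fun h => ⟨by omega, hsame _ rfl rfl (by tauto)⟩, fun h4 => ⟨by omega, ?_⟩⟩⟩⟩⟩
  obtain ⟨c, rfl⟩ := hcol h1
  refine hmark.update (c := c) rfl ?_ fun c' => ?_
  · simp [State.arr_setArr, State.arr_setReg]
  · rw [hF, damages_iff]
    constructor
    · rintro (h | ⟨h, -⟩)
      · exact Or.inl h
      · exact Or.inr (Fin.ext (by omega))
    · rintro (h | rfl)
      · exact Or.inl h
      · exact Or.inr ⟨rfl, by omega⟩

/-- Follow the parents from the vertex in register 18 to the root of the search, and mark the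
colors. -/
def traceBack : Program :=
  .block [.copy 28 18, .load 29 15 28,
    .while (.lt 6 29) (.block [.load 33 17 28, markColor 5, markColor 6, markColor 7,
      .load 28 18 28, .load 29 15 28])]

open ColoredGraph in
/-- A walk from the vertex in register 18 to the root is traversed, and the colors in
`newColors G σ e p` are marked. -/
theorem wp_traceBack {A : Set (Fin m)} {F : Finset (Fin q)} {e : Fin m} {u v : Fin n}
    {Q : List (Fin n)} {s : State} (hI : BfsInv G A k u Q s) (hcode : HasCodes G σ s)
    (hmark : HasMarks F s) (he : HasEdgeCodes G σ e s) (h6 : s.reg 6 = 0) (h18 : s.reg 18 = v)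
    (hv : v ∈ Q) :
    wp W traceBack s fun T s' => ∃ p, T ≤ 40 * depth s v + 10 ∧ G.IsWalk A v p u ∧
      p.length = depth s v ∧ HasMarks (F ∪ newColors G σ e p) s' := by
  unfold traceBack
  simp only [wp_block_cons, wp_block_nil, wp_copy, wp_load, State.reg_setReg,
    State.arr_setReg, reduceIte, h18]
  -- the walk `p` from `v` to the present vertex `x` has been traversed
  refine (wp_while (j := depth s v) (fun j T s' => ∃ x ∈ Q, ∃ p, depth s x = j ∧ s'.reg 28 = x ∧
    s'.reg 29 = s.arr 15 x ∧ G.IsWalk A v p x ∧ p.length + depth s x = depth s v ∧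
    HasMarks (F ∪ newColors G σ e p) s' ∧ T ≤ 40 * p.length) ?_ ?_).mono ?_
  · refine ⟨v, hv, [], rfl, by simp [State.reg_setReg], by simp [State.reg_setReg], .nil v, by simp,
      ?_, by simp⟩
    have : newColors G σ e ([] : List (Fin m × Fin n)) = ∅ := by simp [newColors]
    rw [this, Finset.union_empty]
    exact hmark.congr rfl rfl
  · rintro j T s1 ⟨x, hx, p, rfl, h28, h29, hp, hpl, hmark1, hT⟩ hf hb
    have r6 : s1.reg 6 = 0 := by
      rw [hf.reg 6 (by decide)]
      simpa [State.reg_setReg] using h6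
    have hhalf := hI.halves x hx
    rw [Test.holds_lt, r6, h29] at hb
    have hxu : x ≠ u := fun h => by
      have := (hI.zero x hx).2 h
      unfold depth at this
      omega
    obtain ⟨h, hhA, y, hy, hj, h17, h18', hd⟩ := hI.tree x hx hxu
    have a17 : s1.arr 17 = s.arr 17 := hf.arr 17 (by decide)
    have hcode1 : HasCodes G σ s1 := by
      refine HasCodes.frame ?_ hf (by decide)
      exact hcode.congr fun _ _ => rfl
    have he1 : HasEdgeCodes G σ e s1 := by
      refine HasEdgeCodes.frame ?_ hf (by decide)
      exact he.congr fun r hr => by fin_cases hr <;> rfl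
    classical
    simp only [wp_block_cons, wp_block_nil, wp_load, State.reg_setReg,
      State.arr_setReg, reduceIte, Nat.reduceEqDiff, h28, a17, h17]
    set F1 := F ∪ newColors G σ e p
    refine (wp_markColor (F := F1)
      (F' := F1 ∪ Finset.univ.filter fun c => codeE G σ h = c + 1 ∧ ¬ G.Damages σ c e) (e := e)
      (G := G) (σ := σ) (γ := codeE G σ h) (a := 5) (s := s1.setReg 33 h)
      (by simpa [State.reg_setReg] using r6) (hmark1.congr rfl rfl)
      (he1.congr fun r hr => by fin_cases hr <;> rfl)
      (by simpa [State.reg_setReg, State.arr_setReg] using hcode1.edge h)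
      exists_color_codeE (by simp)).mono ?_
    rintro T1 s2 ⟨hT1, hmark2⟩ hf1
    set F2 := F1 ∪ _
    have r33 : s2.reg 33 = h := (hf1.reg 33 (by decide)).trans (by simp [State.reg_setReg])
    have he2 : HasEdgeCodes G σ e s2 := by
      refine HasEdgeCodes.frame ?_ hf1 (by decide)
      exact he1.congr fun r hr => by fin_cases hr <;> rfl
    refine (wp_markColor (F := F2) (F' := F2 ∪ Finset.univ.filter fun c =>
        codeV G σ (G.src h) = c + 1 ∧ ¬ G.Damages σ c e) (e := e) (G := G) (σ := σ)
      (by rw [hf1.reg 6 (by decide)]; simpa [State.reg_setReg] using r6) hmark2 he2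
      (by rw [r33, hf1.arr 6 (by decide)]; simpa [State.arr_setReg] using hcode1.src h)
      exists_color_codeV (by simp)).mono ?_
    rintro T2 s3 ⟨hT2, hmark3⟩ hf2
    set F3 := F2 ∪ _
    refine (wp_markColor (F := F3) (F' := F ∪ newColors G σ e (p ++ [(h, y)])) (e := e) (G := G)
      (σ := σ) (γ := codeV G σ (G.dst h))
      (by rw [hf2.reg 6 (by decide), hf1.reg 6 (by decide)]; simpa [State.reg_setReg] using r6)
      hmark3 (he2.frame hf2 (by decide))
      (by
        rw [hf2.reg 33 (by decide), r33, hf2.arr 7 (by decide), hf1.arr 7 (by decide)]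
        simpa [State.arr_setReg] using hcode1.dst h)
      exists_color_codeV ?_).mono ?_
    · intro c
      simp only [F3, F2, F1, Finset.mem_union, Finset.mem_filter, Finset.mem_univ, true_and,
        mem_newColors_concat, or_assoc]
    · rintro T3 s4 ⟨hT3, hmark4⟩ hf3
      have r28 : s4.reg 28 = x := by
        rw [hf3.reg 28 (by decide), hf2.reg 28 (by decide), hf1.reg 28 (by decide)]
        simpa [State.reg_setReg] using h28
      have a18 : s4.arr 18 = s.arr 18 := by
        rw [hf3.arr 18 (by decide), hf2.arr 18 (by decide), hf1.arr 18 (by decide)]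
        exact hf.arr 18 (by decide)
      have a15 : s4.arr 15 = s.arr 15 := by
        rw [hf3.arr 15 (by decide), hf2.arr 15 (by decide), hf1.arr 15 (by decide)]
        exact hf.arr 15 (by decide)
      refine ⟨depth s y, by omega, y, hy, p ++ [(h, y)], rfl, ?_, ?_, ?_, ?_, ?_, ?_⟩
      · simp [r28, a18, h18']
      · simp [r28, a18, h18', a15]
      · exact hp.append (.single hhA hj)
      · simp
        omega
      · exact hmark4.congr rfl rfl
      · simp
        omega
  · rintro T s' ⟨j, T', rfl, ⟨x, hx, p, rfl, h28, h29, hp, hpl, hmark1, hT⟩, hf, hb⟩ -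
    have r6 : s'.reg 6 = 0 := by
      rw [hf.reg 6 (by decide)]
      simpa [State.reg_setReg] using h6
    have hhalf := hI.halves x hx
    rw [Test.holds_lt, r6, h29] at hb
    have h0 : depth s x = 0 := by
      unfold depth
      omega
    obtain rfl := (hI.zero x hx).1 h0
    exact ⟨p, by omega, hp, by omega, hmark1⟩

/-- Test the edge in register 17 with the ends in registers 11 and 18. The number in register 23
counts the walks found so far. In the end register 24 is 1 if the edge is accepted, and 2 if it is
rejected. -/
def testEdge : Program :=
  .block [.inc 22, .const 23 0, .const 24 0,
    .while (.eq 24 6) (.block [bfs, .load 35 13 18,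
      .ite (.eq 35 25) (.block [traceBack, .ite (.eq 23 8) (.const 24 2) (.inc 23)])
        (.const 24 1)])]

open ColoredGraph in
/-- Every round costs a search. If no walk is left after at most `f` rounds, then the marked colors
show that the edge may be accepted; otherwise `min f m + 1` color disjoint walks have been found,
and the edge may be rejected. -/
theorem wp_testEdge {L : List (Fin m)} {e : Fin m} {s : State} (hk : 1 ≤ k)
    (hcode : HasCodes G σ s) (hsub : HasSubgraph G L s) (he : HasEdgeCodes G σ e s)
    (h3 : s.reg 3 = k) (h6 : s.reg 6 = 0) (h8 : s.reg 8 = min f m) (h11 : s.reg 11 = G.src e)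
    (h18 : s.reg 18 = G.dst e) (hst : ∀ i, s.arr 13 i ≤ s.reg 25)
    (hst' : ∀ i, s.arr 12 i ≤ s.reg 22) :
    wp W testEdge s fun T s' => T ≤ 300 * ((min f m + 2) * (L.length + 1)) ∧
      (∀ i, s'.arr 13 i ≤ s'.reg 25) ∧ (∀ i, s'.arr 12 i ≤ s'.reg 22) ∧
      ((s'.reg 24 = 1 ∧ ∃ F, G.Accepts σ k f {e | e ∈ L} e F) ∨
        (s'.reg 24 = 2 ∧ G.Rejects σ k f L.toFinset e)) := by
  unfold testEdge
  simp only [wp_block_cons, wp_block_nil, wp_inc, wp_const]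
  set s0 : State := ((s.setReg 22 (s.reg 22 + 1)).setReg 23 0).setReg 24 0 with hs0
  have hmark0 : HasMarks (∅ : Finset (Fin q)) s0 := by
    have : ∀ i, s.arr 12 i ≠ s.reg 22 + 1 := fun i => by
      have := hst' i
      omega
    constructor
    · simp [hs0, State.reg_setReg, State.arr_setReg, this]
    · simp [hs0, State.reg_setReg, State.arr_setReg, this]
    · intro i
      simpa [hs0, State.reg_setReg, State.arr_setReg] using (hst' i).trans (Nat.le_succ _)
  replace hcode : HasCodes G σ s0 := hcode.congr fun a _ => rfl
  replace hsub : HasSubgraph G L s0 := hsub.congr (fun a _ => rfl) rfl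
  replace he : HasEdgeCodes G σ e s0 := he.congr fun r hr => by fin_cases hr <;> rfl
  replace h3 : s0.reg 3 = k := h3
  replace h6 : s0.reg 6 = 0 := h6
  replace h8 : s0.reg 8 = min f m := h8
  replace h11 : s0.reg 11 = G.src e := h11
  replace h18 : s0.reg 18 = G.dst e := h18
  replace hst : ∀ i, s0.arr 13 i ≤ s0.reg 25 := hst
  have h23 : s0.reg 23 = 0 := rfl
  have h24 : s0.reg 24 = 0 := rfl
  clear_value s0
  set c := L.length + 1 with hc
  -- the walks `ps` have been found, and the colors in `F` have been marked because of them
  refine (wp_while (j := min f m + 1) (fun j T s' => (∀ i, s'.arr 13 i ≤ s'.reg 25) ∧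
    (∀ i, s'.arr 12 i ≤ s'.reg 22) ∧
    ((s'.reg 24 = 0 ∧ ∃ (ps : List (List (Fin m × Fin n))) (F : Finset (Fin q)),
      HasMarks F s' ∧ s'.reg 23 = ps.length ∧ j + ps.length = min f m + 1 ∧ 0 < j ∧
      (∀ p ∈ ps, G.IsWalk {e | e ∈ L} (G.dst e) p (G.src e) ∧ p.length ≤ 2 * k - 1) ∧
      ps.Pairwise (G.ColorDisjoint σ e) ∧ (∀ c, c ∈ F ↔ ∃ p ∈ ps, c ∈ newColors G σ e p) ∧
      F.card ≤ ps.length * (2 * (2 * k - 1)) ∧ T ≤ ps.length * (260 * c)) ∨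
    (j = 0 ∧ T ≤ (min f m + 1) * (260 * c) ∧
      ((s'.reg 24 = 1 ∧ ∃ F, G.Accepts σ k f {e | e ∈ L} e F) ∨
        (s'.reg 24 = 2 ∧ G.Rejects σ k f L.toFinset e))))) ?_ ?_).mono ?_
  · exact ⟨hst, hmark0.stamp, Or.inl ⟨h24, [], ∅, hmark0, h23, by simp, by simp, by simp, by simp,
      by simp, by simp, by simp⟩⟩
  · rintro j T s1 ⟨hst1, hst1', hcase⟩ hf hb
    have r6 := (hf.reg 6 (by decide)).trans h6
    rw [Test.holds_eq, r6] at hb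
    rcases hcase with ⟨-, ps, F, hmark, h23', hj, hj0, hps, hpair, hF, hFc, hT⟩ | ⟨-, -, h | h⟩
    rotate_left
    · omega
    · omega
    have hcode1 : HasCodes G σ s1 := hcode.frame hf (by decide)
    have hsub1 : HasSubgraph G L s1 := hsub.frame hf (by decide) (by decide)
    have he1 : HasEdgeCodes G σ e s1 := he.frame hf (by decide)
    simp only [wp_block_cons]
    -- a walk that survives the failure of the marked colors is color disjoint from those in `ps`
    refine (wp_bfs (u := G.src e) (L := L) (F := F) hk hcode1 hmark hsub1 r6
      ((hf.reg 3 (by decide)).trans h3) ((hf.reg 11 (by decide)).trans h11) hst1).mono ?_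
    rintro T1 s2 ⟨Q, hT1, hI, hdep, hcl⟩ hf1
    have hmark2 : HasMarks F s2 := hmark.congr (hf1.arr 12 (by decide)) (hf1.reg 22 (by decide))
    have r18 : s2.reg 18 = G.dst e := by
      rw [hf1.reg 18 (by decide), hf.reg 18 (by decide), h18]
    have hpsl : ps.length * (260 * c) + 260 * c ≤ (min f m + 1) * (260 * c) := by
      rw [← Nat.succ_mul]
      exact Nat.mul_le_mul_right _ (by omega)
    simp only [wp_block_cons, wp_block_nil, wp_load, wp_ite, wp_const, wp_inc, State.reg_setReg,
      State.arr_setReg, reduceIte, Nat.reduceEqDiff, Test.holds_eq, r18]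
    constructor
    · intro hvis
      have hv : G.dst e ∈ Q := (hI.vis _).1 hvis
      refine (wp_traceBack (s := s2.setReg 35 (s2.arr 13 (G.dst e))) (σ := σ) (e := e) (F := F)
        (v := G.dst e) (Q := Q) (u := G.src e) (k := k) (A := G.surviving σ {e | e ∈ L} F)
        (hI.congr rfl le_rfl rfl fun _ _ => rfl)
        ((hcode1.frame hf1 (by decide)).congr fun _ _ => rfl)
        (hmark2.congr rfl rfl)
        ((he1.frame hf1 (by decide)).congr fun r hr => by fin_cases hr <;> rfl)
        ((hf1.reg 6 (by decide)).trans r6) r18 hv).mono ?_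
      rintro T2 s3 ⟨p, hT2, hp, hpl, hmark3⟩ hf2
      have hdv := hdep _ hv
      have hpl' : p.length = depth s2 (G.dst e) := hpl
      have hT2' : T2 ≤ 40 * depth s2 (G.dst e) + 10 := hT2
      have hkl := (hI.depth_le _ hv).1
      have hpH : G.IsWalk {e | e ∈ L} (G.dst e) p (G.src e) := hp.mono fun h hh => hh.1
      have hps' : ∀ p' ∈ p :: ps, G.IsWalk {e | e ∈ L} (G.dst e) p' (G.src e) ∧
          p'.length ≤ 2 * k - 1 := by
        intro p' hp'
        rcases List.mem_cons.1 hp' with rfl | hp'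
        · exact ⟨hpH, by omega⟩
        · exact hps p' hp'
      have hpair' : (p :: ps).Pairwise (G.ColorDisjoint σ e) := by
        refine List.pairwise_cons.2 ⟨fun p' hp' c hce h hh h' hh' hd => ?_, hpair⟩
        exact (hp.mem_edgeSet hh).2 c
          ((hF c).2 ⟨p', hp', mem_newColors.2 ⟨hce, h', hh', hd.2⟩⟩) hd.1
      have q23 : s3.reg 23 = ps.length := by
        rw [hf2.reg 23 (by decide)]
        exact (hf1.reg 23 (by decide)).trans h23'
      have q8 : s3.reg 8 = min f m := by
        rw [hf2.reg 8 (by decide)]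
        exact (hf1.reg 8 (by decide)).trans ((hf.reg 8 (by decide)).trans h8)
      have q24 : s3.reg 24 = 0 := by
        rw [hf2.reg 24 (by decide)]
        exact (hf1.reg 24 (by decide)).trans hb
      have q13 : ∀ i, s3.arr 13 i ≤ s3.reg 25 := fun i => by
        rw [hf2.arr 13 (by decide), hf2.reg 25 (by decide)]
        exact hI.stamp i
      simp only [q23, q8]
      constructor
      · intro hfull
        refine ⟨0, hj0, q13, hmark3.stamp, Or.inr ⟨rfl, by omega, Or.inr ⟨trivial, ?_⟩⟩⟩
        exact rejects_of_walks (by simp; omega)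
          (fun p' hp' => ⟨(hps' p' hp').1.mono fun h hh => by simpa using hh, (hps' p' hp').2⟩)
          hpair'
      · intro hnfull
        refine ⟨j - 1, by omega, q13, hmark3.stamp, Or.inl ⟨q24, p :: ps, F ∪ newColors G σ e p,
          hmark3.congr rfl rfl, by simp, by simp; omega, by omega, hps', hpair', ?_, ?_, ?_⟩⟩
        · intro c
          simp [hF, or_comm]
        · refine (Finset.card_union_le _ _).trans ?_
          have h1 := card_newColors_le (σ := σ) hp
          rw [List.length_cons, Nat.succ_mul]
          have := (hps' p (by simp)).2
          omega
        · rw [List.length_cons, Nat.succ_mul]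
          omega
    · intro hnvis
      refine ⟨0, hj0, hI.stamp, ?_, Or.inr ⟨rfl, by omega, Or.inl ⟨trivial, F, ?_, ?_, ?_⟩⟩⟩
      · exact hmark2.stamp
      · have h1 : ps.length ≤ f := by omega
        calc F.card ≤ ps.length * (2 * (2 * k - 1)) := hFc
          _ ≤ f * (4 * k) := Nat.mul_le_mul h1 (by omega)
          _ = 4 * k * f := by ring
      · intro c hc
        obtain ⟨p, -, hp⟩ := (hF c).1 hc
        exact (mem_newColors.1 hp).1
      · intro p hp hpl
        by_contra! hno
        have hp' : G.IsWalk (G.surviving σ {e | e ∈ L} F) (G.dst e) p (G.src e) :=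
          hp.restrict fun h hh => ⟨hp.mem_edgeSet hh, fun c hc => hno h hh c hc⟩
        obtain ⟨r, hr, hrl⟩ := hp'.exists_reverse
        have hrl := congrArg List.length hrl
        simp only [List.length_map, List.length_reverse] at hrl
        refine hnvis ((hI.vis _).2 (mem_of_isWalk hcl hr hI.root ?_))
        have := (hI.zero _ hI.root).2 rfl
        omega
  · rintro T s' ⟨j, T', rfl, ⟨hst1, hst1', hcase⟩, hf, hb⟩ -
    rw [Test.holds_eq, hf.reg 6 (by decide), h6] at hb
    rcases hcase with ⟨h, -⟩ | ⟨-, hT, h⟩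
    · exact absurd h hb
    · refine ⟨?_, hst1, hst1', h⟩
      have : (min f m + 2) * c = (min f m + 1) * c + c := by ring
      have h2 : (min f m + 1) * (260 * c) = 260 * ((min f m + 1) * c) := by ring
      omega

end CFT

namespace CFT

variable {n m q : ℕ} {G : ColoredGraph n m q} {σ : Setting} {k f : ℕ} {W : ℕ → ℝ≥0}

/-! ### Adding an edge to the spanner -/

/-- Array 19 holds the first entries of linked lists that represent the lists `I x`, as described at
`HasSubgraph`. -/
def HasLists (I : Fin n → List (Fin m × Fin n)) (s : State) : Prop :=
  ∀ x : Fin n, ∃ l, IsLinked (s.arr 22) (s.arr 19 x) l ∧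
    List.Forall₂ (fun a b => s.arr 20 a = (b.1 : Fin m) ∧ s.arr 21 a = (b.2 : Fin n) ∧ a ≤ s.reg 36)
      l (I x)

/-- Put the edge in register 17, with the other end in register `y`, in front of the list of the
vertex in register `x`. -/
def addIncidence (x y : ℕ) : Program :=
  .block [.inc 36, .store 20 36 17, .store 21 36 y, .load 12 19 x, .store 22 36 12, .store 19 x 36]

theorem wp_addIncidence {I : Fin n → List (Fin m × Fin n)} {s : State} {rx ry : ℕ} {x y : Fin n}
    {e : Fin m} (h : HasLists I s) (hrx : rx ≠ 36 ∧ rx ≠ 12) (hry : ry ≠ 36 ∧ ry ≠ 12)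
    (hx : s.reg rx = x) (hy : s.reg ry = y) (he : s.reg 17 = e) :
    wp W (addIncidence rx ry) s fun T s' => T ≤ 7 ∧
      HasLists (Function.update I x ((e, y) :: I x)) s' := by
  unfold addIncidence
  simp only [wp_block_cons, wp_block_nil, wp_inc, wp_store, wp_load, State.reg_setReg,
    State.arr_setReg, State.reg_setArr, State.arr_setArr, reduceIte, Nat.reduceEqDiff, he, hrx, hry,
    hx, hy]
  refine ⟨by omega, fun z => ?_⟩
  obtain ⟨l, hl, hl2⟩ := h z
  have hle : ∀ a ∈ l, a ≤ s.reg 36 := by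
    generalize I z = J at hl2
    clear hl
    induction hl2 with
    | nil => simp
    | cons h _ ih => exact List.forall_mem_cons.2 ⟨h.2.2, ih⟩
  have hne : ∀ a ∈ l, a ≠ s.reg 36 + 1 := fun a ha => by
    have := hle a ha
    omega
  -- the old entries do not change
  have hold : List.Forall₂ (fun a b => Function.update (s.arr 20)
      (s.reg 36 + 1) e a = (b.1 : Fin m) ∧ Function.update (s.arr 21) (s.reg 36 + 1) y a =
      (b.2 : Fin n) ∧ a ≤ s.reg 36 + 1) l (I z) := by
    generalize I z = J at hl2 ⊢
    clear hl
    induction hl2 with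
    | nil => exact .nil
    | cons h _ ih =>
      rw [List.forall_mem_cons] at hne hle
      refine .cons ?_ (ih hle.2 hne.2)
      rw [Function.update_of_ne hne.1, Function.update_of_ne hne.1]
      exact ⟨h.1, h.2.1, by omega⟩
  have hlink : ∀ a, IsLinked (Function.update (s.arr 22) (s.reg 36 + 1) a) (s.arr 19 z) l :=
    fun a => hl.congr fun b hb => Function.update_of_ne (hne b hb) _ _
  by_cases hz : z = x
  · subst hz
    refine ⟨(s.reg 36 + 1) :: l, ?_, ?_⟩
    · simp only [State.arr_setReg, State.arr_setArr, reduceIte, Nat.reduceEqDiff]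
      refine ⟨by simp, by omega, ?_⟩
      simpa using hlink _
    · rw [Function.update_self]
      refine .cons ?_ ?_
      · simp [State.arr_setReg, State.arr_setArr, State.reg_setArr, State.reg_setReg]
      · simpa [State.arr_setReg, State.arr_setArr, State.reg_setArr, State.reg_setReg] using hold
  · refine ⟨l, ?_, ?_⟩
    · simp only [State.arr_setReg, State.arr_setArr, reduceIte, Nat.reduceEqDiff]
      rw [Function.update_of_ne (fun h => hz (Fin.ext h))]
      exact hlink _
    · rw [Function.update_of_ne hz]
      simpa [State.arr_setReg, State.arr_setArr, State.reg_setArr, State.reg_setReg] using hold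

/-- Add the edge in register 17 with the ends in registers 11 and 18 to the subgraph and to the
output. -/
def addEdge : Program :=
  .block [.store 4 17 7, addIncidence 11 18, addIncidence 18 11]

theorem wp_addEdge {L : List (Fin m)} {s : State} {e : Fin m} (h : HasSubgraph G L s)
    (h7 : s.reg 7 = 1) (he : s.reg 17 = e) (h11 : s.reg 11 = G.src e) (h18 : s.reg 18 = G.dst e) :
    wp W addEdge s fun T s' => T ≤ 20 ∧ HasSubgraph G (e :: L) s' ∧
      s'.arr 4 = Function.update (s.arr 4) e 1 := by
  unfold addEdge
  simp only [wp_block_cons, wp_store, h7, he]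
  refine (wp_addIncidence (I := incidences G L) (e := e) (x := G.src e) (y := G.dst e)
    (s := s.setArr 4 e 1) h (by simp) (by simp) h11 h18 he).mono ?_
  rintro T1 s1 ⟨hT1, h1⟩ hf1
  refine (wp_addIncidence (e := e) (x := G.dst e) (y := G.src e) h1 (by simp) (by simp)
    ((hf1.reg 18 (by decide)).trans h18) ((hf1.reg 11 (by decide)).trans h11)
    ((hf1.reg 17 (by decide)).trans he)).mono ?_
  rintro T2 s2 ⟨hT2, h2⟩ hf2
  rw [wp_block_nil]
  refine ⟨by omega, ?_, ?_⟩
  · have hI : incidences G (e :: L) = Function.update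
        (Function.update (incidences G L) (G.src e) ((e, G.dst e) :: incidences G L (G.src e)))
        (G.dst e) ((e, G.src e) :: Function.update (incidences G L) (G.src e)
          ((e, G.dst e) :: incidences G L (G.src e)) (G.dst e)) := by
      have hl := G.loopless e
      funext x
      by_cases hd : x = G.dst e
      · subst hd
        simp [incidences, hl, hl.symm]
      · by_cases hs : x = G.src e
        · subst hs
          simp [incidences, hl]
        · simp [incidences, hd, hs, Ne.symm hd, Ne.symm hs]
    unfold HasSubgraph
    rw [hI]
    exact h2
  · rw [hf2.arr 4 (by decide), hf1.arr 4 (by decide)]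
    simp [State.arr_setArr]

/-! ### The order of the edges -/

/-- `h` is the handle of a lightest edge in `S`: its number plus one, or `0` if `S` is empty. -/
def IsLightest (G : ColoredGraph n m q) (S : Set (Fin m)) (h : ℕ) : Prop :=
  (h = 0 ∧ S = ∅) ∨ ∃ e ∈ S, h = e + 1 ∧ ∀ e' ∈ S, G.weight e ≤ G.weight e'

theorem weightArr_val (G : ColoredGraph n m q) (e : Fin m) : G.weightArr e = G.weight e := by
  simp [ColoredGraph.weightArr]

/-- Replace the handle in register `x` by the handle in register `y`, if that is lighter. -/
def pickLighter (x y : ℕ) : Program :=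
  .ite (.eq y 6) .skip (.ite (.eq x 6) (.copy x y) (.block [.copy 43 x, .dec 43, .copy 44 y,
    .dec 44, .ite (.weightLE 43 44) .skip (.copy x y)]))

theorem wp_pickLighter {x y : ℕ} {S S' : Set (Fin m)} {s : State} (h6 : s.reg 6 = 0)
    (hx : IsLightest G S (s.reg x)) (hy : IsLightest G S' (s.reg y))
    (hxr : x ≠ 43 ∧ x ≠ 44) (hyr : y ≠ 43 ∧ y ≠ 44) :
    wp G.weightArr (pickLighter x y) s fun T s' => T ≤ 10 ∧ IsLightest G (S ∪ S') (s'.reg x) := by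
  unfold pickLighter
  simp only [wp_block_cons, wp_block_nil, wp_ite, wp_skip, wp_copy, wp_dec, Test.holds_eq,
    Test.holds_weightLE, State.reg_setReg, reduceIte, Nat.reduceEqDiff, h6, hxr, hyr]
  refine ⟨fun h0 => ⟨by omega, ?_⟩, fun hy0 => ⟨fun hx0 => ⟨by omega, ?_⟩, fun hx0 =>
    ⟨fun hle => ⟨by omega, ?_⟩, fun hnle => ⟨by omega, ?_⟩⟩⟩⟩
  · rcases hy with ⟨-, rfl⟩ | ⟨e, -, he, -⟩
    · simpa using hx
    · omega
  · rcases hx with ⟨-, rfl⟩ | ⟨e, -, he, -⟩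
    · simpa using hy
    · omega
  all_goals
    rcases hx with ⟨hx, -⟩ | ⟨e, heS, he, hmin⟩
    · exact absurd hx hx0
    rcases hy with ⟨hy, -⟩ | ⟨e', heS', he', hmin'⟩
    · exact absurd hy hy0
    simp only [he, he', Nat.add_sub_cancel, weightArr_val] at *
  · refine Or.inr ⟨e, Or.inl heS, rfl, ?_⟩
    rintro e'' (h | h)
    · exact hmin e'' h
    · exact hle.trans (hmin' e'' h)
  · refine Or.inr ⟨e', Or.inr heS', rfl, ?_⟩
    rintro e'' (h | h)
    · exact (not_le.1 hnle).le.trans (hmin e'' h)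
    · exact hmin' e'' h

/-- The vertices in `act` are listed in array 10. -/
structure HasActive (act : List (Fin n)) (s : State) : Prop where
  len : s.reg 9 = act.length
  val : ∀ (i : ℕ) (x : Fin n), act[i]? = some x → s.arr 10 i = x

/-- Find the lightest among the candidates of the vertices. -/
def findBest : Program :=
  .block [.const 14 0, .const 12 0,
    .while (.lt 12 9) (.block [.load 13 10 12, .load 15 11 13, pickLighter 14 15, .inc 12])]

theorem wp_findBest {act : List (Fin n)} {S : Fin n → Set (Fin m)} {s : State}
    (h6 : s.reg 6 = 0) (hact : HasActive act s) (hS : ∀ u, IsLightest G (S u) (s.arr 11 u)) :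
    wp G.weightArr findBest s fun T s' => T ≤ 20 * act.length + 5 ∧
      IsLightest G {e | ∃ u ∈ act, e ∈ S u} (s'.reg 14) := by
  unfold findBest
  simp only [wp_block_cons, wp_block_nil, wp_const]
  -- the candidates of the vertices in `l1` have been compared
  refine (wp_while (j := act.length) (fun j T s' => ∃ l1 l2, act = l1 ++ l2 ∧ l2.length = j ∧
    s'.reg 12 = l1.length ∧ IsLightest G {e | ∃ u ∈ l1, e ∈ S u} (s'.reg 14) ∧
    T ≤ 20 * l1.length) ?_ ?_).mono ?_
  · exact ⟨[], act, rfl, rfl, rfl, Or.inl ⟨rfl, by simp⟩, by simp⟩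
  · rintro j T s1 ⟨l1, l2, rfl, rfl, h12, h14, hT⟩ hf hb
    have r9 : s1.reg 9 = (l1 ++ l2).length := by
      rw [hf.reg 9 (by decide)]
      exact hact.len
    rw [Test.holds_lt, h12, r9] at hb
    cases l2 with
    | nil => simp at hb
    | cons x l2 =>
      have h10 : s1.arr 10 l1.length = x := by
        rw [hf.arr 10 (by decide)]
        exact hact.val _ _ (by simp)
      have h11 : s1.arr 11 x = s.arr 11 x := by
        rw [hf.arr 11 (by decide)]
        rfl
      simp only [wp_block_cons, wp_block_nil, wp_load, wp_inc, State.reg_setReg, State.arr_setReg,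
        reduceIte, h12, h10, h11]
      refine (wp_pickLighter (s := (s1.setReg 13 x).setReg 15 (s.arr 11 x)) ?_ h14 (hS x) (by simp)
        (by simp)).mono ?_
      · exact (hf.reg 6 (by decide)).trans h6
      · rintro T' s2 ⟨hT', h14'⟩ hf2
        have r12 : s2.reg 12 = l1.length := (hf2.reg 12 (by decide)).trans h12
        refine ⟨l2.length, by simp, l1 ++ [x], l2, by simp, rfl, by simp [r12], ?_, by simp; omega⟩
        simp only [reduceIte, Nat.reduceEqDiff]
        convert h14' using 1
        ext e
        simp [or_and_right, exists_or]
  · rintro T s' ⟨j, T', rfl, ⟨l1, l2, rfl, rfl, h12, h14, hT⟩, hf, hb⟩ -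
    have r9 : s'.reg 9 = (l1 ++ l2).length := by
      rw [hf.reg 9 (by decide)]
      exact hact.len
    rw [Test.holds_lt, h12, r9] at hb
    have hnil : l2 = [] := by
      cases l2 with
      | nil => rfl
      | cons => simp at hb
    subst hnil
    rw [List.append_nil] at *
    exact ⟨by omega, h14⟩

end CFT

namespace CFT

variable {n m q : ℕ} {G : ColoredGraph n m q} {σ : Setting} {k f : ℕ} {W : ℕ → ℝ≥0}

/-! ### Discarding parallel edges -/

/-- The edges of `X` that are parallel to `e` and listed with the same orientation. -/
def parallels (G : ColoredGraph n m q) (X : Finset (Fin m)) (e : Fin m) : Finset (Fin m) :=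
  X.filter fun e' => G.src e' = G.src e ∧ G.dst e' = G.dst e

theorem mem_parallels {X : Finset (Fin m)} {e e' : Fin m} :
    e' ∈ parallels G X e ↔ e' ∈ X ∧ G.src e' = G.src e ∧ G.dst e' = G.dst e := by
  simp [parallels]

/-- The selection process: the edges in `X` have been selected for the test, in the order of their
weights, and the edges in `D` have been selected or discarded. An edge is discarded if a selected
parallel edge has the same color, or if more than `f` parallel edges have been selected. -/
structure Selection (G : ColoredGraph n m q) (f : ℕ) (X D : Finset (Fin m)) : Prop where
  subset : X ⊆ D
  reason : ∀ e ∈ D, (∃ e' ∈ parallels G X e, G.edgeColor e' = G.edgeColor e ∧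
      G.weight e' ≤ G.weight e) ∨
    f < ((parallels G X e).filter fun e' => G.weight e' ≤ G.weight e).card
  color : ∀ e ∈ X, ∀ e' ∈ parallels G Finset.univ e, G.edgeColor e' = G.edgeColor e → e' ∈ D
  color_inj : ∀ e ∈ X, ∀ e' ∈ parallels G X e, G.edgeColor e' = G.edgeColor e → e' = e
  card_le : ∀ e, (parallels G X e).card ≤ f + 1
  card_le_of_notMem : ∀ e ∉ D, (parallels G X e).card ≤ f
  weight_le : ∀ e ∉ D, ∀ e' ∈ X, G.weight e' ≤ G.weight e

theorem Selection.empty (G : ColoredGraph n m q) (f : ℕ) : Selection G f ∅ ∅ := by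
  constructor <;> simp [parallels]

open Classical in
/-- The edges that are discarded when `e` is selected, including `e`. -/
noncomputable def discard (G : ColoredGraph n m q) (f : ℕ) (X D : Finset (Fin m)) (e : Fin m) :
    Finset (Fin m) :=
  D ∪ (parallels G Finset.univ e).filter fun e' =>
    G.edgeColor e' = G.edgeColor e ∨ f < (parallels G X e).card + 1

theorem mem_discard {X D : Finset (Fin m)} {e e' : Fin m} : e' ∈ discard G f X D e ↔
    e' ∈ D ∨ (G.src e' = G.src e ∧ G.dst e' = G.dst e) ∧
      (G.edgeColor e' = G.edgeColor e ∨ f < (parallels G X e).card + 1) := by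
  simp [discard, mem_parallels]

theorem parallels_congr {X : Finset (Fin m)} {e e' : Fin m}
    (h : G.src e' = G.src e ∧ G.dst e' = G.dst e) : parallels G X e' = parallels G X e := by
  simp [parallels, h]

theorem parallels_insert {X : Finset (Fin m)} {e e' : Fin m} : parallels G (insert e X) e' =
    if G.src e = G.src e' ∧ G.dst e = G.dst e' then insert e (parallels G X e')
      else parallels G X e' := by
  unfold parallels
  rw [Finset.filter_insert]

theorem card_parallels_insert {X : Finset (Fin m)} {e e' : Fin m} (he : e ∉ X) :
    (parallels G (insert e X) e').card = (parallels G X e').card +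
      if G.src e = G.src e' ∧ G.dst e = G.dst e' then 1 else 0 := by
  rw [parallels_insert]
  split_ifs
  · rw [Finset.card_insert_of_notMem fun h => he (mem_parallels.1 h).1]
  · rfl

theorem parallels_mono {X X' : Finset (Fin m)} {e : Fin m} (h : X ⊆ X') :
    parallels G X e ⊆ parallels G X' e := Finset.filter_subset_filter _ h

/-- Select a lightest edge among those that are left. -/
theorem Selection.insert {X D : Finset (Fin m)} {e : Fin m} (h : Selection G f X D) (he : e ∉ D)
    (hmin : ∀ e' ∉ D, G.weight e ≤ G.weight e') :
    Selection G f (insert e X) (discard G f X D e) := by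
  have heX : e ∉ X := fun hX => he (h.subset hX)
  constructor
  · intro e' he'
    rw [mem_discard]
    rcases Finset.mem_insert.1 he' with rfl | he'
    · simp
    · exact Or.inl (h.subset he')
  · intro e' he'
    by_cases hD : e' ∈ D
    · rcases h.reason e' hD with ⟨e₁, h1, h2⟩ | h1
      · exact Or.inl ⟨e₁, parallels_mono (Finset.subset_insert _ _) h1, h2⟩
      · refine Or.inr (h1.trans_le (Finset.card_le_card ?_))
        exact Finset.filter_subset_filter _ (parallels_mono (Finset.subset_insert _ _))
    · obtain ⟨hpar, hc⟩ := (mem_discard.1 he').resolve_left hD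
      rcases hc with hc | hc
      · exact Or.inl ⟨e, mem_parallels.2 ⟨Finset.mem_insert_self _ _, hpar.1.symm, hpar.2.symm⟩,
          hc.symm, hmin e' hD⟩
      · right
        rw [Finset.filter_true_of_mem]
        · rw [card_parallels_insert heX, if_pos ⟨hpar.1.symm, hpar.2.symm⟩, parallels_congr hpar]
          exact hc
        · intro e₁ h1
          rcases Finset.mem_insert.1 (mem_parallels.1 h1).1 with rfl | h1
          · exact hmin e' hD
          · exact h.weight_le e' hD e₁ h1
  · intro e₁ h1 e₂ h2 hc
    rw [mem_discard]
    rcases Finset.mem_insert.1 h1 with rfl | h1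
    · exact Or.inr ⟨(mem_parallels.1 h2).2, Or.inl hc⟩
    · exact Or.inl (h.color e₁ h1 e₂ h2 hc)
  · intro e₁ h1 e₂ h2 hc
    obtain ⟨h2, hpar⟩ := mem_parallels.1 h2
    rcases Finset.mem_insert.1 h1 with h1 | h1 <;> rcases Finset.mem_insert.1 h2 with h2 | h2
    · rw [h1, h2]
    · rw [h1] at hpar hc
      exact absurd (h.color e₂ h2 e (mem_parallels.2 ⟨Finset.mem_univ _, hpar.1.symm, hpar.2.symm⟩)
        hc.symm) he
    · rw [h2] at hpar hc
      exact absurd (h.color e₁ h1 e (mem_parallels.2 ⟨Finset.mem_univ _, hpar⟩) hc) he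
    · exact h.color_inj e₁ h1 e₂ (mem_parallels.2 ⟨h2, hpar⟩) hc
  · intro e'
    rw [card_parallels_insert heX]
    split_ifs with hpar
    · rw [← parallels_congr hpar]
      have := h.card_le_of_notMem e he
      omega
    · exact h.card_le e'
  · intro e' he'
    rw [mem_discard, not_or] at he'
    rw [card_parallels_insert heX]
    split_ifs with hpar
    · have h1 : ¬ f < (parallels G X e).card + 1 := fun hlt =>
        he'.2 ⟨⟨hpar.1.symm, hpar.2.symm⟩, Or.inr hlt⟩
      rw [← parallels_congr hpar]
      omega
    · exact h.card_le_of_notMem e' he'.1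
  · intro e' he' e₁ h1
    rw [mem_discard, not_or] at he'
    rcases Finset.mem_insert.1 h1 with rfl | h1
    · exact hmin e' he'.1
    · exact h.weight_le e' he'.1 e₁ h1

open ColoredGraph in
/-- It suffices that the selected edges are covered: a discarded edge is covered by a selected edge
of the same color, or by one of more than `f` selected edges of different colors. -/
theorem Selection.covered {X D H : Finset (Fin m)} {t : ℝ≥0∞} (h : Selection G f X D)
    (hX : ∀ e ∈ X, G.Covered σ f t H e) : ∀ e ∈ D, G.Covered σ f t H e := by
  intro e he
  rcases h.reason e he with ⟨e', h1, hc, hw⟩ | hlt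
  · obtain ⟨hX', hs, hd⟩ := mem_parallels.1 h1
    exact (hX e' hX').congr hs hd hc hw
  · refine covered_of_parallel hlt ?_ ?_
    · intro e₁ h1 e₂ h2 hc
      obtain ⟨h1, hs1, hd1⟩ := mem_parallels.1 (Finset.mem_filter.1 h1).1
      obtain ⟨h2, hs2, hd2⟩ := mem_parallels.1 (Finset.mem_filter.1 h2).1
      exact h.color_inj e₂ h2 e₁ (mem_parallels.2 ⟨h1, hs1.trans hs2.symm, hd1.trans hd2.symm⟩) hc
    · intro e' he'
      obtain ⟨h1, hw⟩ := Finset.mem_filter.1 he'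
      obtain ⟨h1, hs, hd⟩ := mem_parallels.1 h1
      exact ⟨hX e' h1, hs, hd, hw⟩

/-- The numbers of the edges from `u`, plus one, form a linked list with the first entry in array 8
and the successors in array 9. -/
def HasSourceLists (G : ColoredGraph n m q) (s : State) : Prop :=
  ∀ u : Fin n, ∃ l : List (Fin m),
    IsLinked (s.arr 9) (s.arr 8 u) (l.map fun e : Fin m => (e : ℕ) + 1) ∧ l.Nodup ∧
      ∀ e, e ∈ l ↔ G.src e = u

theorem HasSourceLists.congr {s s' : State} (h : HasSourceLists G s)
    (ha : ∀ a ∈ [8, 9], s'.arr a = s.arr a) : HasSourceLists G s' := by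
  unfold HasSourceLists at *
  simpa [ha] using h

/-- The ends and the colors of the edges are in the arrays 0 to 2. -/
structure HasEdges (G : ColoredGraph n m q) (s : State) : Prop where
  src : ∀ e : Fin m, s.arr 0 e = G.src e
  dst : ∀ e : Fin m, s.arr 1 e = G.dst e
  color : ∀ e : Fin m, s.arr 2 e = G.edgeColor e

theorem HasEdges.congr {s s' : State} (h : HasEdges G s)
    (ha : ∀ a ∈ [0, 1, 2], s'.arr a = s.arr a) : HasEdges G s' := by
  constructor
  · simpa [ha] using h.src
  · simpa [ha] using h.dst
  · simpa [ha] using h.color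

/-- The state of the selection: array 23 tells which edges are in `D`, and array 24 counts the
selected parallel edges. -/
structure HasSelection (G : ColoredGraph n m q) (X D : Finset (Fin m)) (s : State) : Prop where
  done : ∀ e : Fin m, s.arr 23 e ≠ 0 ↔ e ∈ D
  count : ∀ e ∉ D, s.arr 24 (e : Fin m) = (parallels G X e).card

/-- Update the state of the edge in register 39, when the edge selected has the destination in
register 18 and the color in register 42. -/
def markDone : Program :=
  .block [.load 40 23 39, .ite (.eq 40 6) (.block [.load 40 1 39, .ite (.eq 40 18) (.block [
    .load 41 24 39, .inc 41, .store 24 39 41, .load 40 2 39,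
    .ite (.eq 40 42) (.store 23 39 7) (.ite (.lt 4 41) (.store 23 39 7) .skip)]) .skip]) .skip]

theorem wp_markDone {X D : Finset (Fin m)} {s s₀ : State} {e e₁ : Fin m} (hE : HasEdges G s)
    (hsel : HasSelection G X D s₀) (hs : G.src e₁ = G.src e)
    (h4 : s.reg 4 = f) (h6 : s.reg 6 = 0) (h7 : s.reg 7 = 1)
    (h18 : s.reg 18 = G.dst e) (h39 : s.reg 39 = e₁) (h42 : s.reg 42 = G.edgeColor e)
    (h23 : s.arr 23 e₁ = s₀.arr 23 e₁) (h24 : s.arr 24 e₁ = s₀.arr 24 e₁) :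
    wp W markDone s fun T s' => T ≤ 20 ∧ (∀ i, i ≠ (e₁ : ℕ) → s'.arr 23 i = s.arr 23 i) ∧
      (∀ i, i ≠ (e₁ : ℕ) → s'.arr 24 i = s.arr 24 i) ∧
      (s'.arr 23 e₁ ≠ 0 ↔ e₁ ∈ discard G f X D e) ∧
      (e₁ ∉ D → s'.arr 24 e₁ = (parallels G X e₁).card + if G.dst e = G.dst e₁ then 1 else 0) := by
  unfold markDone
  simp only [wp_block_cons, wp_block_nil, wp_load, wp_inc, wp_store, wp_ite, wp_skip,
    State.reg_setReg, State.arr_setReg, State.reg_setArr, State.arr_setArr, Test.holds_eq,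
    Test.holds_lt, reduceIte, Nat.reduceEqDiff, h4, h6, h7, h18, h39, h42, h23, h24, hE.dst,
    hE.color, mem_discard, hs, true_and]
  have hd := hsel.done e₁
  constructor
  · intro h0
    have hD : e₁ ∉ D := fun h => hd.2 h h0
    have hc := hsel.count e₁ hD
    constructor
    · intro hdst
      have hdst := Fin.ext hdst
      have hpar := parallels_congr (X := X) ⟨hs, hdst⟩
      rw [hc, hpar]
      constructor
      · intro hcol
        refine ⟨by omega, ?_, ?_, ?_, ?_⟩
        · intro i hi
          rw [Function.update_of_ne hi]
        · intro i hi
          rw [Function.update_of_ne hi]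
        · simp [hdst, Fin.ext hcol]
        · simp [hdst]
      · intro hcol
        have hcol : G.edgeColor e₁ ≠ G.edgeColor e := fun h => hcol (congrArg _ h)
        refine ⟨fun hlt => ⟨by omega, ?_, ?_, ?_, ?_⟩, fun hlt => ⟨by omega, ?_, ?_, ?_, ?_⟩⟩
        · intro i hi
          rw [Function.update_of_ne hi]
        · intro i hi
          rw [Function.update_of_ne hi]
        · simp [hdst, hlt]
        · simp [hdst]
        · simp
        · intro i hi
          rw [Function.update_of_ne hi]
        · simp [h0, hD, hcol, hlt]
        · simp [hdst]
    · intro hdst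
      have hdst' : G.dst e₁ ≠ G.dst e := fun h => hdst (congrArg _ h)
      refine ⟨by omega, by simp, by simp, ?_, ?_⟩
      · simp [h0, hD, hdst']
      · simp [hc, hdst'.symm]
  · intro h0
    have hD : e₁ ∈ D := hd.1 h0
    exact ⟨by omega, by simp, by simp, by simp [h0, hD], fun h => absurd hD h⟩

/-- Scan the edges from the vertex in register 11, after the edge in register 17 has been selected,
and find the new candidate of the vertex. -/
def rescan : Program :=
  .block [.load 42 2 17, .const 37 0, .load 38 8 11,
    .while (.lt 6 38) (.block [.copy 39 38, .dec 39, markDone, .load 40 23 39,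
      .ite (.eq 40 6) (pickLighter 37 38) .skip, .load 38 9 38]),
    .store 11 11 37]

theorem wp_rescan {X D : Finset (Fin m)} {s : State} {e : Fin m} (hE : HasEdges G s)
    (hsrc : HasSourceLists G s) (hsel : HasSelection G X D s) (heX : e ∉ X)
    (h4 : s.reg 4 = f) (h6 : s.reg 6 = 0) (h7 : s.reg 7 = 1) (h11 : s.reg 11 = G.src e)
    (h17 : s.reg 17 = e) (h18 : s.reg 18 = G.dst e) :
    wp G.weightArr rescan s fun T s' =>
      T ≤ 50 * (Finset.univ.filter fun e' => G.src e' = G.src e).card + 10 ∧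
      HasSelection G (insert e X) (discard G f X D e) s' ∧
      IsLightest G {e' | G.src e' = G.src e ∧ e' ∉ discard G f X D e} (s'.arr 11 (G.src e)) ∧
      ∀ i, i ≠ (G.src e : ℕ) → s'.arr 11 i = s.arr 11 i := by
  obtain ⟨l, hl, hnd, hmem⟩ := hsrc (G.src e)
  have hlen : l.length = (Finset.univ.filter fun e' => G.src e' = G.src e).card := by
    rw [← List.toFinset_card_of_nodup hnd]
    congr 1
    ext e'
    simp [hmem]
  unfold rescan
  simp only [wp_block_cons, wp_block_nil, wp_load, wp_const, wp_store, State.reg_setReg,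
    State.arr_setReg, reduceIte, Nat.reduceEqDiff, h11, h17, hE.color]
  set s0 : State := ((s.setReg 42 (G.edgeColor e)).setReg 37 0).setReg 38 (s.arr 8 (G.src e))
  -- the edges in `l1` have been scanned
  refine (wp_while (j := l.length) (fun j T s' => ∃ l1 l2 : List (Fin m), l = l1 ++ l2 ∧
    l2.length = j ∧ T ≤ 50 * l1.length ∧
    IsLinked (s.arr 9) (s'.reg 38) (l2.map fun e : Fin m => (e : ℕ) + 1) ∧
    (∀ i : Fin m, i ∉ l1 → s'.arr 23 i = s.arr 23 i ∧ s'.arr 24 i = s.arr 24 i) ∧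
    (∀ i ∈ l1, s'.arr 23 (i : Fin m) ≠ 0 ↔ i ∈ discard G f X D e) ∧
    (∀ i ∈ l1, i ∉ D → s'.arr 24 (i : Fin m) =
      (parallels G X i).card + if G.dst e = G.dst i then 1 else 0) ∧
    IsLightest G {i | i ∈ l1 ∧ i ∉ discard G f X D e} (s'.reg 37)) ?_ ?_).mono ?_
  · exact ⟨[], l, rfl, rfl, by simp, hl, fun i _ => ⟨rfl, rfl⟩, by simp, by simp,
      Or.inl ⟨rfl, by simp⟩⟩
  · rintro j T s1 ⟨l1, l2, rfl, rfl, hT, h38, hrest, hdone, hcount, h37⟩ hf hb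
    have r6 : s1.reg 6 = 0 := (hf.reg 6 (by decide)).trans h6
    rw [Test.holds_lt, r6] at hb
    cases l2 with
    | nil =>
      have : s1.reg 38 = 0 := h38
      omega
    | cons i l2 =>
      obtain ⟨h38, -, h38'⟩ := h38
      have hi : i ∉ l1 := fun hi => by
        rw [List.nodup_append] at hnd
        exact hnd.2.2 i hi i (by simp) rfl
      have hsi : G.src i = G.src e := (hmem i).1 (by simp)
      simp only [wp_block_cons, wp_copy, wp_dec, State.reg_setReg, reduceIte, h38,
        Nat.add_sub_cancel]
      refine (wp_markDone (s := (s1.setReg 39 (i + 1)).setReg 39 i) (f := f) (G := G) (X := X)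
        (D := D) (e := e) (e₁ := i) (s₀ := s) (hE.congr fun a ha => ?_) hsel hsi
        ?_ ?_ ?_ ?_ (by simp [State.reg_setReg]) ?_ (hrest i hi).1 (hrest i hi).2).mono ?_
      · exact (hf.arr a (by revert a; decide)).trans rfl
      · exact (hf.reg 4 (by decide)).trans h4
      · exact r6
      · exact (hf.reg 7 (by decide)).trans h7
      · exact (hf.reg 18 (by decide)).trans h18
      · exact (hf.reg 42 (by decide)).trans rfl
      · rintro T2 s2 ⟨hT2, q23, q24, hdone2, hcount2⟩ hf2
        have r39 : s2.reg 39 = i := by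
          rw [hf2.reg 39 (by decide)]
          simp [State.reg_setReg]
        have r38 : s2.reg 38 = i + 1 := (hf2.reg 38 (by decide)).trans h38
        have r37 : s2.reg 37 = s1.reg 37 := hf2.reg 37 (by decide)
        have r6' : s2.reg 6 = 0 := (hf2.reg 6 (by decide)).trans r6
        have a9 : s2.arr 9 = s.arr 9 := (hf2.arr 9 (by decide)).trans (hf.arr 9 (by decide))
        -- what holds after the update of the candidate
        have hfinal : ∀ (T3 : ℕ) (s3 : State), T3 ≤ 15 → s3.arr 23 = s2.arr 23 →
            s3.arr 24 = s2.arr 24 →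
            s3.reg 38 = s.arr 9 (i + 1) →
            IsLightest G ({i | i ∈ l1 ∧ i ∉ discard G f X D e} ∪
              {j | j = i ∧ i ∉ discard G f X D e}) (s3.reg 37) →
            ∃ j' < (i :: l2).length, ∃ l1' l2', l1 ++ i :: l2 = l1' ++ l2' ∧
              l2'.length = j' ∧ T + 1 + (1 + (1 + (T2 + (1 + (T3 + (1 + 1)))))) ≤ 50 * l1'.length ∧
              IsLinked (s.arr 9) (s3.reg 38) (l2'.map fun e : Fin m => (e : ℕ) + 1) ∧
              (∀ i : Fin m, i ∉ l1' → s3.arr 23 i = s.arr 23 i ∧ s3.arr 24 i = s.arr 24 i) ∧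
              (∀ i ∈ l1', s3.arr 23 (i : Fin m) ≠ 0 ↔ i ∈ discard G f X D e) ∧
              (∀ i ∈ l1', i ∉ D → s3.arr 24 (i : Fin m) =
                (parallels G X i).card + if G.dst e = G.dst i then 1 else 0) ∧
              IsLightest G {i | i ∈ l1' ∧ i ∉ discard G f X D e} (s3.reg 37) := by
          intro T3 s3 hT3 e23 e24 e38 e37
          refine ⟨l2.length, by simp, l1 ++ [i], l2, by simp, rfl, by simp; omega, e38 ▸ h38', ?_,
            ?_, ?_, ?_⟩
          · intro i' hi'
            simp only [List.mem_append, List.mem_singleton, not_or] at hi'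
            have hne : (i' : ℕ) ≠ i := fun h => hi'.2 (Fin.ext h)
            rw [e23, e24, q23 _ hne, q24 _ hne]
            exact hrest i' hi'.1
          · intro i' hi'
            rw [e23]
            by_cases hii : i' = i
            · rw [hii]
              exact hdone2
            · rw [q23 _ fun h => hii (Fin.ext h)]
              exact hdone i' (by simpa [hii] using hi')
          · intro i' hi' hD
            rw [e24]
            by_cases hii : i' = i
            · rw [hii] at hD ⊢
              exact hcount2 hD
            · rw [q24 _ fun h => hii (Fin.ext h)]
              exact hcount i' (by simpa [hii] using hi') hD
          · convert e37 using 1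
            ext j
            simp only [List.mem_append, List.mem_singleton, Set.mem_ofPred_eq, Set.mem_union]
            constructor
            · rintro ⟨h | rfl, h'⟩
              · exact Or.inl ⟨h, h'⟩
              · exact Or.inr ⟨rfl, h'⟩
            · rintro (h | ⟨rfl, h'⟩)
              · exact ⟨Or.inl h.1, h.2⟩
              · exact ⟨Or.inr rfl, h'⟩
        simp only [wp_block_nil, wp_load, wp_ite, wp_skip, State.reg_setReg, State.arr_setReg,
          reduceIte, Nat.reduceEqDiff, Test.holds_eq, r39, r6', r38, a9]
        constructor
        · intro h0
          have hnD : i ∉ discard G f X D e := fun h => hdone2.2 h h0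
          refine (wp_pickLighter (s := s2.setReg 40 (s2.arr 23 i))
            (S := {i | i ∈ l1 ∧ i ∉ discard G f X D e})
            (S' := {j | j = i ∧ i ∉ discard G f X D e}) r6' ?_ ?_ (by simp) (by simp)).mono ?_
          · simpa only [State.reg_setReg, reduceIte, Nat.reduceEqDiff, r37] using h37
          · refine Or.inr ⟨i, ⟨rfl, hnD⟩, r38, ?_⟩
            rintro e' ⟨rfl, -⟩
            exact le_rfl
          · rintro T3 s3 ⟨hT3, hlight⟩ hf3
            have r38' : s3.reg 38 = i + 1 := (hf3.reg 38 (by decide)).trans r38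
            have a9' : s3.arr 9 = s.arr 9 := (hf3.arr 9 (by decide)).trans a9
            have := hfinal (1 + T3) (s3.setReg 38 (s3.arr 9 (s3.reg 38))) (by omega)
              (hf3.arr 23 (by decide)) (hf3.arr 24 (by decide))
              (by simp [State.reg_setReg, r38', a9'])
              (by simpa only [State.reg_setReg, reduceIte, Nat.reduceEqDiff] using hlight)
            simpa only [State.reg_setReg, State.arr_setReg, reduceIte, Nat.reduceEqDiff] using this
        · intro h0
          have hD : i ∈ discard G f X D e := hdone2.1 h0
          have := hfinal (1 + 1) ((s2.setReg 40 (s2.arr 23 i)).setReg 38 (s.arr 9 (i + 1)))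
            (by omega) rfl rfl (by simp [State.reg_setReg]) (by
              simp only [State.reg_setReg, reduceIte, Nat.reduceEqDiff, r37]
              convert h37 using 1
              ext j
              simp [hD])
          simpa only [State.reg_setReg, State.arr_setReg, reduceIte, Nat.reduceEqDiff] using this
  · rintro T s' ⟨j, T', rfl, ⟨l1, l2, rfl, rfl, hT, h38, hrest, hdone, hcount, h37⟩, hf, hb⟩ -
    have r6 : s'.reg 6 = 0 := (hf.reg 6 (by decide)).trans h6
    have r11 : s'.reg 11 = G.src e := (hf.reg 11 (by decide)).trans h11
    rw [Test.holds_lt, r6] at hb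
    have hnil : l2 = [] := by
      cases l2 with
      | nil => rfl
      | cons i l2 =>
        have : s'.reg 38 = i + 1 := h38.1
        omega
    subst hnil
    rw [List.append_nil] at hlen hmem
    simp only [r11]
    refine ⟨by omega, ⟨?_, ?_⟩, ?_, ?_⟩
    · intro i
      simp only [State.arr_setArr, reduceIte, Nat.reduceEqDiff]
      by_cases hi : i ∈ l1
      · exact hdone i hi
      · rw [(hrest i hi).1, hsel.done, mem_discard]
        rw [hmem] at hi
        simp [hi]
    · intro i hi
      simp only [State.arr_setArr, reduceIte, Nat.reduceEqDiff]
      have hiD : i ∉ D := fun h => hi (mem_discard.2 (Or.inl h))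
      rw [card_parallels_insert heX]
      by_cases hil : i ∈ l1
      · rw [hcount i hil hiD, (hmem i).1 hil]
        simp
      · rw [(hrest i hil).2, hsel.count i hiD]
        rw [hmem] at hil
        simp [Ne.symm hil]
    · simp only [State.arr_setArr, reduceIte, Function.update_self]
      convert h37 using 1
      ext i
      simp [hmem]
    · intro i hi
      simp only [State.arr_setArr, reduceIte]
      rw [Function.update_of_ne hi, hf.arr 11 (by decide)]
      rfl

end CFT

namespace CFT

variable {n m q : ℕ} {G : ColoredGraph n m q} {σ : Setting} {k f : ℕ} {W : ℕ → ℝ≥0}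

/-! ### Reading the input -/

/-- Compute the color codes of the edge in register 10 with the ends in registers 11 and 12. -/
def initCodes : Program :=
  .block [.load 13 2 10, .inc 13, .load 14 3 11, .inc 14, .load 15 3 12, .inc 15,
    .ite (.eq 5 7) (.const 13 0) (.ite (.eq 5 6) (.block [.const 14 0, .const 15 0]) .skip),
    .store 5 10 13, .store 6 10 14, .store 7 10 15]

theorem wp_initCodes {s : State} {e : Fin m} (hE : HasEdges G s)
    (h3 : ∀ v : Fin n, s.arr 3 v = G.vertexColor v) (h5 : s.reg 5 = σ.code) (h6 : s.reg 6 = 0)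
    (h7 : s.reg 7 = 1) (h10 : s.reg 10 = e) (h11 : s.reg 11 = G.src e) (h12 : s.reg 12 = G.dst e) :
    wp W initCodes s fun T s' => T ≤ 20 ∧
      s'.arr 5 = Function.update (s.arr 5) e (codeE G σ e) ∧
      s'.arr 6 = Function.update (s.arr 6) e (codeV G σ (G.src e)) ∧
      s'.arr 7 = Function.update (s.arr 7) e (codeV G σ (G.dst e)) := by
  unfold initCodes
  simp only [wp_block_cons, wp_block_nil, wp_load, wp_inc, wp_store, wp_ite, wp_skip, wp_const,
    State.reg_setReg, State.arr_setReg, State.reg_setArr, State.arr_setArr, Test.holds_eq,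
    reduceIte, Nat.reduceEqDiff, h5, h6, h7, h10, h11, h12, hE.color, h3]
  cases σ <;> simp [Setting.code, codeE, codeV]

/-- The edges with a number below `i` have been read: they are in the lists of their sources, `act`
is the list of their sources, and array 11 holds the lightest edges. -/
structure SourceInv (G : ColoredGraph n m q) (i : ℕ) (act : List (Fin n)) (s : State) : Prop where
  lists : ∀ u : Fin n, ∃ l : List (Fin m),
    IsLinked (s.arr 9) (s.arr 8 u) (l.map fun e : Fin m => (e : ℕ) + 1) ∧ l.Nodup ∧
      ∀ e, e ∈ l ↔ G.src e = u ∧ (e : ℕ) < i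
  active : HasActive act s
  nodup : act.Nodup
  mem_act : ∀ u, u ∈ act ↔ ∃ e, G.src e = u ∧ (e : ℕ) < i
  lightest : ∀ u : Fin n, IsLightest G {e | G.src e = u ∧ (e : ℕ) < i} (s.arr 11 u)

theorem SourceInv.congr {i : ℕ} {act : List (Fin n)} {s s' : State} (h : SourceInv G i act s)
    (ha : ∀ a ∈ [8, 9, 10, 11], s'.arr a = s.arr a) (hr : s'.reg 9 = s.reg 9) :
    SourceInv G i act s' := by
  constructor
  · simpa [ha] using h.lists
  · exact ⟨hr.trans h.active.len, by simpa [ha] using h.active.val⟩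
  · exact h.nodup
  · exact h.mem_act
  · simpa [ha] using h.lightest

/-- Put the edge in register 10 in the list of its source, which is in register 11. -/
def initLists : Program :=
  .block [.copy 16 10, .inc 16, .load 12 8 11, .store 9 16 12, .store 8 11 16,
    .ite (.eq 12 6) (.block [.store 10 9 11, .inc 9]) .skip,
    .load 13 11 11, pickLighter 13 16, .store 11 11 13]

theorem HasActive.append {act : List (Fin n)} {s s' : State} {u : Fin n} (h : HasActive act s)
    (hr : s'.reg 9 = s.reg 9 + 1) (ha : s'.arr 10 = Function.update (s.arr 10) (s.reg 9) u) :
    HasActive (act ++ [u]) s' := by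
  constructor
  · simp [hr, h.len]
  · intro i x hx
    rw [ha, h.len]
    rcases lt_trichotomy i act.length with hi | rfl | hi
    · rw [List.getElem?_append_left hi] at hx
      rw [Function.update_of_ne hi.ne]
      exact h.val i x hx
    · simp at hx
      simp [hx]
    · rw [List.getElem?_append_right hi.le, List.getElem?_eq_none (by simp; omega)] at hx
      simp at hx

theorem wp_initLists {act : List (Fin n)} {s : State} {e : Fin m} (h : SourceInv G e act s)
    (h6 : s.reg 6 = 0) (h10 : s.reg 10 = e) (h11 : s.reg 11 = G.src e) :
    wp G.weightArr initLists s fun T s' => T ≤ 30 ∧ ∃ act', SourceInv G (e + 1) act' s' := by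
  have hlt : ∀ e' : Fin m, (e' : ℕ) < e + 1 ↔ (e' : ℕ) < e ∨ e' = e := fun e' => by
    rw [Fin.ext_iff]
    omega
  unfold initLists
  simp only [wp_block_cons, wp_block_nil, wp_copy, wp_inc, wp_load, wp_store,
    State.reg_setReg, State.arr_setReg, State.reg_setArr, reduceIte, Nat.reduceEqDiff, h10, h11]
  -- the vertex becomes active if its list was empty
  refine wp.mono (Q := fun T s1 => T ≤ 5 ∧ s1.reg 6 = 0 ∧ s1.reg 11 = G.src e ∧
    s1.reg 16 = e + 1 ∧ s1.arr 8 = Function.update (s.arr 8) (G.src e) (e + 1) ∧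
    s1.arr 9 = Function.update (s.arr 9) (e + 1) (s.arr 8 (G.src e)) ∧ s1.arr 11 = s.arr 11 ∧
    ∃ act', HasActive act' s1 ∧ act'.Nodup ∧
      ∀ u, u ∈ act' ↔ ∃ e', G.src e' = u ∧ (e' : ℕ) < e + 1) ?_ ?_
  · obtain ⟨l, hl, -, hmem⟩ := h.lists (G.src e)
    simp only [wp_block_cons, wp_block_nil, wp_inc, wp_store, wp_ite, wp_skip, Test.holds_eq,
      State.reg_setReg, State.arr_setReg, State.reg_setArr, State.arr_setArr, reduceIte,
      Nat.reduceEqDiff, h6, h11]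
    refine ⟨fun h0 => ⟨by omega, trivial, trivial, trivial, trivial, trivial, trivial,
      act ++ [G.src e], ?_, ?_, ?_⟩, fun h0 => ⟨by omega, trivial, trivial, trivial, trivial,
      trivial, trivial, act, ?_, h.nodup, ?_⟩⟩
    · exact h.active.append (by simp [State.reg_setReg])
        (by simp [State.arr_setReg, State.arr_setArr])
    · have hnil : l = [] := by
        cases l with
        | nil => rfl
        | cons i l =>
          have : s.arr 8 (G.src e) = i + 1 := hl.1
          omega
      subst hnil
      rw [List.nodup_append]
      refine ⟨h.nodup, by simp, ?_⟩
      rintro u hu v hv rfl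
      rw [List.mem_singleton] at hv
      obtain ⟨e', he'⟩ := (h.mem_act u).1 hu
      have := (hmem e').2 (hv ▸ he')
      simp at this
    · intro u
      rw [List.mem_append, List.mem_singleton, h.mem_act]
      simp only [hlt, and_or_left, exists_or, exists_eq_right]
      rw [eq_comm (a := u)]
    · exact ⟨h.active.len, h.active.val⟩
    · intro u
      rw [h.mem_act]
      simp only [hlt, and_or_left, exists_or, exists_eq_right]
      refine ⟨Or.inl, ?_⟩
      rintro (h' | rfl)
      · exact h'
      · cases l with
        | nil => exact absurd hl h0
        | cons i l => exact ⟨i, (hmem i).1 (by simp)⟩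
  · rintro T1 s1 ⟨hT1, r6, r11, r16, a8, a9, a11, act', hact, hnd, hmem⟩ -
    simp only [r11, a11]
    refine (wp_pickLighter (S := {e' | G.src e' = G.src e ∧ (e' : ℕ) < e}) (S' := {e})
      (s := s1.setReg 13 (s.arr 11 (G.src e))) r6 ?_ ?_ (by simp) (by simp)).mono ?_
    · exact h.lightest (G.src e)
    · exact Or.inr ⟨e, rfl, r16, by simp⟩
    · rintro T2 s2 ⟨hT2, hlight⟩ hf
      have r11' : s2.reg 11 = G.src e := (hf.reg 11 (by decide)).trans r11
      have a11' : s2.arr 11 = s.arr 11 := (hf.arr 11 (by decide)).trans a11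
      refine ⟨by omega, act', ⟨?_, ?_, hnd, hmem, ?_⟩⟩
      · intro u
        obtain ⟨l, hl, hlnd, hlmem⟩ := h.lists u
        simp only [State.arr_setArr, reduceIte, Nat.reduceEqDiff]
        rw [hf.arr 8 (by decide), hf.arr 9 (by decide)]
        simp only [State.arr_setReg, a8, a9]
        have he : e ∉ l := fun he => lt_irrefl _ ((hlmem e).1 he).2
        have hlink : IsLinked (Function.update (s.arr 9) (e + 1) (s.arr 8 (G.src e))) (s.arr 8 u)
            (l.map fun e : Fin m => (e : ℕ) + 1) := by
          refine hl.congr fun a ha => Function.update_of_ne ?_ _ _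
          obtain ⟨e', he', rfl⟩ := List.mem_map.1 ha
          intro heq
          exact he (Fin.ext (Nat.succ_injective heq) ▸ he')
        by_cases hu : u = G.src e
        · subst hu
          refine ⟨e :: l, ?_, List.nodup_cons.2 ⟨he, hlnd⟩, ?_⟩
          · rw [Function.update_self]
            refine ⟨rfl, by simp, ?_⟩
            rw [Function.update_self]
            exact hlink
          · intro e'
            rw [List.mem_cons, hlmem, hlt]
            constructor
            · rintro (rfl | h')
              · exact ⟨rfl, Or.inr rfl⟩
              · exact ⟨h'.1, Or.inl h'.2⟩
            · rintro ⟨h', h'' | rfl⟩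
              · exact Or.inr ⟨h', h''⟩
              · exact Or.inl rfl
        · refine ⟨l, ?_, hlnd, ?_⟩
          · rw [Function.update_of_ne fun heq => hu (Fin.ext heq)]
            exact hlink
          · intro e'
            rw [hlmem, hlt]
            constructor
            · exact fun h' => ⟨h'.1, Or.inl h'.2⟩
            · rintro ⟨h', h'' | rfl⟩
              · exact ⟨h', h''⟩
              · exact absurd h'.symm hu
      · constructor
        · exact (hf.reg 9 (by decide)).trans hact.len
        · intro i x hx
          simp only [State.arr_setArr, reduceIte, Nat.reduceEqDiff]
          rw [hf.arr 10 (by decide)]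
          exact hact.val i x hx
      · intro u
        simp only [State.arr_setArr, reduceIte, r11', a11']
        by_cases hu : u = G.src e
        · subst hu
          rw [Function.update_self]
          convert hlight using 1
          ext e'
          simp only [hlt, Set.mem_ofPred_eq, Set.mem_union, Set.mem_singleton_iff]
          constructor
          · rintro ⟨h1, h2 | h2⟩
            · exact Or.inl ⟨h1, h2⟩
            · exact Or.inr h2
          · rintro (h1 | rfl)
            · exact ⟨h1.1, Or.inl h1.2⟩
            · exact ⟨rfl, Or.inr rfl⟩
        · rw [Function.update_of_ne fun heq => hu (Fin.ext heq)]
          convert h.lightest u using 1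
          ext e'
          simp only [hlt, Set.mem_ofPred_eq]
          constructor
          · rintro ⟨h1, h2 | rfl⟩
            · exact ⟨h1, h2⟩
            · exact absurd h1.symm hu
          · exact fun h1 => ⟨h1.1, Or.inl h1.2⟩

/-- Read the edges. Register 8 becomes `min f m`. -/
def init : Program :=
  .block [.const 7 1, .while (.lt 10 1) (.block [.load 11 0 10, .load 12 1 10, initCodes, initLists,
    .ite (.lt 8 4) (.inc 8) .skip, .inc 10])]

theorem toArr_val {a b : ℕ} (g : Fin a → Fin b) (i : Fin a) : toArr g i = g i := by
  simp [toArr]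

theorem hasEdges_input (G : ColoredGraph n m q) (σ : Setting) (k f : ℕ) :
    HasEdges G (G.input σ k f) :=
  ⟨toArr_val _, toArr_val _, toArr_val _⟩

theorem wp_init : wp G.weightArr init (G.input σ k f) fun T s =>
    T ≤ 100 * m + 5 ∧ s.reg 7 = 1 ∧ s.reg 8 = min f m ∧ HasCodes G σ s ∧
      ∃ act, SourceInv G m act s := by
  unfold init
  simp only [wp_block_cons, wp_block_nil, wp_const]
  have hE : HasEdges G ((G.input σ k f).setReg 7 1) :=
    (hasEdges_input G σ k f).congr fun _ _ => rfl
  have h3 : ∀ v : Fin n, ((G.input σ k f).setReg 7 1).arr 3 v = G.vertexColor v := toArr_val _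
  have h1 : ((G.input σ k f).setReg 7 1).reg 1 = m := rfl
  have h4 : ((G.input σ k f).setReg 7 1).reg 4 = f := rfl
  have h5 : ((G.input σ k f).setReg 7 1).reg 5 = σ.code := rfl
  have h6 : ((G.input σ k f).setReg 7 1).reg 6 = 0 := rfl
  have h7 : ((G.input σ k f).setReg 7 1).reg 7 = 1 := rfl
  have h8 : ((G.input σ k f).setReg 7 1).reg 8 = 0 := rfl
  have h10 : ((G.input σ k f).setReg 7 1).reg 10 = 0 := rfl
  have hS : SourceInv G 0 [] ((G.input σ k f).setReg 7 1) :=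
    ⟨fun u => ⟨[], rfl, by simp, by simp⟩, ⟨rfl, by simp⟩, by simp, by simp,
      fun u => Or.inl ⟨rfl, by simp⟩⟩
  generalize (G.input σ k f).setReg 7 1 = s0 at *
  refine (wp_while (j := m) (fun j T s => ∃ i act, j + i = m ∧ s.reg 10 = i ∧ T ≤ 100 * i ∧
    s.reg 8 = min f i ∧ SourceInv G i act s ∧ ∀ e : Fin m, (e : ℕ) < i →
      s.arr 5 e = codeE G σ e ∧ s.arr 6 e = codeV G σ (G.src e) ∧
      s.arr 7 e = codeV G σ (G.dst e)) ?_ ?_).mono ?_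
  · exact ⟨0, [], by simp, h10, by simp, by simp [h8], hS, by simp⟩
  · rintro j T s1 ⟨i, act, hji, r10, hT, r8, hI, hcode⟩ hf hb
    have r1 := (hf.reg 1 (by decide)).trans h1
    have r6 := (hf.reg 6 (by decide)).trans h6
    rw [Test.holds_lt, r10, r1] at hb
    have hE1 : HasEdges G s1 := hE.congr fun a ha => hf.arr a (by revert a; decide)
    obtain ⟨e, rfl⟩ : ∃ e : Fin m, i = e := ⟨⟨i, hb⟩, rfl⟩
    simp only [wp_block_cons, wp_load, State.reg_setReg, State.arr_setReg, reduceIte,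
      Nat.reduceEqDiff, r10, hE1.src, hE1.dst]
    refine (wp_initCodes (σ := σ) (e := e)
      (s := (s1.setReg 11 (G.src e)).setReg 12 (G.dst e)) (hE1.congr fun _ _ => rfl)
      (fun v => ?_) ?_ r6 ?_ r10 rfl rfl).mono ?_
    · exact (congrFun (hf.arr 3 (by decide)) v).trans (h3 v)
    · exact (hf.reg 5 (by decide)).trans h5
    · exact (hf.reg 7 (by decide)).trans h7
    rintro T1 s2 ⟨hT1, c5, c6, c7⟩ hf1
    refine (wp_initLists (e := e) (act := act) ?_ ((hf1.reg 6 (by decide)).trans r6)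
      ((hf1.reg 10 (by decide)).trans r10) (hf1.reg 11 (by decide))).mono ?_
    · exact hI.congr (fun a ha => (hf1.arr a (by revert a; decide)).trans rfl)
        (hf1.reg 9 (by decide))
    rintro T2 s3 ⟨hT2, act', hI'⟩ hf2
    have q8 : s3.reg 8 = min f e := (hf2.reg 8 (by decide)).trans ((hf1.reg 8 (by decide)).trans r8)
    have q4 : s3.reg 4 = f := (hf2.reg 4 (by decide)).trans ((hf1.reg 4 (by decide)).trans
      ((hf.reg 4 (by decide)).trans h4))
    have q10 : s3.reg 10 = e :=
      (hf2.reg 10 (by decide)).trans ((hf1.reg 10 (by decide)).trans r10)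
    have hcode' : ∀ e' : Fin m, (e' : ℕ) < e + 1 → s3.arr 5 e' = codeE G σ e' ∧
        s3.arr 6 e' = codeV G σ (G.src e') ∧ s3.arr 7 e' = codeV G σ (G.dst e') := by
      intro e' he'
      rw [hf2.arr 5 (by decide), hf2.arr 6 (by decide), hf2.arr 7 (by decide), c5, c6, c7]
      by_cases heq : e' = e
      · simp [heq]
      · have hne : (e' : ℕ) ≠ e := fun h => heq (Fin.ext h)
        rw [Function.update_of_ne hne, Function.update_of_ne hne, Function.update_of_ne hne]
        exact hcode e' (by omega)
    simp only [wp_block_nil, wp_inc, wp_ite, wp_skip, Test.holds_lt,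
      State.reg_setReg, reduceIte, Nat.reduceEqDiff, q8, q4, q10]
    exact ⟨fun hlt => ⟨j - 1, by omega, e + 1, act', by omega, by simp, by omega, by omega,
      hI'.congr (fun _ _ => rfl) rfl, hcode'⟩,
      fun hlt => ⟨j - 1, by omega, e + 1, act', by omega, by simp, by omega, by omega,
        hI'.congr (fun _ _ => rfl) rfl, hcode'⟩⟩
  · rintro T s ⟨j, T', rfl, ⟨i, act, hji, r10, hT, r8, hI, hcode⟩, hf, hb⟩ -
    rw [Test.holds_lt, r10, hf.reg 1 (by decide), h1] at hb
    obtain rfl : i = m := by omega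
    exact ⟨by omega, (hf.reg 7 (by decide)).trans h7, r8,
      ⟨fun e => (hcode e e.2).1, fun e => (hcode e e.2).2.1, fun e => (hcode e e.2).2.2⟩, act, hI⟩

end CFT

namespace CFT

variable {n m q : ℕ} {G : ColoredGraph n m q} {σ : Setting} {k f : ℕ} {W : ℕ → ℝ≥0}

/-! ### The main loop -/

/-- The part of the memory that the main loop does not change. -/
structure Static (G : ColoredGraph n m q) (σ : Setting) (k f : ℕ) (act : List (Fin n))
    (s : State) : Prop where
  edges : HasEdges G s
  codes : HasCodes G σ s
  sources : HasSourceLists G s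
  active : HasActive act s
  three : s.reg 3 = k
  four : s.reg 4 = f
  six : s.reg 6 = 0
  seven : s.reg 7 = 1
  eight : s.reg 8 = min f m

theorem Static.frame {act : List (Fin n)} {P : Program} {s s' : State}
    (h : Static G σ k f act s) (hf : Frame P s s') (hr : ∀ r ∈ [3, 4, 6, 7, 8, 9], r ∉ P.regWrites)
    (ha : ∀ a ∈ [0, 1, 2, 5, 6, 7, 8, 9, 10], a ∉ P.arrWrites) : Static G σ k f act s' := by
  have hr : ∀ r ∈ [3, 4, 6, 7, 8, 9], s'.reg r = s.reg r := fun r h => hf.reg r (hr r h)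
  have ha : ∀ a ∈ [0, 1, 2, 5, 6, 7, 8, 9, 10], s'.arr a = s.arr a := fun a h => hf.arr a (ha a h)
  constructor
  · exact h.edges.congr fun a h => ha a (by revert a; decide)
  · exact h.codes.congr fun a h => ha a (by revert a; decide)
  · exact h.sources.congr fun a h => ha a (by revert a; decide)
  · exact ⟨(hr 9 (by decide)).trans h.active.len, by simpa [ha] using h.active.val⟩
  · exact (hr 3 (by decide)).trans h.three
  · exact (hr 4 (by decide)).trans h.four
  · exact (hr 6 (by decide)).trans h.six
  · exact (hr 7 (by decide)).trans h.seven
  · exact (hr 8 (by decide)).trans h.eight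

/-- The invariant of the main loop: `L` lists the accepted edges together with the colors that
separate their ends, the edges in `X` have been tested, and those in `D` tested or discarded. -/
structure LoopInv (G : ColoredGraph n m q) (σ : Setting) (k f : ℕ)
    (L : List (Fin m × Finset (Fin q))) (X D : Finset (Fin m)) (s : State) : Prop where
  greedy : G.GreedyList σ k f L
  subset : ∀ e ∈ L.map Prod.fst, e ∈ X
  covered : ∀ e ∈ X, G.Covered σ f ((2 * k - 1 : ℕ) : ℝ≥0∞) (L.map Prod.fst).toFinset e
  selection : Selection G f X D
  hasSelection : HasSelection G X D s
  hasSubgraph : HasSubgraph G (L.map Prod.fst) s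
  lightest : ∀ u : Fin n, IsLightest G {e | G.src e = u ∧ e ∉ D} (s.arr 11 u)
  output : ∀ e : Fin m, s.arr 4 e ≠ 0 ↔ e ∈ L.map Prod.fst
  visits : ∀ i, s.arr 13 i ≤ s.reg 25
  marks : ∀ i, s.arr 12 i ≤ s.reg 22

/-- The number of edges with the same source as `e`. -/
def sourceDegree (G : ColoredGraph n m q) (e : Fin m) : ℕ :=
  (Finset.univ.filter fun e' => G.src e' = G.src e).card

/-- Test the edge whose handle is in register 14, and discard the parallel edges that need not be
tested any more. -/
def process : Program :=
  .block [.copy 17 14, .dec 17, .load 11 0 17, .load 18 1 17, .load 19 5 17, .load 20 6 17,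
    .load 21 7 17, testEdge, .ite (.eq 24 7) addEdge .skip, rescan]

open ColoredGraph in
/-- A rejected edge is covered because no edge of the present spanner is heavier. -/
theorem wp_process {act : List (Fin n)} {L : List (Fin m × Finset (Fin q))} {X D : Finset (Fin m)}
    {s : State} {e : Fin m} (hk : 1 ≤ k) (hs : Static G σ k f act s)
    (hI : LoopInv G σ k f L X D s) (he : e ∉ D) (hmin : ∀ e' ∉ D, G.weight e ≤ G.weight e')
    (h14 : s.reg 14 = e + 1) :
    wp G.weightArr process s fun T s' =>
      T ≤ 300 * ((min f m + 2) * (L.length + 1)) + 50 * sourceDegree G e + 50 ∧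
      ∃ L', L.length ≤ L'.length ∧ LoopInv G σ k f L' (insert e X) (discard G f X D e) s' := by
  have heX : e ∉ X := fun h => he (hI.selection.subset h)
  have heL : e ∉ L.map Prod.fst := fun h => heX (hI.subset e h)
  unfold process
  simp only [wp_block_cons, wp_copy, wp_dec, wp_load, State.reg_setReg, State.arr_setReg,
    reduceIte, Nat.reduceEqDiff, h14, Nat.add_sub_cancel, hs.edges.src, hs.edges.dst,
    hs.codes.edge, hs.codes.src, hs.codes.dst]
  set s1 : State := (((((((s.setReg 17 (e + 1)).setReg 17 e).setReg 11 (G.src e)).setReg 18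
    (G.dst e)).setReg 19 (codeE G σ e)).setReg 20 (codeV G σ (G.src e))).setReg 21
    (codeV G σ (G.dst e))) with hs1
  have hf1 : Frame process s s1 := by
    constructor
    · intro x hx
      have : x ∉ [17, 11, 18, 19, 20, 21] := fun h =>
        hx ((by decide : ∀ x ∈ [17, 11, 18, 19, 20, 21], x ∈ process.regWrites) x h)
      simp only [List.mem_cons, List.not_mem_nil, or_false, not_or] at this
      simp [hs1, State.reg_setReg, this]
    · exact fun _ _ => rfl
  have r17 : s1.reg 17 = e := rfl
  have r11 : s1.reg 11 = G.src e := rfl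
  have r18 : s1.reg 18 = G.dst e := rfl
  have hcodes1 : HasEdgeCodes G σ e s1 := ⟨rfl, rfl, rfl⟩
  have hst1 : Static G σ k f act s1 := hs.frame hf1 (by decide) (by decide)
  have hsub1 : HasSubgraph G (L.map Prod.fst) s1 := hI.hasSubgraph
  have hvis1 : ∀ i, s1.arr 13 i ≤ s1.reg 25 := hI.visits
  have hmar1 : ∀ i, s1.arr 12 i ≤ s1.reg 22 := hI.marks
  have e4 : s1.arr 4 = s.arr 4 := rfl
  have e11 : s1.arr 11 = s.arr 11 := rfl
  have hsel1 : HasSelection G X D s1 := ⟨hI.hasSelection.done, hI.hasSelection.count⟩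
  clear_value s1
  refine (wp_testEdge hk hst1.codes hsub1 hcodes1 hst1.three hst1.six hst1.eight r11 r18 hvis1
    hmar1).mono ?_
  rintro T2 s2 ⟨hT2, hvis2, hmar2, hres⟩ hf2
  rw [List.length_map] at hT2
  have hst2 := hst1.frame hf2 (by decide) (by decide)
  have q17 := (hf2.reg 17 (by decide)).trans r17
  have q11 := (hf2.reg 11 (by decide)).trans r11
  have q18 := (hf2.reg 18 (by decide)).trans r18
  have hsub2 : HasSubgraph G (L.map Prod.fst) s2 := hsub1.frame hf2 (by decide) (by decide)
  have f4 : s2.arr 4 = s.arr 4 := (hf2.arr 4 (by decide)).trans e4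
  -- the situation after the edge has been added or not
  refine wp.mono (Q := fun T s3 => T ≤ 25 ∧ ∃ L', L.length ≤ L'.length ∧ G.GreedyList σ k f L' ∧
    (∀ e' ∈ L'.map Prod.fst, e' ∈ insert e X) ∧
    (∀ e' ∈ insert e X,
      G.Covered σ f ((2 * k - 1 : ℕ) : ℝ≥0∞) (L'.map Prod.fst).toFinset e') ∧
    HasSubgraph G (L'.map Prod.fst) s3 ∧ ∀ e' : Fin m, s3.arr 4 e' ≠ 0 ↔ e' ∈ L'.map Prod.fst)
    ?_ ?_
  · rw [wp_ite, Test.holds_eq, hst2.seven, wp_skip]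
    constructor
    · intro h1
      rcases hres with ⟨-, F, hF⟩ | ⟨h2, -⟩
      swap
      · omega
      refine (wp_addEdge hsub2 hst2.seven q17 q11 q18).mono ?_
      rintro T3 s3 ⟨hT3, hsub3, h4⟩ -
      refine ⟨by omega, (e, F) :: L, by simp, ⟨hI.greedy, heL, hF⟩, ?_, ?_, hsub3, ?_⟩
      · intro e' he'
        rw [List.map_cons, List.mem_cons] at he'
        rcases he' with rfl | he'
        · simp
        · exact Finset.mem_insert_of_mem (hI.subset e' he')
      · intro e' he'
        rcases Finset.mem_insert.1 he' with rfl | he'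
        · refine covered_of_mem (by simp) ?_
          exact_mod_cast (by omega : 1 ≤ 2 * k - 1)
        · refine (hI.covered e' he').mono fun e'' h => ?_
          rw [List.mem_toFinset] at h ⊢
          exact List.mem_cons_of_mem _ h
      · intro e'
        rw [h4, f4, List.map_cons, List.mem_cons, ← hI.output]
        by_cases heq : e' = e
        · simp [heq]
        · rw [Function.update_of_ne fun h => heq (Fin.ext h)]
          simp [heq]
    · intro h1
      rcases hres with ⟨h2, -⟩ | ⟨-, hR⟩
      · exact absurd h2 h1
      refine ⟨by omega, L, le_rfl, hI.greedy, fun e' h => Finset.mem_insert_of_mem (hI.subset e' h),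
        ?_, hsub2, fun e' => by rw [f4, hI.output]⟩
      intro e' he'
      rcases Finset.mem_insert.1 he' with rfl | he'
      · refine hR.covered fun e'' h => ?_
        exact hI.selection.weight_le _ he _ (hI.subset _ (List.mem_toFinset.1 h))
      · exact hI.covered e' he'
  · rintro T3 s3 ⟨hT3, L', hL', hgr, hsubX, hcov, hsub3, hout⟩ hf3
    have hst3 := hst2.frame hf3 (by decide) (by decide)
    have g11 : s3.arr 11 = s.arr 11 :=
      (hf3.arr 11 (by decide)).trans ((hf2.arr 11 (by decide)).trans e11)
    refine (wp_rescan (f := f) (X := X) (D := D) hst3.edges hst3.sources ?_ heX hst3.four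
      hst3.six hst3.seven ((hf3.reg 11 (by decide)).trans q11) ((hf3.reg 17 (by decide)).trans q17)
      ((hf3.reg 18 (by decide)).trans q18)).mono ?_
    · constructor
      · rw [hf3.arr 23 (by decide), hf2.arr 23 (by decide)]
        exact hsel1.done
      · rw [hf3.arr 24 (by decide), hf2.arr 24 (by decide)]
        exact hsel1.count
    · rintro T4 s4 ⟨hT4, hsel4, hlight, h11⟩ hf4
      change T4 ≤ 50 * sourceDegree G e + 10 at hT4
      rw [wp_block_nil]
      refine ⟨by omega, L', hL', hgr, hsubX, hcov, hI.selection.insert he hmin, hsel4,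
        hsub3.frame hf4 (by decide) (by decide), ?_, ?_, ?_, ?_⟩
      · intro u
        by_cases hu : u = G.src e
        · rw [hu]
          exact hlight
        · rw [h11 u fun h => hu (Fin.ext h), g11]
          convert hI.lightest u using 1
          ext e'
          simp only [Set.mem_ofPred_eq, mem_discard, not_or]
          constructor
          · exact fun h => ⟨h.1, h.2.1⟩
          · rintro ⟨rfl, h⟩
            exact ⟨rfl, h, fun h' => hu h'.1.1⟩
      · intro e'
        rw [hf4.arr 4 (by decide)]
        exact hout e'
      · intro i
        rw [hf4.arr 13 (by decide), hf4.reg 25 (by decide), hf3.arr 13 (by decide),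
          hf3.reg 25 (by decide)]
        exact hvis2 i
      · intro i
        rw [hf4.arr 12 (by decide), hf4.reg 22 (by decide), hf3.arr 12 (by decide),
          hf3.reg 22 (by decide)]
        exact hmar2 i

/-- The greedy algorithm: the lightest edge that is left is processed, as long as there is one. -/
def spannerProgram : Program :=
  .block [init, findBest, .while (.lt 6 14) (.block [process, findBest])]

/-- In the end all edges have been tested or discarded. The time is bounded by the sum of the times
for a test, a scan of the edges with the same source, and the search for the next edge, over all
edges that have been tested. -/
theorem wp_spannerProgram (hk : 1 ≤ k) : wp G.weightArr spannerProgram (G.input σ k f) fun T s =>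
    ∃ (act : List (Fin n)) (L : List (Fin m × Finset (Fin q))) (X : Finset (Fin m)),
      act.Nodup ∧ (∀ u, u ∈ act ↔ ∃ e, G.src e = u) ∧ LoopInv G σ k f L X Finset.univ s ∧
      T ≤ 100 * m + 20 * act.length + 20 + ∑ e ∈ X,
        (300 * ((min f m + 2) * (L.length + 1)) + 50 * sourceDegree G e + 20 * act.length +
          60) := by
  unfold spannerProgram
  simp only [wp_block_cons, wp_block_nil]
  refine wp_init.mono ?_
  rintro T1 s1 ⟨hT1, h7, h8, hcodes, act, hS⟩ hf1
  have hst1 : Static G σ k f act s1 := by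
    refine ⟨?_, hcodes, ?_, hS.active, ?_, ?_, ?_, h7, h8⟩
    · exact (hasEdges_input G σ k f).congr fun a ha => hf1.arr a (by revert a; decide)
    · intro u
      simpa using hS.lists u
    · exact hf1.reg 3 (by decide)
    · exact hf1.reg 4 (by decide)
    · exact hf1.reg 6 (by decide)
  have hmem : ∀ u, u ∈ act ↔ ∃ e, G.src e = u := fun u => by simpa using hS.mem_act u
  have hI1 : LoopInv G σ k f [] ∅ ∅ s1 := by
    refine ⟨trivial, by simp, by simp, .empty G f, ⟨?_, ?_⟩, ?_, ?_, ?_, ?_, ?_⟩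
    · rw [hf1.arr 23 (by decide)]
      simp [ColoredGraph.input]
    · rw [hf1.arr 24 (by decide)]
      simp [ColoredGraph.input, parallels]
    · intro x
      exact ⟨[], by rw [hf1.arr 19 (by decide)]; rfl, .nil⟩
    · simpa using hS.lightest
    · rw [hf1.arr 4 (by decide)]
      simp [ColoredGraph.input]
    · rw [hf1.arr 13 (by decide), hf1.reg 25 (by decide)]
      simp [ColoredGraph.input]
    · rw [hf1.arr 12 (by decide), hf1.reg 22 (by decide)]
      simp [ColoredGraph.input]
  -- the candidates of all vertices give the candidate of the graph
  have hbest : ∀ {s s' : State} {L X D}, LoopInv G σ k f L X D s → Frame findBest s s' →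
      IsLightest G {e | ∃ u ∈ act, e ∈ {e | G.src e = u ∧ e ∉ D}} (s'.reg 14) →
      LoopInv G σ k f L X D s' ∧ IsLightest G {e | e ∉ D} (s'.reg 14) := by
    intro s s' L X D hI hf hl
    constructor
    · refine ⟨hI.greedy, hI.subset, hI.covered, hI.selection, ⟨?_, ?_⟩,
        hI.hasSubgraph.frame hf (by decide) (by decide), ?_, ?_, ?_, ?_⟩
      · rw [hf.arr 23 (by decide)]
        exact hI.hasSelection.done
      · rw [hf.arr 24 (by decide)]
        exact hI.hasSelection.count
      · rw [hf.arr 11 (by decide)]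
        exact hI.lightest
      · rw [hf.arr 4 (by decide)]
        exact hI.output
      · rw [hf.arr 13 (by decide), hf.reg 25 (by decide)]
        exact hI.visits
      · rw [hf.arr 12 (by decide), hf.reg 22 (by decide)]
        exact hI.marks
    · convert hl using 1
      ext e
      simp [hmem]
  refine (wp_findBest (S := fun u => {e | G.src e = u ∧ e ∉ (∅ : Finset (Fin m))}) hst1.six
    hst1.active hI1.lightest).mono ?_
  rintro T2 s2 ⟨hT2, hl2⟩ hf2
  obtain ⟨hI2, hl2⟩ := hbest hI1 hf2 hl2
  have hst2 := hst1.frame hf2 (by decide) (by decide)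
  refine (wp_while (j := m) (fun j T s => ∃ L X D, j + X.card = m ∧ LoopInv G σ k f L X D s ∧
    IsLightest G {e | e ∉ D} (s.reg 14) ∧ T ≤ ∑ e ∈ X,
      (300 * ((min f m + 2) * (L.length + 1)) + 50 * sourceDegree G e + 20 * act.length + 60))
    ?_ ?_).mono ?_
  · exact ⟨[], ∅, ∅, by simp, hI2, hl2, by simp⟩
  · rintro j T s3 ⟨L, X, D, hj, hI3, hl3, hT⟩ hf3 hb
    have hst3 := hst2.frame hf3 (by decide) (by decide)
    rw [Test.holds_lt, hst3.six] at hb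
    rcases hl3 with ⟨h14, -⟩ | ⟨e, he, h14, hmin⟩
    · omega
    simp only [wp_block_cons, wp_block_nil]
    refine (wp_process hk hst3 hI3 he hmin h14).mono ?_
    rintro T4 s4 ⟨hT4, L', hL', hI4⟩ hf4
    have hst4 := hst3.frame hf4 (by decide) (by decide)
    refine (wp_findBest (S := fun u => {e' | G.src e' = u ∧ e' ∉ discard G f X D e}) hst4.six
      hst4.active hI4.lightest).mono ?_
    rintro T5 s5 ⟨hT5, hl5⟩ hf5
    obtain ⟨hI5, hl5⟩ := hbest hI4 hf5 hl5
    have heX : e ∉ X := fun h => he (hI3.selection.subset h)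
    have hcard : (insert e X).card ≤ m := by
      simpa using Finset.card_le_univ (insert e X)
    have hmono : 300 * ((min f m + 2) * (L.length + 1)) ≤
        300 * ((min f m + 2) * (L'.length + 1)) := by gcongr
    refine ⟨m - (insert e X).card, ?_, L', insert e X, _, by omega, hI5, hl5, ?_⟩
    · rw [Finset.card_insert_of_notMem heX] at hcard ⊢
      omega
    · rw [Finset.sum_insert heX]
      have : T ≤ ∑ e ∈ X, (300 * ((min f m + 2) * (L'.length + 1)) + 50 * sourceDegree G e +
          20 * act.length + 60) := hT.trans (Finset.sum_le_sum fun e _ => by omega)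
      omega
  · rintro T s3 ⟨j, T', rfl, ⟨L, X, D, hj, hI3, hl3, hT⟩, hf3, hb⟩ -
    have hst3 := hst2.frame hf3 (by decide) (by decide)
    rw [Test.holds_lt, hst3.six] at hb
    have hD : D = Finset.univ := by
      rcases hl3 with ⟨-, hD⟩ | ⟨e, he, h14, hmin⟩
      · ext e
        simpa using Set.ext_iff.1 hD e
      · omega
    subst hD
    exact ⟨act, L, X, hS.nodup, hmem, hI3, by omega⟩

end CFT

namespace CFT

variable {n m q : ℕ} {G : ColoredGraph n m q} {σ : Setting} {k f : ℕ}

/-! ### The running time -/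

/-- The vertices that are incident with an edge of `H`. -/
def touched (G : ColoredGraph n m q) (H : Finset (Fin m)) : Finset (Fin n) :=
  H.image G.src ∪ H.image G.dst

theorem card_touched_le (G : ColoredGraph n m q) (H : Finset (Fin m)) :
    (touched G H).card ≤ 2 * H.card := by
  have h := Finset.card_union_le (H.image G.src) (H.image G.dst)
  have h1 := Finset.card_image_le (s := H) (f := G.src)
  have h2 := Finset.card_image_le (s := H) (f := G.dst)
  unfold touched
  omega

theorem mem_touched_of_joins {t : ℝ≥0∞} {H : Finset (Fin m)} (hH : G.IsFTSpanner σ f t H)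
    (ht : t ≠ ⊤) {e : Fin m} {u v : Fin n} (hj : G.Joins e u v) : u ∈ touched G H := by
  obtain ⟨e', he', w, hj'⟩ := hH.exists_joins ht hj
  rw [touched, Finset.mem_union]
  rcases hj' with ⟨rfl, -⟩ | ⟨-, rfl⟩
  · exact Or.inl (Finset.mem_image_of_mem _ he')
  · exact Or.inr (Finset.mem_image_of_mem _ he')

/-- For a fixed vertex `u`, at most `f + 1` edges are selected between `u` and each other vertex,
hence each edge `e'` is scanned at most `f + 1` times for each possible destination. -/
theorem sum_sourceDegree_le {t : ℝ≥0∞} {H X D : Finset (Fin m)} (hX : Selection G f X D)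
    (hH : G.IsFTSpanner σ f t H) (ht : t ≠ ⊤) :
    ∑ e ∈ X, sourceDegree G e ≤ m * (2 * H.card * (f + 1)) := by
  calc ∑ e ∈ X, sourceDegree G e
      = ∑ e', (X.filter fun e => G.src e' = G.src e).card := by
        simp only [sourceDegree, Finset.card_filter]
        rw [Finset.sum_comm]
    _ ≤ ∑ _e' : Fin m, (touched G H).card * (f + 1) := by
        refine Finset.sum_le_sum fun e' _ => ?_
        rw [mul_comm]
        refine Finset.card_le_mul_card_image_of_maps_to (f := G.dst) (fun e _ => ?_) (f + 1)
          fun v _ => ?_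
        · exact mem_touched_of_joins hH ht (e := e) (v := G.src e) (Or.inr ⟨rfl, rfl⟩)
        · rcases Finset.eq_empty_or_nonempty
            ((X.filter fun e => G.src e' = G.src e).filter fun e => G.dst e = v) with h0 | ⟨e, he⟩
          · simp [h0]
          · simp only [Finset.mem_filter] at he
            refine (Finset.card_le_card fun e₁ h1 => ?_).trans (hX.card_le e)
            simp only [Finset.mem_filter] at h1
            exact mem_parallels.2 ⟨h1.1.1, h1.1.2.symm.trans he.1.2, h1.2.trans he.2.symm⟩
    _ ≤ ∑ _e' : Fin m, 2 * H.card * (f + 1) :=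
        Finset.sum_le_sum fun _ _ => Nat.mul_le_mul_right _ (card_touched_le G H)
    _ = m * (2 * H.card * (f + 1)) := by simp

theorem sourceDegree_le (G : ColoredGraph n m q) (e : Fin m) : sourceDegree G e ≤ m := by
  simpa [sourceDegree] using Finset.card_le_univ (Finset.univ.filter fun e' => G.src e' = G.src e)

/-- The running time in terms of the size of the spanner. -/
theorem time_le_size {t : ℝ≥0∞} {H X D : Finset (Fin m)} {T : ℕ} {act : List (Fin n)} (hf : 1 ≤ f)
    (hX : Selection G f X D) (hH : G.IsFTSpanner σ f t H) (ht : t ≠ ⊤) (hact : act.Nodup)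
    (hmem : ∀ u, u ∈ act ↔ ∃ e, G.src e = u)
    (hT : T ≤ 100 * m + 20 * act.length + 20 + ∑ e ∈ X,
      (300 * ((min f m + 2) * (H.card + 1)) + 50 * sourceDegree G e + 20 * act.length + 60)) :
    T ≤ 5000 * max 1 (m * f * H.card) := by
  have ha : act.length ≤ 2 * H.card := by
    rw [← List.toFinset_card_of_nodup hact]
    refine (Finset.card_le_card fun u hu => ?_).trans (card_touched_le G H)
    obtain ⟨e, rfl⟩ := (hmem u).1 (List.mem_toFinset.1 hu)
    exact mem_touched_of_joins hH ht (e := e) (v := G.dst e) (Or.inl ⟨rfl, rfl⟩)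
  have hXm : X.card ≤ m := by simpa using Finset.card_le_univ X
  rcases Nat.eq_zero_or_pos m with rfl | hm
  · have h0 : X = ∅ := by simpa using hXm
    have h1 : H.card = 0 := by
      have := Finset.card_le_univ H
      simpa using this
    rw [h0, Finset.sum_empty] at hT
    omega
  have hs : 0 < H.card := by
    obtain ⟨e', he', -⟩ := hH.exists_joins ht (e := ⟨0, hm⟩) (Or.inl ⟨rfl, rfl⟩)
    exact Finset.card_pos.2 ⟨e', he'⟩
  have hdeg := sum_sourceDegree_le hX hH ht
  set s := H.card
  rw [Finset.sum_add_distrib, Finset.sum_add_distrib, Finset.sum_add_distrib, Finset.sum_const,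
    Finset.sum_const, Finset.sum_const, smul_eq_mul, smul_eq_mul, smul_eq_mul,
    ← Finset.mul_sum] at hT
  have hfs : 1 ≤ f * s := Nat.mul_pos hf hs
  have hm1 : m ≤ m * (f * s) := Nat.le_mul_of_pos_right _ hfs
  have hf1 : f * s ≤ m * (f * s) := Nat.le_mul_of_pos_left _ hm
  have hsf : s ≤ f * s := Nat.le_mul_of_pos_left _ hf
  have hff : f ≤ f * s := Nat.le_mul_of_pos_right _ hs
  have h1 : X.card * (300 * ((min f m + 2) * (s + 1))) ≤ m * (1800 * (f * s)) := by
    refine Nat.mul_le_mul hXm ?_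
    have : (min f m + 2) * (s + 1) ≤ (f + 2) * (s + 1) :=
      Nat.mul_le_mul_right _ (by omega)
    have h2 : (f + 2) * (s + 1) = f * s + f + 2 * s + 2 := by ring
    omega
  have h2 : X.card * (20 * act.length) ≤ m * (40 * (f * s)) := Nat.mul_le_mul hXm (by omega)
  have h3 : m * (2 * s * (f + 1)) ≤ m * (4 * (f * s)) := by
    refine Nat.mul_le_mul le_rfl ?_
    have : 2 * s * (f + 1) = 2 * (f * s) + 2 * s := by ring
    omega
  have h4 : 1 ≤ m * (f * s) := hm.trans_le hm1
  have e1 : ∀ c, m * (c * (f * s)) = c * (m * (f * s)) := fun c => by ring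
  rw [e1] at h1 h2 h3
  refine le_trans ?_ (Nat.mul_le_mul_left _ (le_max_right _ _))
  rw [mul_assoc m f s]
  omega

/-- The running time in terms of the size of the graph. -/
theorem time_le_poly {H X : Finset (Fin m)} {T : ℕ} {act : List (Fin n)} (hact : act.Nodup)
    (hT : T ≤ 100 * m + 20 * act.length + 20 + ∑ e ∈ X,
      (300 * ((min f m + 2) * (H.card + 1)) + 50 * sourceDegree G e + 20 * act.length + 60)) :
    T ≤ 5000 * (n + m + 1) ^ 3 := by
  have ha : act.length ≤ n := by simpa using hact.length_le_card
  have hXm : X.card ≤ m := by simpa using Finset.card_le_univ X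
  have hHm : H.card ≤ m := by simpa using Finset.card_le_univ H
  set N := n + m + 1 with hN
  have hN1 : 1 ≤ N := by omega
  have hNN : N ≤ N * N := Nat.le_mul_of_pos_left _ hN1
  have hNNN : N * N ≤ N * (N * N) := Nat.le_mul_of_pos_left _ hN1
  have hsum : ∑ e ∈ X, (300 * ((min f m + 2) * (H.card + 1)) + 50 * sourceDegree G e +
      20 * act.length + 60) ≤ N * (1000 * (N * N)) := by
    refine (Finset.sum_le_card_nsmul _ _ (1000 * (N * N)) fun e _ => ?_).trans ?_
    · have h1 : (min f m + 2) * (H.card + 1) ≤ 2 * N * N := Nat.mul_le_mul (by omega) (by omega)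
      have h2 := sourceDegree_le G e
      rw [mul_assoc] at h1
      omega
    · exact Nat.mul_le_mul_right _ (by omega)
  have h1 : N * (1000 * (N * N)) = 1000 * (N * (N * N)) := by ring
  have h2 : N ^ 3 = N * (N * N) := by ring
  omega

end CFT

theorem mainTheorem6 :
    ∃ (P : CFT.Program) (C d : ℕ), ∀ (σ : CFT.Setting) (k f n m q : ℕ), 1 ≤ k → 1 ≤ f →
      ∀ G : CFT.ColoredGraph n m q, ∃ (T : ℕ) (s' : CFT.State) (H : Finset (Fin m)),
        -- the program halts after `T` steps with output `H`
        CFT.Exec G.weightArr P (G.input σ k f) T s' ∧ CFT.output m s' = H ∧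
        -- `H` is an `f`-CFT `(2k-1)`-spanner
        G.IsFTSpanner σ f ((2 * k - 1 : ℕ) : ENNReal) H ∧
        -- size
        (σ = .ECFT → (H.card : ℝ) ≤ C * (k * f * (n : ℝ) ^ (1 + 1 / (k : ℝ)))) ∧
        (σ = .VCFT → (H.card : ℝ) ≤
          C * (k * (f : ℝ) ^ (1 - 1 / (k : ℝ)) * (n : ℝ) ^ (1 + 1 / (k : ℝ)))) ∧
        (σ = .MCFT → (H.card : ℝ) ≤
          C * ((k : ℝ) ^ 2 * (f : ℝ) ^ (2 - 1 / (k : ℝ)) * (n : ℝ) ^ (1 + 1 / (k : ℝ)))) ∧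
        -- running time
        T ≤ C * max 1 (m * f * H.card) ∧
        T ≤ C * (n + m + 1) ^ d ∧
        -- blocking set
        ∃ B : Finset (Fin m × Fin q), G.IsBlockingSet σ (2 * k) H B ∧
          ∀ e ∈ H, (B.filter fun b => b.1 = e).card ≤ 4 * k * f := by
  refine ⟨CFT.spannerProgram, 5000, 3, fun σ k f n m q hk hf G => ?_⟩
  obtain ⟨T, s', hexec, act, L, X, hact, hmem, hI, hT⟩ := CFT.wp_spannerProgram (G := G) (σ := σ)
    (f := f) hk
  have hH : CFT.output m s' = (L.map Prod.fst).toFinset := by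
    ext e
    simp only [CFT.output, Finset.mem_filter, Finset.mem_univ, true_and, List.mem_toFinset]
    exact hI.output e
  have hcard : (CFT.output m s').card = L.length := by
    rw [hH, List.toFinset_card_of_nodup hI.greedy.nodup, List.length_map]
  have hmemH : ∀ e, e ∈ CFT.output m s' ↔ e ∈ L.map Prod.fst := fun e => by
    rw [hH, List.mem_toFinset]
  have hspan : G.IsFTSpanner σ f ((2 * k - 1 : ℕ) : ENNReal) (CFT.output m s') := by
    refine CFT.ColoredGraph.isFTSpanner_of_covered ?_ (ENNReal.natCast_ne_top _) fun e => ?_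
    · exact_mod_cast (by omega : 1 ≤ 2 * k - 1)
    · rw [hH]
      exact hI.selection.covered hI.covered e (Finset.mem_univ e)
  obtain ⟨B, hB, hD⟩ := hI.greedy.exists_blockingSet hmemH
  rw [← hcard] at hT
  refine ⟨T, s', _, hexec, rfl, hspan, ?_, ?_, ?_,
    CFT.time_le_size hf hI.selection hspan (ENNReal.natCast_ne_top _) hact hmem hT,
    CFT.time_le_poly hact hT, B, hB, fun e he => ?_⟩
  · rintro rfl
    exact_mod_cast CFT.ColoredGraph.card_le_of_blocking_ECFT hk hf hB fun e he => by convert hD e he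
  · rintro rfl
    exact_mod_cast CFT.ColoredGraph.card_le_of_blocking_VCFT hk hf hB fun e he => by convert hD e he
  · rintro rfl
    exact_mod_cast CFT.ColoredGraph.card_le_of_blocking_MCFT hk hf hB fun e he => by convert hD e he
  · convert hD e he
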